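/- **Setting.** Let $\Omega\subset\mathbb R^n$ be open, $1<p<\infty$, and let $Q(x)$, $x\in\Omega$, be symmetric nonnegative semidefinite $n\times n$ matrices with $|Q|\in L^{p/2}_{loc}(\Omega)$. $W^{1,p}_Q(\Omega)$ is the completion of the locally Lipschitz functions on $\Omega$ of finite norm $\|w\|_{W^{1,p}_Q(\Omega)}=\big(\int_\Omega|w|^p+\int_\Omega|\sqrt Q\,\nabla w|^p\big)^{1/p}$; its elements are represented by pairs $(w,\nabla w)$, limits of pairs $(w_k,\nabla w_k)$ in this norm. $(W^{1,p}_Q)_0(S)$ is the analogous completion of the Lipschitz functions with compact support in $S$ (norm over $S$). Let $\rho$ be a symmetric quasimetric on $\Omega$ whose balls $B(y,r)=\{z\in\Omega:\rho(y,z)<r\}$ are Lebesgue measurable, and such that for each $x\in\Omega$, $|x-y|\to0$ if $\rho(x,y)\to0$. Let $r_1:\Omega\to(0,\infty)$ be such that $B(y,r)$ has compact closure contained in $\Omega$ whenever $y\in\Omega$, $0<r<r_1(y)$. Write $\|f\|_{\alpha,E}=(\int_E|f|^\alpha)^{1/\alpha}$ and $\|f\|_{\alpha,E}^{av}=(|E|^{-1}\int_E|f|^\alpha)^{1/\alpha}$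 (the essential supremum over $E$ if $\alpha=\infty$). Let $\sigma>1$, $p'=\frac p{p-1}$, $\sigma'=\frac\sigma{\sigma-1}$. Assume, for all balls $B_r=B(y,r)$ with $y\in\Omega$, $0<r<r_1(y)$: 1. (Sobolev) $\|w\|^{av}_{p\sigma,B_r}\le C_{1}\big[r\,\|\sqrt Q\,\nabla w\|^{av}_{p,B_r}+\|w\|^{av}_{p,B_r}\big]$ for all $(w,\nabla w)\in(W^{1,p}_Q)_0(B_r)$. 2. (Cutoffs) For fixed $s^*\in(p\sigma',\infty]$, $\tau\in(0,1)$, $N$, $C_{2}$, there are Lipschitz functions $\eta_1,\eta_2,\dots$ (depending on $B_r$) with $0\le\eta_j\le1$, $\operatorname{supp}\eta_1\subset B_r$, $\eta_j=1$ on $B(y,\tau r)$, $\operatorname{supp}\eta_{j+1}\subset\{x\in B_r:\eta_j(x)=1\}$ and $\|\sqrt Q\,\nabla\eta_j\|^{av}_{s^*,B_r}\le C_{2}N^j/r$ for all $j\ge1$. 3. For some $t,t'\in[1,\infty]$ with $1/t+1/t'=1$: $\|\sqrt Q\,\nabla\eta_j\|_{tp,B_r}<\infty$ for all $j\ge1$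 and these $\eta_j$, and there is $c_2=c_2(B_r)$ with $\|w\|_{pt',B_r}\le c_2\|w\|_{W^{1,p}_Q(\Omega)}$ for all locally Lipschitz $w$ on $\Omega$. 4. (Condition $D_{q^*}$) $0<q^*\le p\sigma'$, $c_0>0$, and $|B_r|\ge c_0r^{q^*}$ if moreover $r<1$. Let $a>1$ and $\gamma,\psi,\delta\in(1,p)$, and let $b,c,d,e,f,g,h\ge0$ be functions on $\Omega$. Suppose that there is $\tilde A:\Omega\times\mathbb R\times\mathbb R^n\to\mathbb R^n$ such that for a.e. $x\in\Omega$ and all $(z,\xi)\in\mathbb R\times\mathbb R^n$ $$A(x,z,\xi)=\sqrt{Q(x)}\,\tilde A(x,z,\xi),\qquad \xi\cdot A(x,z,\xi)\ge a^{-1}|\sqrt{Q(x)}\,\xi|^p-h|z|^\gamma-g,$$ $$|\tilde A(x,z,\xi)|\le a|\sqrt{Q(x)}\,\xi|^{p-1}+b|z|^{\gamma-1}+e,\qquad |B(x,z,\xi)|\le c|\sqrt{Q(x)}\,\xi|^{\psi-1}+d|z|^{\delta-1}+f.$$ Let $(u,\nabla u)\in W^{1,p}_Q(\Omega)$ be a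 weak solution of $\operatorname{div}A(x,u,\nabla u)=B(x,u,\nabla u)$ in $\Omega$: for every Lipschitz $\varphi$ with compact support in $\Omega$, $\nabla\varphi\cdot A(x,u,\nabla u)+\varphi B(x,u,\nabla u)$ is integrable on $\Omega$ with integral $0$. Let $\epsilon>0$, $y\in\Omega$, $0<r<\tau r_1(y)$ and $r\le1$, and suppose that $$b,e\in L^{p'\sigma'}(B(y,r)),\quad c\in L^{p\sigma'(1+\epsilon)}(B(y,r)),\quad d,f,g,h\in L^{\sigma'(1+\epsilon)}(B(y,r)).$$ **Statement.** With $s$ defined by $\frac1s+\frac p{s^*}=1$ (so $1\le s<\sigma$; $s=1$ if $s^*=\infty$), $$\|u\|_{L^\infty(B(y,\tau r))}\le C\left\{\left(\frac1{|B(y,r)|}\int_{B(y,r)}|u|^{sp}\,dx\right)^{\frac1{sp}}+K(y,r)\right\},$$ where the right side is finite and $$K(y,r)=r^{1-\frac{q^*}{p\sigma'}}\Big(\|e+b\|_{p'\sigma',B(y,r)}^{\frac1{p-1}}+r^{\frac{q^*}{p\sigma'}\frac{\epsilon}{1+\epsilon}}\|g+h\|_{\sigma'(1+\epsilon),B(y,r)}^{\frac1p}+r^{\{1-\frac{q^*}{p\sigma'}+\frac{q^*}{\sigma'}\frac{\epsilon}{1+\epsilon}\}\frac1{p-1}}\|f+c+d\|_{\sigma'(1+\epsilon),B(y,r)}^{\frac1{p-1}}\Big).$$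 Here $C$ depends only on $n,p,\sigma,a,\gamma,\psi,\delta,\tau,s^*,N,C_1,C_2,\epsilon,q^*,c_0$ and an upper bound for the norms of $b,c,d,h$ over $B(y,r)$ in the classes above; it does not depend on $u$, $B(y,r)$, $e$, $f$ or $g$. -/

import Mathlib

open MeasureTheory Set Filter Topology
open scoped NNReal ENNReal MatrixOrder

noncomputable section

/-- The Euclidean space of dimension `n`. -/
abbrev Eucl (n : ℕ) : Type := EuclideanSpace ℝ (Fin n)

/-- `√M ξ`, where `√M` is the symmetric nonnegative semidefinite square root of a symmetric
nonnegative semidefinite matrix `M` (given by the continuous functional calculus). -/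
def sqrtMul {n : ℕ} (M : Matrix (Fin n) (Fin n) ℝ) (ξ : Eucl n) : Eucl n :=
  Matrix.toEuclideanLin (CFC.sqrt M) ξ

/-- A symmetric nonnegative semidefinite matrix function on `Ω` with `|Q| ∈ L^{p/2}_loc(Ω)`.
All matrix norms being equivalent, the integrability is stated for the entries. -/
structure IsAdmissibleMatrix {n : ℕ} (Ω : Set (Eucl n)) (p : ℝ)
    (Q : Eucl n → Matrix (Fin n) (Fin n) ℝ) : Prop where
  posSemidef : ∀ x ∈ Ω, (Q x).PosSemidef
  memLp_loc : ∀ K : Set (Eucl n), IsCompact K → K ⊆ Ω → ∀ i j : Fin n,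
    MemLp (fun x => Q x i j) (ENNReal.ofReal (p / 2)) (volume.restrict K)

/-! ### Quasimetric balls -/

/-- The `ρ`-ball with centre `y` and radius `r` in `Ω`. -/
def rhoBall {n : ℕ} (Ω : Set (Eucl n)) (ρ : Eucl n → Eucl n → ℝ) (y : Eucl n) (r : ℝ) :
    Set (Eucl n) :=
  {z | z ∈ Ω ∧ ρ y z < r}

/-- `ρ` is a symmetric quasimetric on `Ω` with Lebesgue measurable balls, such that
`|x - y| → 0` whenever `ρ(x, y) → 0`, for every fixed `x ∈ Ω`. -/
structure IsQuasimetricOn {n : ℕ} (Ω : Set (Eucl n)) (ρ : Eucl n → Eucl n → ℝ) : Prop where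
  nonneg : ∀ x ∈ Ω, ∀ y ∈ Ω, 0 ≤ ρ x y
  eq_zero_iff : ∀ x ∈ Ω, ∀ y ∈ Ω, (ρ x y = 0 ↔ x = y)
  symm : ∀ x ∈ Ω, ∀ y ∈ Ω, ρ x y = ρ y x
  quasi_triangle : ∃ κ : ℝ, 1 ≤ κ ∧
    ∀ x ∈ Ω, ∀ y ∈ Ω, ∀ z ∈ Ω, ρ x y ≤ κ * (ρ x z + ρ y z)
  nullMeasurableSet_ball : ∀ x ∈ Ω, ∀ r : ℝ, 0 < r → NullMeasurableSet (rhoBall Ω ρ x r) volume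
  dist_small : ∀ x ∈ Ω, ∀ ε : ℝ, 0 < ε → ∃ δ : ℝ, 0 < δ ∧ ∀ y ∈ Ω, ρ x y < δ → dist x y < ε

/-- `r₁` is a positive function on `Ω` such that every ball `B(y, r)` with `0 < r < r₁(y)` has
compact closure contained in `Ω`. -/
def IsAdmissibleRadius {n : ℕ} (Ω : Set (Eucl n)) (ρ : Eucl n → Eucl n → ℝ)
    (r₁ : Eucl n → ℝ) : Prop :=
  ∀ y ∈ Ω, 0 < r₁ y ∧ ∀ r : ℝ, 0 < r → r < r₁ y →
    IsCompact (closure (rhoBall Ω ρ y r)) ∧ closure (rhoBall Ω ρ y r) ⊆ Ω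

/-- Condition `D_q` with constant `c₀`: `|B(y, r)| ≥ c₀ r ^ q` whenever `r < min {1, r₁(y)}`. -/
def ConditionD {n : ℕ} (Ω : Set (Eucl n)) (ρ : Eucl n → Eucl n → ℝ) (r₁ : Eucl n → ℝ)
    (q c₀ : ℝ) : Prop :=
  ∀ y ∈ Ω, ∀ r : ℝ, 0 < r → r < min 1 (r₁ y) →
    ENNReal.ofReal (c₀ * r ^ q) ≤ volume (rhoBall Ω ρ y r)

/-! ### Norms and degenerate Sobolev spaces -/

/-- The normalized norm `(|S|⁻¹ ∫_S ‖f‖ ^ α) ^ (1 / α)` (the essential supremum over `S` if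
`α = ∞`). -/
def avgNorm {n : ℕ} {F : Type*} [NormedAddCommGroup F] (f : Eucl n → F) (α : ℝ≥0∞)
    (S : Set (Eucl n)) : ℝ≥0∞ :=
  eLpNorm f α ((volume S)⁻¹ • volume.restrict S)

/-- `(∫_S |w| ^ p + ∫_S |√Q v| ^ p) ^ (1 / p)`, the norm of a pair `(w, v)`. -/
def sobNorm {n : ℕ} (Q : Eucl n → Matrix (Fin n) (Fin n) ℝ) (p : ℝ) (S : Set (Eucl n))
    (w : Eucl n → ℝ) (v : Eucl n → Eucl n) : ℝ≥0∞ :=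
  ((∫⁻ x in S, ‖w x‖ₑ ^ p) + ∫⁻ x in S, ‖sqrtMul (Q x) (v x)‖ₑ ^ p) ^ (1 / p)

/-- Lipschitz functions with compact support contained in `S`. -/
def IsLipZero {n : ℕ} (S : Set (Eucl n)) (φ : Eucl n → ℝ) : Prop :=
  (∃ L : ℝ≥0, LipschitzWith L φ) ∧ HasCompactSupport φ ∧ tsupport φ ⊆ S

/-- `(w, v)` represents an element of `W^{1,p}_Q(Ω)`: it is the limit, in the norm `sobNorm`, of
pairs `(w_k, ∇w_k)` of locally Lipschitz functions of finite norm on `Ω`. -/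
def MemW {n : ℕ} (Q : Eucl n → Matrix (Fin n) (Fin n) ℝ) (p : ℝ) (Ω : Set (Eucl n))
    (w : Eucl n → ℝ) (v : Eucl n → Eucl n) : Prop :=
  AEStronglyMeasurable w (volume.restrict Ω) ∧ AEStronglyMeasurable v (volume.restrict Ω) ∧
  ∃ wk : ℕ → Eucl n → ℝ,
    (∀ k, LocallyLipschitzOn Ω (wk k) ∧ sobNorm Q p Ω (wk k) (gradient (wk k)) < ∞) ∧
    Tendsto (fun k => sobNorm Q p Ω (fun x => wk k x - w x) (fun x => gradient (wk k) x - v x))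
      atTop (𝓝 0)

/-- `(w, v)` represents an element of `(W^{1,p}_Q)_0(S)`: it is the limit, in the norm `sobNorm`,
of pairs `(w_k, ∇w_k)` of Lipschitz functions with compact support in `S`. -/
def MemWZero {n : ℕ} (Q : Eucl n → Matrix (Fin n) (Fin n) ℝ) (p : ℝ) (S : Set (Eucl n))
    (w : Eucl n → ℝ) (v : Eucl n → Eucl n) : Prop :=
  AEStronglyMeasurable w (volume.restrict S) ∧ AEStronglyMeasurable v (volume.restrict S) ∧
  ∃ wk : ℕ → Eucl n → ℝ,
    (∀ k, IsLipZero S (wk k) ∧ sobNorm Q p S (wk k) (gradient (wk k)) < ∞) ∧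
    Tendsto (fun k => sobNorm Q p S (fun x => wk k x - w x) (fun x => gradient (wk k) x - v x))
      atTop (𝓝 0)

/-! ### The axioms: Sobolev estimate, cutoff functions, local integrability -/

/-- The Sobolev estimate with gain `σ` and constant `C`, on all balls `B(y, r)`, `r < r₁(y)`. -/
def SobolevEstimate {n : ℕ} (Ω : Set (Eucl n)) (Q : Eucl n → Matrix (Fin n) (Fin n) ℝ)
    (ρ : Eucl n → Eucl n → ℝ) (r₁ : Eucl n → ℝ) (p σ : ℝ) (C : ℝ≥0) : Prop :=
  ∀ y ∈ Ω, ∀ r : ℝ, 0 < r → r < r₁ y → ∀ (w : Eucl n → ℝ) (v : Eucl n → Eucl n),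
    MemWZero Q p (rhoBall Ω ρ y r) w v →
    avgNorm w (ENNReal.ofReal (p * σ)) (rhoBall Ω ρ y r) ≤
      C * (ENNReal.ofReal r *
          avgNorm (fun x => sqrtMul (Q x) (v x)) (ENNReal.ofReal p) (rhoBall Ω ρ y r)
        + avgNorm w (ENNReal.ofReal p) (rhoBall Ω ρ y r))

/-- `η₁, η₂, …` is an accumulating sequence of Lipschitz cutoff functions for `B(y, r)`. The
value at the index `0` is not used. -/
structure IsCutoffSequence {n : ℕ} (Ω : Set (Eucl n)) (Q : Eucl n → Matrix (Fin n) (Fin n) ℝ)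
    (ρ : Eucl n → Eucl n → ℝ) (τ : ℝ) (sStar : ℝ≥0∞) (N C : ℝ≥0) (y : Eucl n) (r : ℝ)
    (η : ℕ → Eucl n → ℝ) : Prop where
  lipschitz : ∀ j, 1 ≤ j → ∃ L : ℝ≥0, LipschitzWith L (η j)
  support_one : tsupport (η 1) ⊆ rhoBall Ω ρ y r
  bounds : ∀ j, 1 ≤ j → ∀ x, 0 ≤ η j x ∧ η j x ≤ 1
  eq_one : ∀ j, 1 ≤ j → rhoBall Ω ρ y (τ * r) ⊆ {x | x ∈ rhoBall Ω ρ y r ∧ η j x = 1}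
  support_succ : ∀ j, 1 ≤ j → tsupport (η (j + 1)) ⊆ {x | x ∈ rhoBall Ω ρ y r ∧ η j x = 1}
  gradient_bound : ∀ j, 1 ≤ j →
    avgNorm (fun x => sqrtMul (Q x) (gradient (η j) x)) sStar (rhoBall Ω ρ y r) ≤
      (C : ℝ≥0∞) * (N : ℝ≥0∞) ^ j / ENNReal.ofReal r

/-- Every ball `B(y, r)`, `r < r₁(y)`, has an accumulating sequence of Lipschitz cutoff functions
(with common constants), and `√Q ∇η_j ∈ L^{tp}(B(y, r))` for each function of that sequence. -/
def CutoffCondition {n : ℕ} (Ω : Set (Eucl n)) (Q : Eucl n → Matrix (Fin n) (Fin n) ℝ)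
    (ρ : Eucl n → Eucl n → ℝ) (r₁ : Eucl n → ℝ) (p τ : ℝ) (sStar : ℝ≥0∞) (N C : ℝ≥0)
    (t : ℝ≥0∞) : Prop :=
  ∀ y ∈ Ω, ∀ r : ℝ, 0 < r → r < r₁ y → ∃ η : ℕ → Eucl n → ℝ,
    IsCutoffSequence Ω Q ρ τ sStar N C y r η ∧
    ∀ j, 1 ≤ j → eLpNorm (fun x => sqrtMul (Q x) (gradient (η j) x)) (t * ENNReal.ofReal p)
      (volume.restrict (rhoBall Ω ρ y r)) < ∞

/-- For every ball `B(y, r)`, `r < r₁(y)`, there is a constant `c₂` such that the norm of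
`L^{pt'}(B(y, r))` is at most `c₂` times the norm of `W^{1,p}_Q(Ω)` on locally Lipschitz
functions. -/
def LocalIntegrabilityCondition {n : ℕ} (Ω : Set (Eucl n))
    (Q : Eucl n → Matrix (Fin n) (Fin n) ℝ) (ρ : Eucl n → Eucl n → ℝ) (r₁ : Eucl n → ℝ)
    (p : ℝ) (t' : ℝ≥0∞) : Prop :=
  ∀ y ∈ Ω, ∀ r : ℝ, 0 < r → r < r₁ y → ∃ c₂ : ℝ≥0, ∀ w : Eucl n → ℝ, LocallyLipschitzOn Ω w →
    eLpNorm w (ENNReal.ofReal p * t') (volume.restrict (rhoBall Ω ρ y r)) ≤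
      c₂ * sobNorm Q p Ω w (gradient w)

/-! ### The equation -/

/-- The structural conditions on `A` and `B`, with constant `a`, exponents `γ, ψ, δ` and
nonnegative coefficients `b, c, d, e, f, g, h`. -/
def StructuralConditions {n : ℕ} (Ω : Set (Eucl n)) (Q : Eucl n → Matrix (Fin n) (Fin n) ℝ)
    (p a γ ψ δ : ℝ) (b c d e f g h : Eucl n → ℝ)
    (A : Eucl n → ℝ → Eucl n → Eucl n) (B : Eucl n → ℝ → Eucl n → ℝ) : Prop :=
  (∀ x ∈ Ω, 0 ≤ b x ∧ 0 ≤ c x ∧ 0 ≤ d x ∧ 0 ≤ e x ∧ 0 ≤ f x ∧ 0 ≤ g x ∧ 0 ≤ h x) ∧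
  ∃ Atilde : Eucl n → ℝ → Eucl n → Eucl n,
    ∀ᵐ x ∂(volume.restrict Ω), ∀ (z : ℝ) (ξ : Eucl n),
      A x z ξ = sqrtMul (Q x) (Atilde x z ξ) ∧
      a⁻¹ * ‖sqrtMul (Q x) ξ‖ ^ p - h x * |z| ^ γ - g x ≤ inner ℝ ξ (A x z ξ) ∧
      ‖Atilde x z ξ‖ ≤ a * ‖sqrtMul (Q x) ξ‖ ^ (p - 1) + b x * |z| ^ (γ - 1) + e x ∧
      |B x z ξ| ≤ c x * ‖sqrtMul (Q x) ξ‖ ^ (ψ - 1) + d x * |z| ^ (δ - 1) + f x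

/-- The pair `(u, v)`, with `v` in the role of `∇u`, is an element of `W^{1,p}_Q(Ω)` and a weak
solution of `div A(x, u, ∇u) = B(x, u, ∇u)` in `Ω`. -/
def IsWeakSolution {n : ℕ} (Ω : Set (Eucl n)) (Q : Eucl n → Matrix (Fin n) (Fin n) ℝ) (p : ℝ)
    (A : Eucl n → ℝ → Eucl n → Eucl n) (B : Eucl n → ℝ → Eucl n → ℝ)
    (u : Eucl n → ℝ) (v : Eucl n → Eucl n) : Prop :=
  MemW Q p Ω u v ∧
  ∀ φ : Eucl n → ℝ, IsLipZero Ω φ →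
    IntegrableOn
      (fun x => inner ℝ (gradient φ x) (A x (u x) (v x)) + φ x * B x (u x) (v x)) Ω volume ∧
    ∫ x in Ω, (inner ℝ (gradient φ x) (A x (u x) (v x)) + φ x * B x (u x) (v x)) = 0

/-- For functions `e, g, f` on a ball `S` of radius `r`, and with `p' = p/(p-1)`,
`σ' = σ/(σ-1)`, the quantity
`r^{1-q/(pσ')} ( ‖e‖_{p'σ'}^{1/(p-1)} + r^{(q/(pσ')) ε/(1+ε)} ‖g‖_{σ'(1+ε)}^{1/p}
  + r^{(1-q/(pσ')+(q/σ') ε/(1+ε))/(p-1)} ‖f‖_{σ'(1+ε)}^{1/(p-1)} )`,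
all norms being taken over `S`. -/
def remainderK {n : ℕ} (p σ ε q : ℝ) (S : Set (Eucl n)) (r : ℝ) (e g f : Eucl n → ℝ) : ℝ≥0∞ :=
  ENNReal.ofReal (r ^ (1 - q / (p * σ.conjExponent))) *
    (eLpNorm e (ENNReal.ofReal (p.conjExponent * σ.conjExponent)) (volume.restrict S)
        ^ (1 / (p - 1))
      + ENNReal.ofReal (r ^ (q / (p * σ.conjExponent) * (ε / (1 + ε)))) *
        eLpNorm g (ENNReal.ofReal (σ.conjExponent * (1 + ε))) (volume.restrict S) ^ (1 / p)
      + ENNReal.ofReal (r ^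
          ((1 - q / (p * σ.conjExponent) + q / σ.conjExponent * (ε / (1 + ε))) * (1 / (p - 1)))) *
        eLpNorm f (ENNReal.ofReal (σ.conjExponent * (1 + ε))) (volume.restrict S)
          ^ (1 / (p - 1)))

end

/-! ### The degenerate quadratic form -/

/-! The proof is Moser iteration, with Lebesgue measure normalized on `B(y, r)`. Put `k = K(y, r) +
κ` with `κ > 0`, and `U = √(u² + k²)`. Since `U ≥ k`, every lower-order term is at most a new
coefficient times a power of `U` (`mul_rpow_add_le`), so the structural conditions become
homogeneous in `U` and `|√Q ∇u|`. The form of `K(y, r)` and condition `D_{q*}` are exactly what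
bounds the normalized norms of the new coefficients by a constant (`exists_localProblem`).

Testing the equation with `η^p G(u)`, where `G' = (β m^(β-1))^p` and `m` is a truncation of `U`,
gives an energy inequality for a truncated power `H` of `U` (`LocalProblem.eLpNorm_one_energy_le`).
The Sobolev estimate for `ηH` then brings in `‖ηH‖_{pσ}`. By Hölder the coefficient terms contain
the same norm, with a factor that can be made small: for `b`, which has only critical integrability,
through the parameter of Young's inequality; for the other coefficients, through the spare exponent
`1 + ε`. Absorbing them costs a power of `β` (`exists_absorb_const`, `exists_step_const`).

A further Hölder inequality with `√Q ∇η ∈ L^{s*}` turns this into a bound of an `L^{pσ}` norm by an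
`L^{ps}` norm. As `s < σ`, integrability improves by the factor `χ = σ/s`. With `β = χ^j` and the
truncation removed, the constants have a convergent product, which gives the supremum bound for `U`
(`exists_moser_const`); finally `κ → 0`.

Three points need care because `∇u` is only a component of a limit of pairs. Cutoffs times functions
of `u` must lie in `(W^{1,p}_Q)_0` (`memWZero_mul_comp`, the place where assumption 3 enters). The
equation must extend to such test functions (`integral_nonpos_of_isWeakSolution`). Absorption needs
`u ∈ L^{pσ}` on the ball beforehand; this comes from a cutoff function of the larger ball `B(y,
r/τ)` (`MemW.memLp_mul_sigma`), hence the restriction `r < τ r₁(y)`. -/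

lemma sqrtMul_add {n : ℕ} (M : Matrix (Fin n) (Fin n) ℝ) (ξ ζ : Eucl n) :
    sqrtMul M (ξ + ζ) = sqrtMul M ξ + sqrtMul M ζ := by simp [sqrtMul]

lemma sqrtMul_sub {n : ℕ} (M : Matrix (Fin n) (Fin n) ℝ) (ξ ζ : Eucl n) :
    sqrtMul M (ξ - ζ) = sqrtMul M ξ - sqrtMul M ζ := by simp [sqrtMul]

lemma sqrtMul_smul {n : ℕ} (M : Matrix (Fin n) (Fin n) ℝ) (c : ℝ) (ξ : Eucl n) :
    sqrtMul M (c • ξ) = c • sqrtMul M ξ := by simp [sqrtMul]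

lemma sqrtMul_zero {n : ℕ} (M : Matrix (Fin n) (Fin n) ℝ) :
    sqrtMul M (0 : Eucl n) = 0 := by simp [sqrtMul]

lemma inner_sqrtMul {n : ℕ} (M : Matrix (Fin n) (Fin n) ℝ) (ξ ζ : Eucl n) :
    inner ℝ ξ (sqrtMul M ζ) = inner ℝ (sqrtMul M ξ) ζ := by
  have h : (CFC.sqrt M).IsHermitian := (Matrix.nonneg_iff_posSemidef.1 (CFC.sqrt_nonneg M)).1
  have := (Matrix.isSymmetric_toEuclideanLin_iff (𝕜 := ℝ)).2 h
  exact (this ξ ζ).symm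

/-- This expresses `|√M ξ|` through the entries of `M` alone, so that measurability of `|√Q v|`
follows without any measurability of the map `M ↦ √M`. -/
lemma norm_sqrtMul_sq {n : ℕ} {M : Matrix (Fin n) (Fin n) ℝ} (hM : M.PosSemidef) (ξ : Eucl n) :
    ‖sqrtMul M ξ‖ ^ 2 = ∑ i, ∑ j, M i j * ξ i * ξ j := by
  have h1 : sqrtMul M (sqrtMul M ξ) = Matrix.toEuclideanLin M ξ := by
    have h := CFC.sqrt_mul_sqrt_self M hM.nonneg
    unfold sqrtMul
    conv_rhs => rw [← h]
    simp [Matrix.toLpLin_apply, Matrix.mulVec_mulVec]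
  rw [← real_inner_self_eq_norm_sq, ← inner_sqrtMul, h1, PiLp.inner_apply]
  refine Finset.sum_congr rfl fun i _ => ?_
  simp only [Matrix.toLpLin_apply, Matrix.mulVec, dotProduct, RCLike.inner_apply, conj_trivial,
    Finset.sum_mul]
  exact Finset.sum_congr rfl fun j _ => by ring

lemma aemeasurable_norm_sqrtMul {n : ℕ} {μ : Measure (Eucl n)}
    {Q : Eucl n → Matrix (Fin n) (Fin n) ℝ} {v : Eucl n → Eucl n}
    (hpos : ∀ᵐ x ∂μ, (Q x).PosSemidef) (hQ : ∀ i j, AEMeasurable (fun x => Q x i j) μ)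
    (hv : AEMeasurable v μ) : AEMeasurable (fun x => ‖sqrtMul (Q x) (v x)‖) μ := by
  have h1 : AEMeasurable (fun x => √(∑ i, ∑ j, Q x i j * v x i * v x j)) μ := by
    refine AEMeasurable.sqrt ?_
    refine Finset.aemeasurable_fun_sum _ fun i _ => Finset.aemeasurable_fun_sum _ fun j _ => ?_
    have hvi : ∀ i, AEMeasurable (fun x => v x i) μ := fun i =>
      (EuclideanSpace.proj (𝕜 := ℝ) i).continuous.measurable.comp_aemeasurable hv
    exact ((hQ i j).mul (hvi i)).mul (hvi j)
  refine h1.congr ?_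
  filter_upwards [hpos] with x hx
  rw [← norm_sqrtMul_sq hx, Real.sqrt_sq (norm_nonneg _)]

lemma measurable_gradient {n : ℕ} (w : Eucl n → ℝ) : Measurable (gradient w) :=
  (InnerProductSpace.toDual ℝ (Eucl n)).symm.continuous.measurable.comp (measurable_fderiv ℝ w)

lemma gradient_eq_zero_of_notMem_tsupport {n : ℕ} {φ : Eucl n → ℝ} {x : Eucl n}
    (hx : x ∉ tsupport φ) : gradient φ x = 0 := by
  have h : fderiv ℝ φ x = 0 := by
    by_contra h
    exact hx (tsupport_fderiv_subset ℝ (subset_tsupport _ h))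
  rw [gradient, h, map_zero]

/-! ### Lipschitz functions -/

/-- Rademacher's theorem near each point; locally null sets are null because the space is second
countable. -/
lemma LocallyLipschitzOn.ae_differentiableAt {n : ℕ} {Ω : Set (Eucl n)} (hΩ : IsOpen Ω)
    {w : Eucl n → ℝ} (hw : LocallyLipschitzOn Ω w) :
    ∀ᵐ x ∂(volume.restrict Ω), DifferentiableAt ℝ w x := by
  rw [ae_restrict_iff' hΩ.measurableSet, ae_iff]
  refine measure_null_of_locally_null _ fun x hx => ?_
  simp only [Classical.not_imp, mem_ofPred_eq] at hx
  obtain ⟨K, t, ht, hK⟩ := hw hx.1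
  rw [hΩ.nhdsWithin_eq hx.1] at ht
  obtain ⟨U, hUt, hU, hxU⟩ := mem_nhds_iff.1 ht
  have h1 := (hK.mono hUt).ae_differentiableWithinAt_of_mem (μ := (volume : Measure (Eucl n)))
  refine ⟨{a | ¬(a ∈ Ω → DifferentiableAt ℝ w a)} ∩ U,
    inter_mem self_mem_nhdsWithin (mem_nhdsWithin_of_mem_nhds (hU.mem_nhds hxU)), ?_⟩
  refine measure_mono_null ?_ (ae_iff.1 h1)
  rintro z ⟨hz, hzU⟩ hcon
  exact hz fun _ => (hcon hzU).differentiableAt (hU.mem_nhds hzU)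

/-- On a closed ball with radius one more than needed to contain the support, compactness gives a
Lipschitz constant. Outside it, a point is at distance at least one from the support, so the bound
on `|φ|` serves as a Lipschitz constant. -/
lemma exists_lipschitzWith_of_hasCompactSupport {n : ℕ} {φ : Eucl n → ℝ}
    (h : LocallyLipschitz φ) (hc : HasCompactSupport φ) : ∃ L : ℝ≥0, LipschitzWith L φ := by
  obtain ⟨R, hR⟩ := hc.isCompact.isBounded.subset_closedBall (0 : Eucl n)
  set S := Metric.closedBall (0 : Eucl n) (R + 1)
  have hS : IsCompact S := isCompact_closedBall _ _
  obtain ⟨K, hK⟩ := (h.locallyLipschitzOn (s := S)).exists_lipschitzOnWith_of_compact hS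
  obtain ⟨b, hb⟩ := hS.exists_bound_of_continuousOn h.continuous.continuousOn
  have hb' : ∀ x ∈ S, ‖φ x‖ ≤ |b| := fun x hx => (hb x hx).trans (le_abs_self b)
  have hzero : ∀ x, x ∉ Metric.closedBall (0 : Eucl n) R → φ x = 0 := fun x hx =>
    image_eq_zero_of_notMem_tsupport fun hx' => hx (hR hx')
  have key : ∀ x y, x ∈ S → ‖φ x - φ y‖ ≤ (K + |b|) * ‖x - y‖ := by
    intro x y hx
    have h0 : 0 ≤ ‖x - y‖ := norm_nonneg _
    by_cases hy : y ∈ S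
    · have := hK.dist_le_mul x hx y hy
      rw [dist_eq_norm, dist_eq_norm] at this
      nlinarith [abs_nonneg b]
    · have hyR : y ∉ Metric.closedBall (0 : Eucl n) R := fun h' =>
        hy (Metric.closedBall_subset_closedBall (by linarith) h')
      rw [hzero y hyR, sub_zero]
      by_cases hxR : x ∈ Metric.closedBall (0 : Eucl n) R
      · have h1 : 1 ≤ ‖x - y‖ := by
          have h2 : ‖x‖ ≤ R := by simpa using hxR
          have h3 : R + 1 < ‖y‖ := by simpa [S] using hy
          have := norm_sub_norm_le y x
          rw [norm_sub_rev] at this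
          linarith
        have := hb' x hx
        have hK0 : (0 : ℝ) ≤ K := K.2
        nlinarith [abs_nonneg b]
      · rw [hzero x hxR, norm_zero]
        have hK0 : (0 : ℝ) ≤ K := K.2
        positivity
  refine ⟨K + ⟨|b|, abs_nonneg b⟩, LipschitzWith.of_dist_le_mul fun x y => ?_⟩
  rw [dist_eq_norm, dist_eq_norm]
  have hnn : (0 : ℝ) ≤ (K + |b|) * ‖x - y‖ := by
    have hK0 : (0 : ℝ) ≤ K := K.2
    positivity
  change _ ≤ (K + |b|) * ‖x - y‖
  by_cases hx : x ∈ S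
  · exact key x y hx
  by_cases hy : y ∈ S
  · rw [norm_sub_rev, norm_sub_rev x]; exact key y x hy
  have hsub : Metric.closedBall (0 : Eucl n) R ⊆ S :=
    Metric.closedBall_subset_closedBall (by linarith)
  rw [hzero x fun h' => hx (hsub h'), hzero y fun h' => hy (hsub h')]
  simpa using hnn

lemma LocallyLipschitzOn.comp_locallyLipschitz {n : ℕ} {Ω : Set (Eucl n)}
    {w : Eucl n → ℝ} (hw : LocallyLipschitzOn Ω w) {G : ℝ → ℝ} (hG : LocallyLipschitz G) :
    LocallyLipschitzOn Ω (fun x => G (w x)) := by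
  intro x hx
  obtain ⟨K, t, ht, hK⟩ := hw hx
  obtain ⟨K', t', ht', hK'⟩ := hG (w x)
  have hcont : ContinuousWithinAt w Ω x := hw.continuousOn x hx
  refine ⟨K' * K, t ∩ w ⁻¹' t', inter_mem ht (hcont ht'), ?_⟩
  exact hK'.comp (hK.mono inter_subset_left) fun z hz => hz.2

/-- Near the support of `ζ` both factors are bounded and Lipschitz; away from it the product
vanishes. Compactness makes the local constants global. -/
lemma isLipZero_mul {n : ℕ} {Ω S : Set (Eucl n)} (hΩ : IsOpen Ω) (hS : S ⊆ Ω)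
    {ζ w : Eucl n → ℝ} (hζ : IsLipZero S ζ) (hw : LocallyLipschitzOn Ω w) :
    IsLipZero S (fun x => ζ x * w x) := by
  obtain ⟨⟨L, hL⟩, hc, hsupp⟩ := hζ
  have hc' : HasCompactSupport fun x => ζ x * w x := hc.mul_right
  refine ⟨exists_lipschitzWith_of_hasCompactSupport ?_ hc', hc',
    (tsupport_mul_subset_left).trans hsupp⟩
  intro x
  by_cases hx : x ∈ tsupport ζ
  · obtain ⟨K, t, ht, hK⟩ := hw (hS (hsupp hx))
    rw [hΩ.nhdsWithin_eq (hS (hsupp hx))] at ht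
    have hwc : ContinuousAt w x := (hw.continuousOn).continuousAt (hΩ.mem_nhds (hS (hsupp hx)))
    have h1 : ∀ᶠ z in 𝓝 x, |w z| ≤ |w x| + 1 :=
      (hwc.abs.eventually (eventually_lt_nhds (lt_add_one _))).mono fun z hz => le_of_lt hz
    have h2 : ∀ᶠ z in 𝓝 x, |ζ z| ≤ |ζ x| + 1 :=
      (hL.continuous.continuousAt.abs.eventually (eventually_lt_nhds (lt_add_one _))).mono
        fun z hz => le_of_lt hz
    refine ⟨⟨(|w x| + 1) * L + (|ζ x| + 1) * K, by positivity⟩, _, inter_mem ht (h1.and h2),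
      LipschitzOnWith.of_dist_le_mul fun z hz z' hz' => ?_⟩
    have e1 := hL.dist_le_mul z z'
    have e2 := hK.dist_le_mul z hz.1 z' hz'.1
    rw [Real.dist_eq] at e1 e2 ⊢
    change _ ≤ ((|w x| + 1) * L + (|ζ x| + 1) * K) * dist z z'
    have e3 : ζ z * w z - ζ z' * w z' = (ζ z - ζ z') * w z + ζ z' * (w z - w z') := by ring
    rw [e3]
    refine (abs_add_le _ _).trans ?_
    rw [abs_mul, abs_mul]
    have := mul_le_mul e1 hz.2.1 (abs_nonneg _) (by positivity)
    have := mul_le_mul hz'.2.2 e2 (abs_nonneg _) (by positivity)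
    nlinarith
  · refine ⟨0, (tsupport ζ)ᶜ, (isClosed_tsupport ζ).isOpen_compl.mem_nhds hx,
      LipschitzOnWith.of_dist_le_mul fun z hz z' hz' => ?_⟩
    simp [image_eq_zero_of_notMem_tsupport hz, image_eq_zero_of_notMem_tsupport hz']

lemma gradient_mul_comp {n : ℕ} {ζ w : Eucl n → ℝ} {G G' : ℝ → ℝ} {x : Eucl n}
    (hζ : DifferentiableAt ℝ ζ x) (hw : DifferentiableAt ℝ w x) (hG : ∀ z, HasDerivAt G (G' z) z) :
    gradient (fun x => ζ x * G (w x)) x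
      = G (w x) • gradient ζ x + (ζ x * G' (w x)) • gradient w x := by
  have h1 : HasFDerivAt (fun x => G (w x)) (G' (w x) • fderiv ℝ w x) x :=
    (hG (w x)).comp_hasFDerivAt x hw.hasFDerivAt
  have h2 := hζ.hasFDerivAt.mul h1
  have h3 : fderiv ℝ (fun x => ζ x * G (w x)) x = _ := h2.fderiv
  unfold gradient
  rw [h3, map_add, map_smulₛₗ, map_smulₛₗ, map_smulₛₗ]
  simp [smul_smul, add_comm]

lemma gradient_sub {n : ℕ} {w w' : Eucl n → ℝ} {x : Eucl n}
    (hw : DifferentiableAt ℝ w x) (hw' : DifferentiableAt ℝ w' x) :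
    gradient (fun x => w x - w' x) x = gradient w x - gradient w' x := by
  unfold gradient
  rw [fderiv_fun_sub hw hw', map_sub]

/-! ### The Sobolev norm of pairs -/

section SobNorm

variable {n : ℕ} {Ω S : Set (Eucl n)} {Q : Eucl n → Matrix (Fin n) (Fin n) ℝ} {p : ℝ}

lemma eLpNorm_ofReal_eq {α F : Type*} [MeasurableSpace α] {μ : Measure α} [NormedAddCommGroup F]
    (hp : 0 < p) (f : α → F) :
    eLpNorm f (ENNReal.ofReal p) μ = (∫⁻ x, ‖f x‖ₑ ^ p ∂μ) ^ (1 / p) := by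
  rw [eLpNorm_eq_lintegral_rpow_enorm_toReal (by simpa using hp) ENNReal.ofReal_ne_top,
    ENNReal.toReal_ofReal hp.le]

lemma sobNorm_eq (hp : 0 < p) (w : Eucl n → ℝ) (v : Eucl n → Eucl n) :
    sobNorm Q p S w v = (eLpNorm w (ENNReal.ofReal p) (volume.restrict S) ^ p +
      eLpNorm (fun x => ‖sqrtMul (Q x) (v x)‖) (ENNReal.ofReal p) (volume.restrict S) ^ p)
        ^ (1 / p) := by
  rw [eLpNorm_norm, eLpNorm_ofReal_eq hp, eLpNorm_ofReal_eq hp, ← ENNReal.rpow_mul,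
    ← ENNReal.rpow_mul, one_div_mul_cancel hp.ne', ENNReal.rpow_one, ENNReal.rpow_one, sobNorm]

lemma eLpNorm_le_sobNorm (hp : 0 < p) (w : Eucl n → ℝ) (v : Eucl n → Eucl n) :
    eLpNorm w (ENNReal.ofReal p) (volume.restrict S) ≤ sobNorm Q p S w v := by
  rw [sobNorm_eq hp, one_div, ENNReal.le_rpow_inv_iff hp]
  exact le_self_add

lemma eLpNorm_sqrtMul_le_sobNorm (hp : 0 < p) (w : Eucl n → ℝ) (v : Eucl n → Eucl n) :
    eLpNorm (fun x => ‖sqrtMul (Q x) (v x)‖) (ENNReal.ofReal p) (volume.restrict S)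
      ≤ sobNorm Q p S w v := by
  rw [sobNorm_eq hp, one_div, ENNReal.le_rpow_inv_iff hp]
  exact le_add_self

lemma sobNorm_le_add (hp : 1 ≤ p) (w : Eucl n → ℝ) (v : Eucl n → Eucl n) :
    sobNorm Q p S w v ≤ eLpNorm w (ENNReal.ofReal p) (volume.restrict S) +
      eLpNorm (fun x => ‖sqrtMul (Q x) (v x)‖) (ENNReal.ofReal p) (volume.restrict S) := by
  rw [sobNorm_eq (by linarith), one_div, ENNReal.rpow_inv_le_iff (by linarith)]
  exact ENNReal.add_rpow_le_rpow_add _ _ hp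

lemma sobNorm_congr {w w' : Eucl n → ℝ} {v v' : Eucl n → Eucl n}
    (hw : w =ᵐ[volume.restrict S] w') (hv : v =ᵐ[volume.restrict S] v') :
    sobNorm Q p S w v = sobNorm Q p S w' v' := by
  unfold sobNorm
  congr 2
  · exact lintegral_congr_ae (by filter_upwards [hw] with x hx; rw [hx])
  · exact lintegral_congr_ae (by filter_upwards [hv] with x hx; rw [hx])

/-- An open set is a countable union of compact sets, on each of which the entry belongs to
`L^{p/2}`. -/
lemma IsAdmissibleMatrix.aemeasurable_entry (hQ : IsAdmissibleMatrix Ω p Q) (hΩ : IsOpen Ω)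
    (i j : Fin n) : AEMeasurable (fun x => Q x i j) (volume.restrict Ω) := by
  obtain ⟨F, hF, hFΩ, hU, -⟩ := hΩ.exists_iUnion_isClosed
  have h1 : (⋃ k : ℕ × ℕ, F k.1 ∩ Metric.closedBall 0 (k.2 : ℝ)) = Ω := by
    rw [← hU]
    ext x
    simp only [mem_iUnion, mem_inter_iff, Prod.exists]
    constructor
    · rintro ⟨a, b, h, -⟩; exact ⟨a, h⟩
    · rintro ⟨a, h⟩
      obtain ⟨b, hb⟩ := exists_nat_ge ‖x‖
      exact ⟨a, b, h, by simpa using hb⟩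
  rw [← h1, aemeasurable_iUnion_iff]
  intro k
  exact (hQ.memLp_loc _ ((isCompact_closedBall _ _).inter_left (hF k.1))
    (inter_subset_left.trans (hFΩ k.1)) i j).1.aemeasurable

lemma IsAdmissibleMatrix.aemeasurable_norm (hQ : IsAdmissibleMatrix Ω p Q) (hΩ : IsOpen Ω)
    (hS : S ⊆ Ω) {v : Eucl n → Eucl n} (hv : AEStronglyMeasurable v (volume.restrict S)) :
    AEMeasurable (fun x => ‖sqrtMul (Q x) (v x)‖) (volume.restrict S) := by
  refine aemeasurable_norm_sqrtMul ?_ (fun i j => (hQ.aemeasurable_entry hΩ i j).mono_measure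
    (Measure.restrict_mono hS le_rfl)) hv.aemeasurable
  exact ae_mono (Measure.restrict_mono hS le_rfl)
    ((ae_restrict_mem hΩ.measurableSet).mono fun x hx => hQ.posSemidef x hx)

lemma aestronglyMeasurable_gradient (w : Eucl n → ℝ) :
    AEStronglyMeasurable (gradient w) (volume.restrict S) :=
  (measurable_gradient w).aestronglyMeasurable

lemma ENNReal.one_le_ofReal_of_one_le (hp : 1 ≤ p) : 1 ≤ ENNReal.ofReal p := by simpa using hp

/-- A triangle inequality with a crude factor `2`, which comes from comparing the `ℓ^p` combination
of the two norms with their sum. Only smallness and finiteness are drawn from it. -/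
lemma sobNorm_sub_le (hp : 1 ≤ p) (hQ : IsAdmissibleMatrix Ω p Q) (hΩ : IsOpen Ω) (hS : S ⊆ Ω)
    {w w' u : Eucl n → ℝ} {v v' z : Eucl n → Eucl n}
    (hw : AEStronglyMeasurable w (volume.restrict S))
    (hw' : AEStronglyMeasurable w' (volume.restrict S))
    (hu : AEStronglyMeasurable u (volume.restrict S))
    (hv : AEStronglyMeasurable v (volume.restrict S))
    (hv' : AEStronglyMeasurable v' (volume.restrict S))
    (hz : AEStronglyMeasurable z (volume.restrict S)) :
    sobNorm Q p S (fun x => w x - w' x) (fun x => v x - v' x) ≤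
      2 * (sobNorm Q p S (fun x => w x - u x) (fun x => v x - z x) +
        sobNorm Q p S (fun x => w' x - u x) (fun x => v' x - z x)) := by
  have hp0 : 0 < p := by linarith
  have h1 : eLpNorm (fun x => w x - w' x) (ENNReal.ofReal p) (volume.restrict S) ≤
      eLpNorm (fun x => w x - u x) (ENNReal.ofReal p) (volume.restrict S) +
      eLpNorm (fun x => w' x - u x) (ENNReal.ofReal p) (volume.restrict S) := by
    have : (fun x => w x - w' x) = (fun x => w x - u x) - fun x => w' x - u x := by
      ext x; simp
    rw [this]
    exact eLpNorm_sub_le (hw.sub hu) (hw'.sub hu) (ENNReal.one_le_ofReal_of_one_le hp)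
  have h2 : eLpNorm (fun x => ‖sqrtMul (Q x) (v x - v' x)‖) (ENNReal.ofReal p)
        (volume.restrict S) ≤
      eLpNorm (fun x => ‖sqrtMul (Q x) (v x - z x)‖) (ENNReal.ofReal p) (volume.restrict S) +
      eLpNorm (fun x => ‖sqrtMul (Q x) (v' x - z x)‖) (ENNReal.ofReal p)
        (volume.restrict S) := by
    refine le_trans (eLpNorm_mono_real fun x => ?_) (eLpNorm_add_le
      (hQ.aemeasurable_norm hΩ hS (hv.sub hz)).aestronglyMeasurable
      (hQ.aemeasurable_norm hΩ hS (hv'.sub hz)).aestronglyMeasurable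
      (ENNReal.one_le_ofReal_of_one_le hp))
    have : v x - v' x = (v x - z x) - (v' x - z x) := by abel
    rw [norm_norm, this, sqrtMul_sub]
    exact norm_sub_le _ _
  refine (sobNorm_le_add hp _ _).trans ((add_le_add h1 h2).trans ?_)
  rw [two_mul]
  have e1 := eLpNorm_le_sobNorm (Q := Q) (S := S) hp0 (fun x => w x - u x) fun x => v x - z x
  have e2 := eLpNorm_le_sobNorm (Q := Q) (S := S) hp0 (fun x => w' x - u x) fun x => v' x - z x
  have e3 := eLpNorm_sqrtMul_le_sobNorm (Q := Q) (S := S) hp0 (fun x => w x - u x)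
    fun x => v x - z x
  have e4 := eLpNorm_sqrtMul_le_sobNorm (Q := Q) (S := S) hp0 (fun x => w' x - u x)
    fun x => v' x - z x
  exact add_le_add (add_le_add e1 e2) (add_le_add e3 e4)

lemma sobNorm_gradient_sub (hΩ : IsOpen Ω) (hS : S ⊆ Ω) {w w' : Eucl n → ℝ}
    (hw : LocallyLipschitzOn Ω w) (hw' : LocallyLipschitzOn Ω w') :
    sobNorm Q p S (fun x => w x - w' x) (gradient fun x => w x - w' x) =
      sobNorm Q p S (fun x => w x - w' x) fun x => gradient w x - gradient w' x := by
  refine sobNorm_congr ae_eq_rfl (ae_mono (Measure.restrict_mono hS le_rfl) ?_)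
  filter_upwards [hw.ae_differentiableAt hΩ, hw'.ae_differentiableAt hΩ] with x hx hx'
  exact gradient_sub hx hx'

lemma eLpNorm_lt_top_of_sobNorm_sub_lt_top (hp : 1 ≤ p) (hQ : IsAdmissibleMatrix Ω p Q)
    (hΩ : IsOpen Ω) (hS : S ⊆ Ω) {w u : Eucl n → ℝ} {v : Eucl n → Eucl n}
    (hw : AEStronglyMeasurable w (volume.restrict S))
    (hu : AEStronglyMeasurable u (volume.restrict S))
    (hv : AEStronglyMeasurable v (volume.restrict S))
    (h1 : sobNorm Q p S w (gradient w) < ∞)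
    (h2 : sobNorm Q p S (fun x => w x - u x) (fun x => gradient w x - v x) < ∞) :
    eLpNorm u (ENNReal.ofReal p) (volume.restrict S) < ∞ ∧
    eLpNorm (fun x => ‖sqrtMul (Q x) (v x)‖) (ENNReal.ofReal p) (volume.restrict S) < ∞ := by
  have hp0 : 0 < p := by linarith
  constructor
  · have : u = w - fun x => w x - u x := by ext x; simp
    rw [this]
    refine (eLpNorm_sub_le hw (hw.sub hu) (ENNReal.one_le_ofReal_of_one_le hp)).trans_lt ?_
    exact ENNReal.add_lt_top.2 ⟨(eLpNorm_le_sobNorm hp0 _ _).trans_lt h1,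
      (eLpNorm_le_sobNorm hp0 _ _).trans_lt h2⟩
  · refine lt_of_le_of_lt (le_trans (eLpNorm_mono_real fun x => ?_) (eLpNorm_add_le
      (hQ.aemeasurable_norm hΩ hS (aestronglyMeasurable_gradient w)).aestronglyMeasurable
      (hQ.aemeasurable_norm hΩ hS
        ((aestronglyMeasurable_gradient w).sub hv)).aestronglyMeasurable
      (ENNReal.one_le_ofReal_of_one_le hp))) (ENNReal.add_lt_top.2
      ⟨(eLpNorm_sqrtMul_le_sobNorm hp0 _ _).trans_lt h1,
        (eLpNorm_sqrtMul_le_sobNorm hp0 _ _).trans_lt h2⟩)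
    have : v x = gradient w x - (gradient w x - v x) := by abel
    rw [norm_norm]
    conv_lhs => rw [this, sqrtMul_sub]
    exact norm_sub_le _ _

lemma MemW.eLpNorm_lt_top (hp : 1 ≤ p) (hQ : IsAdmissibleMatrix Ω p Q) (hΩ : IsOpen Ω)
    {u : Eucl n → ℝ} {v : Eucl n → Eucl n} (h : MemW Q p Ω u v) :
    eLpNorm u (ENNReal.ofReal p) (volume.restrict Ω) < ∞ ∧
    eLpNorm (fun x => ‖sqrtMul (Q x) (v x)‖) (ENNReal.ofReal p) (volume.restrict Ω) < ∞ := by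
  obtain ⟨hu, hv, wk, hwk, hlim⟩ := h
  obtain ⟨k, hk⟩ := (hlim.eventually (gt_mem_nhds one_pos)).exists
  exact eLpNorm_lt_top_of_sobNorm_sub_lt_top hp hQ hΩ le_rfl
    ((hwk k).1.continuousOn.aestronglyMeasurable hΩ.measurableSet) hu hv (hwk k).2
    (hk.trans ENNReal.one_lt_top)

lemma MemWZero.eLpNorm_lt_top (hp : 1 ≤ p) (hQ : IsAdmissibleMatrix Ω p Q) (hΩ : IsOpen Ω)
    (hS : S ⊆ Ω) {u : Eucl n → ℝ} {v : Eucl n → Eucl n} (h : MemWZero Q p S u v) :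
    eLpNorm u (ENNReal.ofReal p) (volume.restrict S) < ∞ ∧
    eLpNorm (fun x => ‖sqrtMul (Q x) (v x)‖) (ENNReal.ofReal p) (volume.restrict S) < ∞ := by
  obtain ⟨hu, hv, wk, hwk, hlim⟩ := h
  obtain ⟨k, hk⟩ := (hlim.eventually (gt_mem_nhds one_pos)).exists
  obtain ⟨L, hL⟩ := (hwk k).1.1
  exact eLpNorm_lt_top_of_sobNorm_sub_lt_top hp hQ hΩ hS hL.continuous.aestronglyMeasurable hu hv
    (hwk k).2 (hk.trans ENNReal.one_lt_top)

end SobNorm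

/-! ### Products of cutoff functions and compositions -/

lemma eLpNorm_mul_le_of_inv_add_inv {α : Type*} [MeasurableSpace α] {μ : Measure α}
    {f g : α → ℝ} {p q r : ℝ≥0∞} (hf : AEStronglyMeasurable f μ) (hg : AEStronglyMeasurable g μ)
    (h : p⁻¹ + q⁻¹ = r⁻¹) :
    eLpNorm (fun x => f x * g x) r μ ≤ eLpNorm f p μ * eLpNorm g q μ := by
  have : ENNReal.HolderTriple p q r := ⟨h⟩
  simpa using eLpNorm_le_eLpNorm_mul_eLpNorm_of_nnnorm (p := p) (q := q) (r := r) hf hg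
    (fun a b => a * b) 1 (Eventually.of_forall fun x => by simp)

lemma inv_add_inv_mul_ofReal {p : ℝ} (hp : 0 < p) {t t' : ℝ≥0∞} (h : t⁻¹ + t'⁻¹ = 1) :
    (t * ENNReal.ofReal p)⁻¹ + (ENNReal.ofReal p * t')⁻¹ = (ENNReal.ofReal p)⁻¹ := by
  have h0 : ENNReal.ofReal p ≠ 0 := by simpa using hp
  rw [ENNReal.mul_inv (Or.inr ENNReal.ofReal_ne_top) (Or.inr h0),
    ENNReal.mul_inv (Or.inl h0) (Or.inl ENNReal.ofReal_ne_top), mul_comm t⁻¹, ← mul_add, h,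
    mul_one]

lemma abs_sub_le_of_hasDerivAt {G G' : ℝ → ℝ} (hG : ∀ z, HasDerivAt G (G' z) z) {Λ : ℝ≥0}
    (hb : ∀ z, |G' z| ≤ Λ) (z z' : ℝ) : |G z - G z'| ≤ Λ * |z - z'| := by
  have := (lipschitzWith_of_nnnorm_deriv_le (C := Λ) (fun z => (hG z).differentiableAt)
    fun z => by rw [(hG z).deriv]; exact_mod_cast hb z).dist_le_mul z z'
  simpa [Real.dist_eq] using this

lemma locallyLipschitz_of_hasDerivAt {G G' : ℝ → ℝ} (hG : ∀ z, HasDerivAt G (G' z) z) {Λ : ℝ≥0}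
    (hb : ∀ z, |G' z| ≤ Λ) : LocallyLipschitz G :=
  (lipschitzWith_of_nnnorm_deriv_le (C := Λ) (fun z => (hG z).differentiableAt)
    fun z => by rw [(hG z).deriv]; exact_mod_cast hb z).locallyLipschitz

lemma tendsto_eLpNorm_of_dominated {α : Type*} [MeasurableSpace α] {μ : Measure α} {p : ℝ}
    (hp : 0 < p) {f : ℕ → α → ℝ} {g : α → ℝ} (hf : ∀ k, AEStronglyMeasurable (f k) μ)
    (hg : eLpNorm g (ENNReal.ofReal p) μ < ∞) (hfg : ∀ k, ∀ᵐ x ∂μ, ‖f k x‖ ≤ ‖g x‖)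
    (hlim : ∀ᵐ x ∂μ, Tendsto (fun k => f k x) atTop (𝓝 0)) :
    Tendsto (fun k => eLpNorm (f k) (ENNReal.ofReal p) μ) atTop (𝓝 0) := by
  have h1 : Tendsto (fun k => ∫⁻ x, ‖f k x‖ₑ ^ p ∂μ) atTop (𝓝 (∫⁻ _, 0 ∂μ)) := by
    refine tendsto_lintegral_of_dominated_convergence' (fun x => ‖g x‖ₑ ^ p)
      (fun k => (hf k).enorm.pow_const p) (fun k => ?_) ?_ ?_
    · filter_upwards [hfg k] with x hx
      exact ENNReal.rpow_le_rpow (enorm_le_iff_norm_le.2 hx) hp.le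
    · rw [eLpNorm_ofReal_eq hp, ENNReal.rpow_lt_top_iff_of_pos (by positivity)] at hg
      exact hg.ne
    · filter_upwards [hlim] with x hx
      have := (continuous_enorm.tendsto (0 : ℝ)).comp hx
      have h2 := (ENNReal.continuous_rpow_const (y := p)).continuousAt.tendsto.comp this
      simpa [hp, Function.comp_def] using h2
  simp_rw [eLpNorm_ofReal_eq hp]
  have := (ENNReal.continuous_rpow_const (y := 1 / p)).continuousAt.tendsto.comp h1
  simpa [hp, Function.comp_def] using this

section Product

variable {n : ℕ} {Ω S : Set (Eucl n)} {Q : Eucl n → Matrix (Fin n) (Fin n) ℝ} {p : ℝ}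
  {t t' : ℝ≥0∞}

/-- Assumption 3 speaks of locally Lipschitz functions only. It is applied to `wk k - wk m`, and
Fatou's lemma as `m → ∞` carries it over to `wk k - u`. -/
lemma eLpNorm_sub_le_of_localIntegrability (hp : 1 < p) (hΩ : IsOpen Ω)
    (hQ : IsAdmissibleMatrix Ω p Q) (hSΩ : S ⊆ Ω)
    {c₂ : ℝ≥0} (hloc : ∀ w : Eucl n → ℝ, LocallyLipschitzOn Ω w →
      eLpNorm w (ENNReal.ofReal p * t') (volume.restrict S) ≤ c₂ * sobNorm Q p Ω w (gradient w))
    {u : Eucl n → ℝ} {v : Eucl n → Eucl n} (hu : AEStronglyMeasurable u (volume.restrict Ω))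
    (hv : AEStronglyMeasurable v (volume.restrict Ω)) {wk : ℕ → Eucl n → ℝ}
    (hwk : ∀ k, LocallyLipschitzOn Ω (wk k))
    (hlim : Tendsto (fun k => sobNorm Q p Ω (fun x => wk k x - u x)
      (fun x => gradient (wk k) x - v x)) atTop (𝓝 0))
    (hae : ∀ᵐ x ∂(volume.restrict S), Tendsto (fun k => wk k x) atTop (𝓝 (u x))) (k : ℕ) :
    eLpNorm (fun x => wk k x - u x) (ENNReal.ofReal p * t') (volume.restrict S) ≤
      c₂ * (2 * (2 * sobNorm Q p Ω (fun x => wk k x - u x)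
        (fun x => gradient (wk k) x - v x))) := by
  set a := fun k => sobNorm Q p Ω (fun x => wk k x - u x) (fun x => gradient (wk k) x - v x)
    with ha
  have hm : ∀ k, AEStronglyMeasurable (wk k) (volume.restrict Ω) := fun k =>
    (hwk k).continuousOn.aestronglyMeasurable hΩ.measurableSet
  have hmono : volume.restrict S ≤ volume.restrict Ω := Measure.restrict_mono hSΩ le_rfl
  rcases eq_or_ne (a k) 0 with h0 | h0
  · have h1 : (fun x => wk k x - u x) =ᵐ[volume.restrict S] 0 := by
      have h2 := (eLpNorm_le_sobNorm (Q := Q) (S := Ω) (p := p) (by linarith)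
        (fun x => wk k x - u x) (fun x => gradient (wk k) x - v x)).trans_eq h0
      have h3 := (eLpNorm_eq_zero_iff ((hm k).sub hu) (by simpa using hp.trans' one_pos)).1
        (le_antisymm h2 (zero_le))
      exact ae_mono hmono h3
    rw [eLpNorm_congr_ae h1, eLpNorm_zero]
    exact zero_le
  · refine Lp.eLpNorm_le_of_ae_tendsto (u := atTop) (f := fun m x => wk k x - wk m x) ?_
      (fun m => ((hm k).sub (hm m)).mono_measure hmono) ?_
    -- As `a k > 0`, eventually `a m < a k`; this is where one factor `2` comes from, and why `a k =
    -- 0` was treated apart.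
    · filter_upwards [hlim.eventually (gt_mem_nhds (pos_iff_ne_zero.2 h0))] with m hm'
      have hL : LocallyLipschitzOn Ω fun x => wk k x - wk m x := by
        intro x hx
        obtain ⟨K, s, hs, hK⟩ := hwk k hx
        obtain ⟨K', s', hs', hK'⟩ := hwk m hx
        exact ⟨K + K', s ∩ s', inter_mem hs hs',
          (hK.mono inter_subset_left).sub (hK'.mono inter_subset_right)⟩
      refine (hloc _ hL).trans ?_
      rw [sobNorm_gradient_sub hΩ le_rfl (hwk k) (hwk m)]
      gcongr
      refine (sobNorm_sub_le hp.le hQ hΩ le_rfl (hm k) (hm m) hu (aestronglyMeasurable_gradient _)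
        (aestronglyMeasurable_gradient _) hv).trans ?_
      rw [two_mul (sobNorm Q p Ω _ _)]
      gcongr
    · filter_upwards [hae] with x hx
      exact tendsto_const_nhds.sub hx

/-- The approximants are `ζ G(w_k)`, with `w_k → u` in the Sobolev norm and, along a subsequence,
almost everywhere. The difference of gradients has three parts. In `(G(w_k) - G(u)) ∇ζ`, Hölder
pairs `√Q ∇ζ ∈ L^{tp}` with `w_k - u → 0` in `L^{pt'}`. The part with `∇w_k - v` is bounded times a
null sequence. The part with `G'(w_k) - G'(u)` tends to zero by dominated convergence. -/
theorem memWZero_mul_comp (hp : 1 < p) (hΩ : IsOpen Ω) (hQ : IsAdmissibleMatrix Ω p Q)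
    (hSΩ : S ⊆ Ω) (hSfin : volume S < ∞) (htt : t⁻¹ + t'⁻¹ = 1)
    (hloc : ∃ c₂ : ℝ≥0, ∀ w : Eucl n → ℝ, LocallyLipschitzOn Ω w →
      eLpNorm w (ENNReal.ofReal p * t') (volume.restrict S) ≤ c₂ * sobNorm Q p Ω w (gradient w))
    {ζ : Eucl n → ℝ} (hζ : IsLipZero S ζ)
    (hζt : eLpNorm (fun x => ‖sqrtMul (Q x) (gradient ζ x)‖) (t * ENNReal.ofReal p)
      (volume.restrict S) < ∞)
    {u : Eucl n → ℝ} {v : Eucl n → Eucl n} (hu : MemW Q p Ω u v) {G G' : ℝ → ℝ}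
    (hG : ∀ z, HasDerivAt G (G' z) z) (hGc : Continuous G') {Λ : ℝ≥0} (hGb : ∀ z, |G' z| ≤ Λ) :
    MemWZero Q p S (fun x => ζ x * G (u x))
      (fun x => G (u x) • gradient ζ x + (ζ x * G' (u x)) • v x) := by
  have hp0 : 0 < p := by linarith
  have hmono : volume.restrict S ≤ volume.restrict Ω := Measure.restrict_mono hSΩ le_rfl
  obtain ⟨hV1, hV2⟩ := hu.eLpNorm_lt_top hp.le hQ hΩ
  obtain ⟨hum, hvm, wk₀, hwk₀, hlim₀⟩ := hu
  obtain ⟨c₂, hloc⟩ := hloc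
  obtain ⟨⟨L, hL⟩, hζc, hζs⟩ := id hζ
  have hGcont : Continuous G := continuous_iff_continuousAt.2 fun z => (hG z).continuousAt
  have : IsFiniteMeasure (volume.restrict S) := ⟨by simpa using hSfin⟩
  -- pass to an almost everywhere convergent subsequence
  obtain ⟨ns, hns, hae₀⟩ : ∃ ns : ℕ → ℕ, StrictMono ns ∧
      ∀ᵐ x ∂(volume.restrict Ω), Tendsto (fun i => wk₀ (ns i) x) atTop (𝓝 (u x)) := by
    refine (tendstoInMeasure_of_tendsto_eLpNorm (p := ENNReal.ofReal p) (by simpa using hp0)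
      (fun k => (hwk₀ k).1.continuousOn.aestronglyMeasurable hΩ.measurableSet) hum
      ?_).exists_seq_tendsto_ae
    exact tendsto_of_tendsto_of_tendsto_of_le_of_le tendsto_const_nhds hlim₀
      (fun _ => zero_le) (fun k => eLpNorm_le_sobNorm hp0 _ _)
  set wk := fun i => wk₀ (ns i)
  have hwL : ∀ k, LocallyLipschitzOn Ω (wk k) := fun k => (hwk₀ (ns k)).1
  have hlim := hlim₀.comp hns.tendsto_atTop
  have hae : ∀ᵐ x ∂(volume.restrict S), Tendsto (fun k => wk k x) atTop (𝓝 (u x)) :=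
    ae_mono hmono hae₀
  have hwm : ∀ k, AEStronglyMeasurable (wk k) (volume.restrict S) := fun k =>
    ((hwL k).continuousOn.aestronglyMeasurable hΩ.measurableSet).mono_measure hmono
  have huS := hum.mono_measure hmono
  have hvS := hvm.mono_measure hmono
  have hζm : AEStronglyMeasurable ζ (volume.restrict S) := hL.continuous.aestronglyMeasurable
  obtain ⟨Cζ, hCζ⟩ := hζc.exists_bound_of_continuous hL.continuous
  have hCζ0 : 0 ≤ Cζ := (norm_nonneg _).trans (hCζ 0)
  set D : Eucl n → ℝ := fun x => ‖sqrtMul (Q x) (gradient ζ x)‖ with hD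
  have hDm : AEStronglyMeasurable D (volume.restrict S) :=
    (hQ.aemeasurable_norm hΩ hSΩ (aestronglyMeasurable_gradient ζ)).aestronglyMeasurable
  set V : Eucl n → ℝ := fun x => ‖sqrtMul (Q x) (v x)‖ with hV
  have hVm : AEStronglyMeasurable V (volume.restrict S) :=
    (hQ.aemeasurable_norm hΩ hSΩ hvS).aestronglyMeasurable
  have hgrad : ∀ k, ∀ᵐ x ∂(volume.restrict S), gradient (fun x => ζ x * G (wk k x)) x =
      G (wk k x) • gradient ζ x + (ζ x * G' (wk k x)) • gradient (wk k) x := by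
    intro k
    filter_upwards [ae_mono hmono ((hwL k).ae_differentiableAt hΩ),
      ae_mono Measure.restrict_le_self hL.ae_differentiableAt] with x hx hx'
    exact gradient_mul_comp hx' hx hG
  have hone := ENNReal.one_le_ofReal_of_one_le hp.le
  refine ⟨hζm.mul (hGcont.comp_aestronglyMeasurable huS),
    ((hGcont.comp_aestronglyMeasurable huS).smul (aestronglyMeasurable_gradient ζ)).add
      ((hζm.mul (hGc.comp_aestronglyMeasurable huS)).smul hvS),
    fun k x => ζ x * G (wk k x), fun k => ⟨?_, ?_⟩, ?_⟩
  · exact isLipZero_mul hΩ hSΩ hζ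
      ((hwL k).comp_locallyLipschitz (locallyLipschitz_of_hasDerivAt hG hGb))
  · obtain ⟨⟨L', hL'⟩, hc', hs'⟩ := isLipZero_mul hΩ hSΩ hζ
      ((hwL k).comp_locallyLipschitz (locallyLipschitz_of_hasDerivAt hG hGb))
    refine (sobNorm_le_add hp.le _ _).trans_lt (ENNReal.add_lt_top.2 ⟨?_, ?_⟩)
    · obtain ⟨C, hC⟩ := hc'.exists_bound_of_continuous hL'.continuous
      exact (MemLp.of_bound hL'.continuous.aestronglyMeasurable C
        (Eventually.of_forall hC)).2
    · have hcont : ContinuousOn (fun x => G (wk k x)) (tsupport ζ) :=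
        hGcont.comp_continuousOn ((hwL k).continuousOn.mono (hζs.trans hSΩ))
      obtain ⟨C, hC⟩ := hζc.isCompact.exists_bound_of_continuousOn hcont
      have hDp : eLpNorm D (ENNReal.ofReal p) (volume.restrict S) < ∞ := by
        have ht1 : 1 ≤ t := by
          rw [← ENNReal.inv_le_one, ← htt]; exact le_self_add
        exact (MemLp.mono_exponent (p := ENNReal.ofReal p) ⟨hDm, hζt⟩
          (le_mul_of_one_le_left (zero_le) ht1)).2
      have hWp : eLpNorm (fun x => ‖sqrtMul (Q x) (gradient (wk k) x)‖) (ENNReal.ofReal p)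
          (volume.restrict S) < ∞ :=
        ((eLpNorm_mono_measure _ hmono).trans (eLpNorm_sqrtMul_le_sobNorm hp0 (wk k)
          (gradient (wk k)))).trans_lt (hwk₀ (ns k)).2
      have hWm := (hQ.aemeasurable_norm hΩ hSΩ
        (aestronglyMeasurable_gradient (wk k))).aestronglyMeasurable
      have h1 : MemLp (fun x => |C| * D x + Cζ * Λ * ‖sqrtMul (Q x) (gradient (wk k) x)‖)
          (ENNReal.ofReal p) (volume.restrict S) :=
        (MemLp.const_mul ⟨hDm, hDp⟩ |C|).add (MemLp.const_mul ⟨hWm, hWp⟩ (Cζ * Λ))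
      refine lt_of_le_of_lt (eLpNorm_mono_ae ?_) h1.2
      filter_upwards [hgrad k] with x hx
      rw [norm_norm, hx, sqrtMul_add, sqrtMul_smul, sqrtMul_smul]
      refine (norm_add_le _ _).trans ((add_le_add ?_ ?_).trans (le_abs_self _))
      · rw [norm_smul]
        by_cases hxs : x ∈ tsupport ζ
        · exact mul_le_mul_of_nonneg_right ((hC x hxs).trans (le_abs_self C)) (norm_nonneg _)
        · simp [hD, gradient_eq_zero_of_notMem_tsupport hxs, sqrtMul_zero]
      · rw [norm_smul, norm_mul]
        gcongr
        · exact hCζ x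
        · exact hGb _
  · have hZ : Tendsto (fun k => eLpNorm (fun x => D x * (wk k x - u x)) (ENNReal.ofReal p)
        (volume.restrict S)) atTop (𝓝 0) := by
      have hb : ∀ k, eLpNorm (fun x => D x * (wk k x - u x)) (ENNReal.ofReal p)
          (volume.restrict S) ≤ eLpNorm D (t * ENNReal.ofReal p) (volume.restrict S) *
            (c₂ * (2 * (2 * sobNorm Q p Ω (fun x => wk k x - u x)
              (fun x => gradient (wk k) x - v x)))) := fun k =>
        (eLpNorm_mul_le_of_inv_add_inv hDm ((hwm k).sub huS)
          (inv_add_inv_mul_ofReal hp0 htt)).trans (mul_le_mul_right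
            (eLpNorm_sub_le_of_localIntegrability hp hΩ hQ hSΩ hloc hum hvm hwL hlim hae k) _)
      refine tendsto_of_tendsto_of_tendsto_of_le_of_le tendsto_const_nhds ?_
        (fun _ => zero_le) hb
      have h2 : (2 : ℝ≥0∞) ≠ ∞ := ENNReal.ofNat_ne_top
      have := ENNReal.Tendsto.const_mul (ENNReal.Tendsto.const_mul (ENNReal.Tendsto.const_mul
        (ENNReal.Tendsto.const_mul hlim (Or.inr h2)) (Or.inr h2))
        (Or.inr (ENNReal.coe_ne_top (r := c₂)))) (Or.inr hζt.ne)
      simpa using this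
    have hY : Tendsto (fun k => eLpNorm (fun x => ‖sqrtMul (Q x) (gradient (wk k) x - v x)‖)
        (ENNReal.ofReal p) (volume.restrict S)) atTop (𝓝 0) :=
      tendsto_of_tendsto_of_tendsto_of_le_of_le tendsto_const_nhds hlim (fun _ => zero_le)
        fun k => (eLpNorm_mono_measure _ hmono).trans (eLpNorm_sqrtMul_le_sobNorm hp0 _ _)
    have hX : Tendsto (fun k => eLpNorm (fun x => wk k x - u x)
        (ENNReal.ofReal p) (volume.restrict S)) atTop (𝓝 0) :=
      tendsto_of_tendsto_of_tendsto_of_le_of_le tendsto_const_nhds hlim (fun _ => zero_le)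
        fun k => (eLpNorm_mono_measure _ hmono).trans (eLpNorm_le_sobNorm hp0 _ _)
    have hT : Tendsto (fun k => eLpNorm (fun x => (G' (wk k x) - G' (u x)) * V x)
        (ENNReal.ofReal p) (volume.restrict S)) atTop (𝓝 0) := by
      refine tendsto_eLpNorm_of_dominated hp0 (g := fun x => (2 * Λ) * V x)
        (fun k => ((hGc.comp_aestronglyMeasurable (hwm k)).sub
          (hGc.comp_aestronglyMeasurable huS)).mul hVm) ?_ ?_ ?_
      · exact (MemLp.const_mul ⟨hVm, (eLpNorm_mono_measure _ hmono).trans_lt hV2⟩ _).2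
      · refine fun k => Eventually.of_forall fun x => ?_
        rw [norm_mul, norm_mul]
        gcongr
        rw [Real.norm_eq_abs, Real.norm_eq_abs, abs_of_nonneg (by positivity : 0 ≤ 2 * (Λ : ℝ))]
        refine (abs_sub _ _).trans ?_
        linarith [hGb (wk k x), hGb (u x)]
      · filter_upwards [hae] with x hx
        have h1 := ((hGc.tendsto (u x)).comp hx).sub_const (G' (u x))
        have h2 := h1.mul_const (V x)
        simpa using h2
    have hb : ∀ k, sobNorm Q p S (fun x => ζ x * G (wk k x) - ζ x * G (u x))
        (fun x => gradient (fun x => ζ x * G (wk k x)) x -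
          (G (u x) • gradient ζ x + (ζ x * G' (u x)) • v x)) ≤
        ENNReal.ofReal (Cζ * Λ) * eLpNorm (fun x => wk k x - u x) (ENNReal.ofReal p)
            (volume.restrict S) +
          (ENNReal.ofReal Λ * eLpNorm (fun x => D x * (wk k x - u x)) (ENNReal.ofReal p)
            (volume.restrict S) +
          ENNReal.ofReal (Cζ * Λ) * eLpNorm (fun x => ‖sqrtMul (Q x) (gradient (wk k) x - v x)‖)
            (ENNReal.ofReal p) (volume.restrict S) +
          ENNReal.ofReal Cζ * eLpNorm (fun x => (G' (wk k x) - G' (u x)) * V x)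
            (ENNReal.ofReal p) (volume.restrict S)) := by
      intro k
      have cm : ∀ (c : ℝ) (f : Eucl n → ℝ), 0 ≤ c → ENNReal.ofReal c *
          eLpNorm f (ENNReal.ofReal p) (volume.restrict S) =
          eLpNorm (fun x => c * f x) (ENNReal.ofReal p) (volume.restrict S) := by
        intro c f hc
        have := eLpNorm_const_smul c f (ENNReal.ofReal p) (volume.restrict S)
        rw [Real.enorm_of_nonneg hc] at this
        exact this.symm
      have hYm := (hQ.aemeasurable_norm hΩ hSΩ
        ((aestronglyMeasurable_gradient (wk k)).sub hvS)).aestronglyMeasurable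
      refine (sobNorm_le_add hp.le _ _).trans (add_le_add ?_ ?_)
      · rw [cm _ _ (by positivity)]
        refine eLpNorm_mono fun x => ?_
        rw [← mul_sub, norm_mul, norm_mul, Real.norm_eq_abs (Cζ * Λ),
          abs_of_nonneg (by positivity), mul_assoc]
        have := abs_sub_le_of_hasDerivAt hG hGb (wk k x) (u x)
        exact mul_le_mul (hCζ x) this (norm_nonneg _) hCζ0
      · rw [cm _ _ (by positivity), cm _ _ (by positivity), cm _ _ (by positivity)]
        have m1 : AEStronglyMeasurable (fun x => (Λ : ℝ) * (D x * (wk k x - u x)))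
            (volume.restrict S) := (hDm.mul ((hwm k).sub huS)).const_mul _
        have m2 := hYm.const_mul (Cζ * (Λ : ℝ))
        have m3 : AEStronglyMeasurable (fun x => Cζ * ((G' (wk k x) - G' (u x)) * V x))
            (volume.restrict S) := (((hGc.comp_aestronglyMeasurable (hwm k)).sub
          (hGc.comp_aestronglyMeasurable huS)).mul hVm).const_mul _
        rw [← eLpNorm_norm (fun x => (Λ : ℝ) * (D x * (wk k x - u x))),
          ← eLpNorm_norm (fun x => Cζ * ((G' (wk k x) - G' (u x)) * V x))]
        refine le_trans (eLpNorm_mono_ae ?_) ((eLpNorm_add_le (m1.norm.add m2) m3.norm hone).trans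
          (add_le_add_left (eLpNorm_add_le m1.norm m2 hone) _))
        filter_upwards [hgrad k] with x hx
        rw [norm_norm, hx]
        have e : G (wk k x) • gradient ζ x + (ζ x * G' (wk k x)) • gradient (wk k) x -
            (G (u x) • gradient ζ x + (ζ x * G' (u x)) • v x) =
            (G (wk k x) - G (u x)) • gradient ζ x +
              (ζ x * G' (wk k x)) • (gradient (wk k) x - v x) +
              (ζ x * (G' (wk k x) - G' (u x))) • v x := by
          module
        rw [e, sqrtMul_add, sqrtMul_add, sqrtMul_smul, sqrtMul_smul, sqrtMul_smul]
        refine (norm_add₃_le).trans (le_trans (add_le_add (add_le_add ?_ ?_) ?_)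
          (le_abs_self _))
        · beta_reduce
          rw [norm_smul, norm_mul, norm_mul, Real.norm_of_nonneg NNReal.zero_le_coe, hD, norm_norm, mul_comm ‖sqrtMul _ _‖,
            ← mul_assoc]
          exact mul_le_mul_of_nonneg_right (abs_sub_le_of_hasDerivAt hG hGb _ _) (norm_nonneg _)
        · rw [norm_smul, norm_mul]
          exact mul_le_mul_of_nonneg_right (mul_le_mul (hCζ x) (hGb _) (norm_nonneg _) hCζ0)
            (norm_nonneg _)
        · beta_reduce
          rw [norm_smul, norm_mul, norm_mul, norm_mul, hV, norm_norm, Real.norm_of_nonneg hCζ0,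
            mul_assoc]
          gcongr
          exact hCζ x
    refine tendsto_of_tendsto_of_tendsto_of_le_of_le tendsto_const_nhds ?_
      (fun _ => zero_le) hb
    have hc : ∀ c : ℝ, ENNReal.ofReal c ≠ ∞ := fun c => ENNReal.ofReal_ne_top
    have := (ENNReal.Tendsto.const_mul hX (Or.inr (hc (Cζ * Λ)))).add
      (((ENNReal.Tendsto.const_mul hZ (Or.inr (hc Λ))).add
        (ENNReal.Tendsto.const_mul hY (Or.inr (hc (Cζ * Λ))))).add
        (ENNReal.Tendsto.const_mul hT (Or.inr (hc Cζ))))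
    simpa using this

end Product

/-! ### Testing the equation with elements of `(W^{1,p}_Q)_0` -/

section Testing

variable {n : ℕ} {Ω S : Set (Eucl n)} {Q : Eucl n → Matrix (Fin n) (Fin n) ℝ} {p σ : ℝ}

lemma IsLipZero.sub {ψ φ : Eucl n → ℝ} (hψ : IsLipZero S ψ) (hφ : IsLipZero S φ) :
    IsLipZero S (fun x => ψ x - φ x) := by
  obtain ⟨⟨L, hL⟩, hc, hs⟩ := hψ
  obtain ⟨⟨L', hL'⟩, hc', hs'⟩ := hφ
  exact ⟨⟨L + L', hL.sub hL'⟩, hc.sub hc',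
    (tsupport_sub ψ φ).trans (union_subset hs hs')⟩

lemma IsLipZero.locallyLipschitzOn {ψ : Eucl n → ℝ} (hψ : IsLipZero S ψ) :
    LocallyLipschitzOn Ω ψ := by
  obtain ⟨⟨L, hL⟩, -⟩ := hψ
  exact hL.locallyLipschitz.locallyLipschitzOn

/-- Needed to apply the Sobolev estimate to the error `w_k - φ` of an approximation. -/
lemma MemWZero.lip_sub (hp : 1 < p) (hΩ : IsOpen Ω) (hQ : IsAdmissibleMatrix Ω p Q)
    (hSΩ : S ⊆ Ω) {ψ φ : Eucl n → ℝ} {ξ : Eucl n → Eucl n} (hψ : IsLipZero S ψ)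
    (hψf : sobNorm Q p S ψ (gradient ψ) < ∞) (h : MemWZero Q p S φ ξ) :
    MemWZero Q p S (fun x => ψ x - φ x) (fun x => gradient ψ x - ξ x) := by
  obtain ⟨hφ, hξ, wk, hwk, hlim⟩ := h
  have hm : ∀ {w : Eucl n → ℝ}, IsLipZero S w → AEStronglyMeasurable w (volume.restrict S) := by
    rintro w ⟨⟨L, hL⟩, -⟩
    exact hL.continuous.aestronglyMeasurable
  refine ⟨(hm hψ).sub hφ, (aestronglyMeasurable_gradient ψ).sub hξ,
    fun k x => ψ x - wk k x, fun k => ⟨hψ.sub (hwk k).1, ?_⟩, ?_⟩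
  · rw [sobNorm_gradient_sub hΩ hSΩ hψ.locallyLipschitzOn (hwk k).1.locallyLipschitzOn]
    refine (sobNorm_sub_le hp.le hQ hΩ hSΩ (hm hψ) (hm (hwk k).1) aestronglyMeasurable_const
      (aestronglyMeasurable_gradient _) (aestronglyMeasurable_gradient _)
      aestronglyMeasurable_const (u := fun _ => 0) (z := fun _ => 0)).trans_lt ?_
    simp only [sub_zero]
    exact ENNReal.mul_lt_top ENNReal.ofNat_lt_top (ENNReal.add_lt_top.2 ⟨hψf, (hwk k).2⟩)
  · refine hlim.congr fun k => ?_
    unfold sobNorm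
    congr 2
    · refine lintegral_congr fun x => ?_
      beta_reduce
      rw [show ψ x - wk k x - (ψ x - φ x) = -(wk k x - φ x) by ring, enorm_neg]
    · refine lintegral_congr_ae ?_
      filter_upwards [ae_mono (Measure.restrict_mono hSΩ le_rfl)
        ((hψ.locallyLipschitzOn (Ω := Ω)).ae_differentiableAt hΩ),
        ae_mono (Measure.restrict_mono hSΩ le_rfl)
        (((hwk k).1.locallyLipschitzOn (Ω := Ω)).ae_differentiableAt hΩ)] with x h1 h2
      rw [gradient_sub h1 h2, show gradient ψ x - gradient (wk k) x - (gradient ψ x - ξ x) =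
        (-1 : ℝ) • (gradient (wk k) x - ξ x) by module, sqrtMul_smul, neg_one_smul, enorm_neg]

lemma tendsto_integral_zero_of_eLpNorm_one {α : Type*} [MeasurableSpace α] {μ : Measure α}
    {g : ℕ → α → ℝ} (hg : ∀ k, Integrable (g k) μ)
    (h : Tendsto (fun k => eLpNorm (g k) 1 μ) atTop (𝓝 0)) :
    Tendsto (fun k => ∫ x, g k x ∂μ) atTop (𝓝 0) := by
  have := tendsto_integral_of_L1' (μ := μ) (fun _ => (0 : ℝ)) aestronglyMeasurable_const
    (Eventually.of_forall hg) (l := atTop) (by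
      refine h.congr fun k => ?_
      congr 1
      ext x
      simp)
  simpa using this

/-- No measurability of `A` or `B` is assumed, so the weak form with test function `φ` need not have
a measurable integrand. Therefore only an integrable minorant `m` is integrated: it is at most the
weak form of a Lipschitz approximant, whose integral is zero, plus an error `g`. The error tends to
zero in `L¹`, since the flux is bounded in `L^{p'}` against `√Q ∇` and the source in the dual of the
Sobolev exponent. -/
theorem integral_nonpos_of_isWeakSolution (hp : 1 < p) (hΩ : IsOpen Ω)
    (hQ : IsAdmissibleMatrix Ω p Q) (hSΩ : S ⊆ Ω)
    {A : Eucl n → ℝ → Eucl n → Eucl n} {B : Eucl n → ℝ → Eucl n → ℝ} {u : Eucl n → ℝ}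
    {v : Eucl n → Eucl n} (hsol : IsWeakSolution Ω Q p A B u v) {β α' β' : ℝ≥0∞}
    (hα' : (ENNReal.ofReal p)⁻¹ + α'⁻¹ = 1⁻¹) (hβ' : β⁻¹ + β'⁻¹ = 1⁻¹)
    (hSob : ∃ C : ℝ≥0, ∀ (w : Eucl n → ℝ) (z : Eucl n → Eucl n), MemWZero Q p S w z →
      eLpNorm w β (volume.restrict S) ≤ C * sobNorm Q p S w z)
    {Ab Bb : Eucl n → ℝ} (hAb : MemLp Ab α' (volume.restrict S))
    (hBb : MemLp Bb β' (volume.restrict S))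
    (hA : ∀ᵐ x ∂(volume.restrict S), ∀ ξ : Eucl n,
      |inner ℝ ξ (A x (u x) (v x))| ≤ ‖sqrtMul (Q x) ξ‖ * Ab x)
    (hB : ∀ᵐ x ∂(volume.restrict S), |B x (u x) (v x)| ≤ Bb x)
    {φ : Eucl n → ℝ} {ξ : Eucl n → Eucl n} (hφ : MemWZero Q p S φ ξ) {m : Eucl n → ℝ}
    (hm : Integrable m (volume.restrict S))
    (hle : ∀ᵐ x ∂(volume.restrict S),
      m x ≤ inner ℝ (ξ x) (A x (u x) (v x)) + φ x * B x (u x) (v x)) :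
    ∫ x in S, m x ≤ 0 := by
  have hp0 : 0 < p := by linarith
  obtain ⟨C, hSob⟩ := hSob
  obtain ⟨hφm, hξm, wk, hwk, hlim⟩ := id hφ
  obtain ⟨a, ha⟩ : ∃ a : ℕ → ℝ≥0∞, ∀ k, a k = sobNorm Q p S (fun x => wk k x - φ x)
    (fun x => gradient (wk k) x - ξ x) := ⟨_, fun _ => rfl⟩
  simp_rw [← ha] at hlim
  have hwm : ∀ k, AEStronglyMeasurable (wk k) (volume.restrict S) := by
    intro k
    obtain ⟨⟨L, hL⟩, -⟩ := (hwk k).1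
    exact hL.continuous.aestronglyMeasurable
  set N : ℕ → Eucl n → ℝ := fun k x => ‖sqrtMul (Q x) (gradient (wk k) x - ξ x)‖ with hN
  have hNm : ∀ k, AEStronglyMeasurable (N k) (volume.restrict S) := fun k =>
    (hQ.aemeasurable_norm hΩ hSΩ ((aestronglyMeasurable_gradient _).sub hξm)).aestronglyMeasurable
  set g : ℕ → Eucl n → ℝ := fun k x => N k x * Ab x + |wk k x - φ x| * Bb x with hg
  have hdm : ∀ k, AEStronglyMeasurable (fun x => |wk k x - φ x|) (volume.restrict S) := fun k =>
    ((hwm k).sub hφm).norm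
  have hgb : ∀ k, eLpNorm (g k) 1 (volume.restrict S) ≤
      a k * eLpNorm Ab α' (volume.restrict S) +
      C * a k * eLpNorm Bb β' (volume.restrict S) := by
    intro k
    rw [ha]
    refine (eLpNorm_add_le ((hNm k).mul hAb.1) ((hdm k).mul hBb.1) le_rfl).trans
      (add_le_add ?_ ?_)
    · refine (eLpNorm_mul_le_of_inv_add_inv (hNm k) hAb.1 hα').trans ?_
      gcongr
      exact eLpNorm_sqrtMul_le_sobNorm hp0 _ _
    · refine (eLpNorm_mul_le_of_inv_add_inv (hdm k) hBb.1 hβ').trans ?_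
      gcongr
      have h1 : eLpNorm (fun x => |wk k x - φ x|) β (volume.restrict S) =
          eLpNorm (fun x => wk k x - φ x) β (volume.restrict S) :=
        eLpNorm_norm fun x => wk k x - φ x
      rw [h1]
      exact hSob _ _ (hφ.lip_sub hp hΩ hQ hSΩ (hwk k).1 (hwk k).2)
  have hsfin : ∀ k, a k < ∞ → Integrable (g k) (volume.restrict S) := by
    intro k hk
    have hgm : AEStronglyMeasurable (g k) (volume.restrict S) :=
      ((hNm k).mul hAb.1).add ((hdm k).mul hBb.1)
    refine memLp_one_iff_integrable.1 ⟨hgm, (hgb k).trans_lt ?_⟩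
    have f1 := hAb.2
    have f2 := hBb.2
    finiteness
  obtain ⟨k₀, hk₀⟩ := eventually_atTop.1 (hlim.eventually (gt_mem_nhds one_pos))
  have hgi : ∀ k, Integrable (g (k + k₀)) (volume.restrict S) := fun k =>
    hsfin _ ((hk₀ _ (Nat.le_add_left _ _)).trans ENNReal.one_lt_top)
  have hg0 : Tendsto (fun k => ∫ x in S, g (k + k₀) x) atTop (𝓝 0) := by
    refine tendsto_integral_zero_of_eLpNorm_one hgi ?_
    refine tendsto_of_tendsto_of_tendsto_of_le_of_le tendsto_const_nhds ?_
      (fun _ => zero_le) (fun k => hgb (k + k₀))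
    have hl := hlim.comp (tendsto_add_atTop_nat k₀)
    have := (ENNReal.Tendsto.mul_const hl (Or.inr hAb.2.ne)).add
      (ENNReal.Tendsto.mul_const (ENNReal.Tendsto.const_mul hl
        (Or.inr (ENNReal.coe_ne_top (r := C)))) (Or.inr hBb.2.ne))
    simpa using this
  refine ge_of_tendsto' hg0 fun k => ?_
  set K := k + k₀
  set f : Eucl n → ℝ := fun x => inner ℝ (gradient (wk K) x) (A x (u x) (v x)) +
    wk K x * B x (u x) (v x) with hf
  have hLip : IsLipZero Ω (wk K) := ⟨(hwk K).1.1, (hwk K).1.2.1, (hwk K).1.2.2.trans hSΩ⟩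
  obtain ⟨hfi, hf0⟩ := hsol.2 _ hLip
  have hf0' : ∫ x in S, f x = 0 := by
    rw [← hf0]
    refine (setIntegral_eq_of_subset_of_ae_sdiff_eq_zero hΩ.measurableSet.nullMeasurableSet hSΩ
      (Eventually.of_forall fun x hx => ?_)).symm
    have hx' : x ∉ tsupport (wk K) := fun h => hx.2 ((hwk K).1.2.2 h)
    change inner ℝ (gradient (wk K) x) _ + wk K x * _ = 0
    rw [gradient_eq_zero_of_notMem_tsupport hx', image_eq_zero_of_notMem_tsupport hx',
      inner_zero_left, zero_mul, add_zero]
  have hfi' : Integrable f (volume.restrict S) := hfi.mono_set hSΩ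
  -- Pointwise, replacing `(φ, ξ)` by the approximant changes the weak form by at most `g K`.
  have hmain : ∫ x in S, m x ≤ ∫ x in S, (f x + g K x) := by
    refine integral_mono_ae hm (hfi'.add (hgi k)) ?_
    filter_upwards [hA, hB, hle] with x hxA hxB hx
    refine hx.trans ?_
    have e1 := hxA (gradient (wk K) x - ξ x)
    rw [inner_sub_left] at e1
    have e2 : |(wk K x - φ x) * B x (u x) (v x)| ≤ |wk K x - φ x| * Bb x := by
      rw [abs_mul]; gcongr
    have e3 := neg_le_of_abs_le e1
    have e4 := neg_le_of_abs_le e2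
    simp only [hf, hg, hN]
    linarith
  rw [integral_add hfi' (hgi k), hf0', zero_add] at hmain
  exact hmain

end Testing

/-! ### Truncated powers -/

noncomputable section TruncatedPowers

/-- A smooth substitute for `|z| + k`. -/
def shiftAbs (k z : ℝ) : ℝ := √(z ^ 2 + k ^ 2)

/-- A smooth truncation of `t` at height `l⁻¹`. -/
def damp (l t : ℝ) : ℝ := t / (1 + l * t)

/-- The weight `β m ^ (β - 1)`, where `m` is the truncation of `shiftAbs k z`. -/
def powWeight (k l β z : ℝ) : ℝ := β * damp l (shiftAbs k z) ^ (β - 1)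

/-- A power `β` of `shiftAbs k z`, truncated so as to have linear growth. -/
def powTrunc (k l β z : ℝ) : ℝ := shiftAbs k z * damp l (shiftAbs k z) ^ (β - 1)

/-- The test function associated with `powTrunc`. -/
def powTest (k l β p z : ℝ) : ℝ := ∫ x in (0 : ℝ)..z, powWeight k l β x ^ p

variable {k l β p : ℝ}

lemma le_shiftAbs (k z : ℝ) : k ≤ shiftAbs k z :=
  Real.le_sqrt_of_sq_le (by nlinarith [sq_nonneg z])

lemma shiftAbs_pos (hk : 0 < k) (z : ℝ) : 0 < shiftAbs k z := hk.trans_le (le_shiftAbs k z)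

lemma abs_le_shiftAbs (k z : ℝ) : |z| ≤ shiftAbs k z :=
  Real.abs_le_sqrt (by nlinarith [sq_nonneg k])

lemma shiftAbs_le (hk : 0 < k) (z : ℝ) : shiftAbs k z ≤ |z| + k := by
  refine Real.sqrt_le_iff.2 ⟨by positivity, ?_⟩
  nlinarith [sq_abs z, abs_nonneg z]

lemma shiftAbs_mono {z z' : ℝ} (h : |z| ≤ |z'|) : shiftAbs k z ≤ shiftAbs k z' :=
  Real.sqrt_le_sqrt (by linarith [sq_le_sq.2 h])

lemma hasDerivAt_shiftAbs (hk : 0 < k) (z : ℝ) :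
    HasDerivAt (shiftAbs k) (z / shiftAbs k z) z := by
  have h1 : HasDerivAt (fun z : ℝ => z ^ 2 + k ^ 2) (2 * z) z := by
    simpa using (hasDerivAt_pow 2 z).add_const (k ^ 2)
  have h2 := h1.sqrt (by positivity : z ^ 2 + k ^ 2 ≠ 0)
  rw [mul_div_mul_left _ _ two_ne_zero] at h2
  exact h2

lemma continuous_shiftAbs : Continuous (shiftAbs k) := by
  unfold shiftAbs; fun_prop

lemma damp_pos (hl : 0 < l) {t : ℝ} (ht : 0 < t) : 0 < damp l t := by
  unfold damp; positivity

lemma damp_le_inv (hl : 0 < l) {t : ℝ} (ht : 0 < t) : damp l t ≤ l⁻¹ := by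
  unfold damp
  rw [div_le_iff₀ (by positivity)]
  field_simp
  linarith

lemma damp_le (hl : 0 < l) {t : ℝ} (ht : 0 < t) : damp l t ≤ t := by
  unfold damp
  exact div_le_self ht.le (by nlinarith)

lemma damp_mono (hl : 0 < l) {t t' : ℝ} (ht : 0 < t) (h : t ≤ t') : damp l t ≤ damp l t' := by
  unfold damp
  have : 0 < t' := ht.trans_le h
  rw [div_le_div_iff₀ (by positivity) (by positivity)]
  nlinarith

lemma hasDerivAt_damp (hl : 0 < l) {t : ℝ} (ht : 0 < t) :
    HasDerivAt (damp l) (1 / (1 + l * t) ^ 2) t := by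
  have h1 : HasDerivAt (fun t : ℝ => 1 + l * t) l t := by
    simpa using ((hasDerivAt_id t).const_mul l).const_add 1
  have h2 := (hasDerivAt_id t).div h1 (by positivity)
  refine h2.congr_deriv ?_
  simp only [id]
  ring

lemma continuous_damp_shiftAbs (hk : 0 < k) (hl : 0 < l) :
    Continuous fun z => damp l (shiftAbs k z) := by
  unfold damp
  refine continuous_shiftAbs.div (continuous_const.add (continuous_const.mul continuous_shiftAbs))
    fun z => ?_
  have := shiftAbs_pos hk z
  positivity

lemma continuous_powWeight (hk : 0 < k) (hl : 0 < l) : Continuous (powWeight k l β) :=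
  continuous_const.mul ((continuous_damp_shiftAbs hk hl).rpow_const
    fun z => Or.inl (damp_pos hl (shiftAbs_pos hk z)).ne')

lemma powWeight_pos (hk : 0 < k) (hl : 0 < l) (hβ : 1 ≤ β) (z : ℝ) : 0 < powWeight k l β z :=
  mul_pos (by linarith) (Real.rpow_pos_of_pos (damp_pos hl (shiftAbs_pos hk z)) _)

lemma powTrunc_pos (hk : 0 < k) (hl : 0 < l) (z : ℝ) : 0 < powTrunc k l β z :=
  mul_pos (shiftAbs_pos hk z) (Real.rpow_pos_of_pos (damp_pos hl (shiftAbs_pos hk z)) _)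

/-- This identity substitutes for `U · βU^(β-1) = βU^β` and survives truncation exactly; it is the
reason for this form of `powTrunc`. -/
lemma shiftAbs_mul_powWeight (z : ℝ) :
    shiftAbs k z * powWeight k l β z = β * powTrunc k l β z := by
  unfold powWeight powTrunc; ring

lemma powWeight_le (hk : 0 < k) (hl : 0 < l) (hβ : 1 ≤ β) (z : ℝ) :
    powWeight k l β z ≤ β * l⁻¹ ^ (β - 1) := by
  unfold powWeight
  have := damp_le_inv hl (shiftAbs_pos hk z)
  have := (damp_pos hl (shiftAbs_pos hk z)).le
  gcongr

lemma powWeight_mono (hk : 0 < k) (hl : 0 < l) (hβ : 1 ≤ β) {z z' : ℝ} (h : |z| ≤ |z'|) :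
    powWeight k l β z ≤ powWeight k l β z' := by
  unfold powWeight
  have := damp_mono hl (shiftAbs_pos hk z) (shiftAbs_mono (k := k) h)
  have := (damp_pos hl (shiftAbs_pos hk z)).le
  gcongr

/-- The bound uniform in `l`, for the removal of the truncation. -/
lemma powTrunc_le_rpow (hk : 0 < k) (hl : 0 < l) (hβ : 1 ≤ β) (z : ℝ) :
    powTrunc k l β z ≤ shiftAbs k z ^ β := by
  have h0 := shiftAbs_pos hk z
  have e : shiftAbs k z ^ β = shiftAbs k z * shiftAbs k z ^ (β - 1) := by
    rw [← Real.rpow_one_add' h0.le (by linarith)]; congr 1; ring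
  rw [e]
  unfold powTrunc
  have := damp_le hl h0
  have := (damp_pos hl h0).le
  gcongr

/-- Linear growth for fixed `l`; it makes all norms finite before absorption. -/
lemma powTrunc_le_mul (hk : 0 < k) (hl : 0 < l) (hβ : 1 ≤ β) (z : ℝ) :
    powTrunc k l β z ≤ shiftAbs k z * l⁻¹ ^ (β - 1) := by
  have h0 := shiftAbs_pos hk z
  unfold powTrunc
  have := damp_le_inv hl h0
  have := (damp_pos hl h0).le
  gcongr

/-- The derivative of `powTrunc`. -/
def powTruncDeriv (k l β z : ℝ) : ℝ :=
  damp l (shiftAbs k z) ^ (β - 1) * (1 + (β - 1) / (1 + l * shiftAbs k z)) *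
    (z / shiftAbs k z)

lemma hasDerivAt_powTrunc (hk : 0 < k) (hl : 0 < l) (z : ℝ) :
    HasDerivAt (powTrunc k l β) (powTruncDeriv k l β z) z := by
  have h0 := shiftAbs_pos hk z
  have hd := damp_pos hl h0
  have h1 := (hasDerivAt_damp hl h0).rpow_const (p := β - 1) (Or.inl hd.ne')
  have h2 := ((hasDerivAt_id (shiftAbs k z)).mul h1).comp z (hasDerivAt_shiftAbs hk z)
  refine h2.congr_deriv ?_
  simp only [id, powTruncDeriv]
  congr 1
  rw [Real.rpow_sub_one hd.ne' (β - 1)]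
  have e : (1 : ℝ) + l * shiftAbs k z ≠ 0 := by positivity
  have e2 : shiftAbs k z / damp l (shiftAbs k z) = 1 + l * shiftAbs k z := by
    unfold damp; field_simp
  have e3 : shiftAbs k z * (1 / (1 + l * shiftAbs k z) ^ 2 * (β - 1) *
      (damp l (shiftAbs k z) ^ (β - 1) / damp l (shiftAbs k z))) =
      (shiftAbs k z / damp l (shiftAbs k z)) * (1 / (1 + l * shiftAbs k z) ^ 2 * (β - 1) *
      damp l (shiftAbs k z) ^ (β - 1)) := by ring
  rw [e3, e2]
  field_simp

lemma continuous_powTruncDeriv (hk : 0 < k) (hl : 0 < l) :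
    Continuous (powTruncDeriv k l β) := by
  have h0 := fun z => shiftAbs_pos hk z
  have hc : Continuous (shiftAbs k) := continuous_shiftAbs
  refine (((continuous_damp_shiftAbs hk hl).rpow_const
    fun z => Or.inl (damp_pos hl (h0 z)).ne').mul (continuous_const.add
      (continuous_const.div (continuous_const.add (continuous_const.mul hc)) fun z => ?_))).mul
      (continuous_id.div hc fun z => (h0 z).ne')
  have := h0 z
  exact (by positivity : 0 < 1 + l * shiftAbs k z).ne'

/-- So `√Q ∇(H(u))` is controlled by the quantity `P |√Q ∇u|` that the energy inequality estimates.
Damping only lowers the logarithmic derivative of the power, whose factor stays between `1` and `β`.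
-/
lemma abs_powTruncDeriv_le (hk : 0 < k) (hl : 0 < l) (hβ : 1 ≤ β) (z : ℝ) :
    |powTruncDeriv k l β z| ≤ powWeight k l β z := by
  have h0 := shiftAbs_pos hk z
  have hd := Real.rpow_pos_of_pos (damp_pos hl h0) (β - 1)
  have hβ' : 0 ≤ β - 1 := by linarith
  have h1 : |z / shiftAbs k z| ≤ 1 := by
    rw [abs_div, abs_of_pos h0, div_le_one h0]; exact abs_le_shiftAbs k z
  have h2 : 1 + (β - 1) / (1 + l * shiftAbs k z) ≤ β := by
    have : (β - 1) / (1 + l * shiftAbs k z) ≤ β - 1 := div_le_self hβ' (by nlinarith)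
    linarith
  have h3 : 0 ≤ 1 + (β - 1) / (1 + l * shiftAbs k z) := by positivity
  unfold powTruncDeriv powWeight
  rw [abs_mul, abs_mul, abs_of_pos hd, abs_of_nonneg h3]
  calc _ ≤ damp l (shiftAbs k z) ^ (β - 1) * β * 1 := by gcongr
    _ = _ := by ring

lemma continuous_powWeight_rpow (hk : 0 < k) (hl : 0 < l) (hβ : 1 ≤ β) :
    Continuous fun z => powWeight k l β z ^ p :=
  (continuous_powWeight hk hl).rpow_const fun z => Or.inl (powWeight_pos hk hl hβ z).ne'

lemma hasDerivAt_powTest (hk : 0 < k) (hl : 0 < l) (hβ : 1 ≤ β) (z : ℝ) :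
    HasDerivAt (powTest k l β p) (powWeight k l β z ^ p) z := by
  have hc : Continuous fun z => powWeight k l β z ^ p := continuous_powWeight_rpow hk hl hβ
  exact intervalIntegral.integral_hasDerivAt_right (hc.intervalIntegrable _ _)
    (hc.stronglyMeasurableAtFilter _ _) hc.continuousAt

/-- The weight is nondecreasing in `|z|`, so between `0` and `z` it is at most its value at `z`. -/
lemma abs_powTest_le (hk : 0 < k) (hl : 0 < l) (hβ : 1 ≤ β) (hp : 0 ≤ p) (z : ℝ) :
    |powTest k l β p z| ≤ shiftAbs k z * powWeight k l β z ^ p := by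
  have h := intervalIntegral.norm_integral_le_of_norm_le_const (a := 0) (b := z)
    (f := fun x => powWeight k l β x ^ p) (C := powWeight k l β z ^ p) (fun x hx => by
      have h1 := powWeight_pos hk hl hβ x
      rw [Real.norm_of_nonneg (by positivity)]
      refine Real.rpow_le_rpow h1.le (powWeight_mono hk hl hβ ?_) hp
      rcases le_total 0 z with hz | hz
      · rw [uIoc_of_le hz] at hx
        rw [abs_of_pos hx.1, abs_of_nonneg hz]; exact hx.2
      · rw [uIoc_of_ge hz] at hx
        rw [abs_of_nonpos hx.2, abs_of_nonpos hz]; linarith [hx.1])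
  rw [sub_zero, mul_comm] at h
  refine h.trans (mul_le_mul_of_nonneg_right (abs_le_shiftAbs k z) ?_)
  have := powWeight_pos hk hl hβ z
  positivity

lemma powWeight_rpow_le (hk : 0 < k) (hl : 0 < l) (hβ : 1 ≤ β) (hp : 0 ≤ p) (z : ℝ) :
    |powWeight k l β z ^ p| ≤ (β * l⁻¹ ^ (β - 1)) ^ p := by
  have := powWeight_pos hk hl hβ z
  rw [abs_of_nonneg (by positivity)]
  exact Real.rpow_le_rpow this.le (powWeight_le hk hl hβ z) hp

lemma tendsto_powTrunc (hk : 0 < k) (hβ : 1 ≤ β) (z : ℝ) :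
    Tendsto (fun j : ℕ => powTrunc k ((j : ℝ) + 1)⁻¹ β z) atTop (𝓝 (shiftAbs k z ^ β)) := by
  have h0 := shiftAbs_pos hk z
  have h1 : Tendsto (fun j : ℕ => damp ((j : ℝ) + 1)⁻¹ (shiftAbs k z)) atTop
      (𝓝 (shiftAbs k z)) := by
    have h2 : Tendsto (fun j : ℕ => 1 + ((j : ℝ) + 1)⁻¹ * shiftAbs k z) atTop (𝓝 1) := by
      have := (tendsto_one_div_add_atTop_nhds_zero_nat (𝕜 := ℝ)).mul_const (shiftAbs k z)
      simpa using this.const_add 1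
    have h3 := (tendsto_const_nhds (x := shiftAbs k z)).div h2 one_ne_zero
    simpa [damp] using! h3
  have h2 := (h1.rpow_const (p := β - 1) (Or.inl h0.ne')).const_mul (shiftAbs k z)
  have e : shiftAbs k z ^ β = shiftAbs k z * shiftAbs k z ^ (β - 1) := by
    rw [← Real.rpow_one_add' h0.le (by linarith)]; congr 1; ring
  rw [e]
  exact h2

end TruncatedPowers

/-! ### Pointwise inequalities and absorption -/

/-- Young's inequality with a parameter, by comparing `y` with `κ x`; the sharp constants play no
role. -/
lemma rpow_mul_le_young {p κ x y : ℝ} (hp : 1 < p) (hκ : 0 < κ) (hx : 0 ≤ x) (hy : 0 ≤ y) :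
    x ^ (p - 1) * y ≤ κ * x ^ p + κ ^ (1 - p) * y ^ p := by
  have hsplit : ∀ {z : ℝ}, 0 ≤ z → z ^ (p - 1) * z = z ^ p := fun hz => by
    rw [← Real.rpow_add_one' hz (by linarith)]; congr 1; ring
  rcases le_total y (κ * x) with h | h
  · have h1 : x ^ (p - 1) * y ≤ x ^ (p - 1) * (κ * x) := by gcongr
    have h2 : x ^ (p - 1) * (κ * x) = κ * x ^ p := by rw [← hsplit hx]; ring
    have h3 : 0 ≤ κ ^ (1 - p) * y ^ p := by positivity
    linarith
  · have h0 : x ≤ y / κ := by rw [le_div_iff₀ hκ]; linarith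
    have h1 : x ^ (p - 1) * y ≤ (y / κ) ^ (p - 1) * y := by gcongr
    have h2 : (y / κ) ^ (p - 1) * y = κ ^ (1 - p) * y ^ p := by
      rw [← hsplit hy, Real.div_rpow hy hκ.le, show 1 - p = -(p - 1) by ring,
        Real.rpow_neg hκ.le]
      field_simp
    have h3 : 0 ≤ κ * x ^ p := by positivity
    linarith

/-- A coefficient with integrability to spare is a constant `L` plus a term whose factor `L^(-ε)` is
as small as desired. -/
lemma le_add_rpow_mul {L ε x : ℝ} (hL : 0 < L) (hε : 0 < ε) (hx : 0 ≤ x) :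
    x ≤ L + L ^ (-ε) * x ^ (1 + ε) := by
  rcases le_total x L with h | h
  · have : 0 ≤ L ^ (-ε) * x ^ (1 + ε) := by positivity
    linarith
  · have hx0 : 0 < x := hL.trans_le h
    have h1 : x = x ^ (-ε) * x ^ (1 + ε) := by
      rw [← Real.rpow_add hx0]; simp
    have h2 : x ^ (-ε) ≤ L ^ (-ε) :=
      Real.rpow_le_rpow_of_nonpos hL h (by linarith)
    have h3 : x ^ (-ε) * x ^ (1 + ε) ≤ L ^ (-ε) * x ^ (1 + ε) := by gcongr
    linarith

/-- The constant in the pointwise energy inequality. -/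
noncomputable def energyConst (p a : ℝ) : ℝ :=
  1 + p + (4 * a) ^ (p - 1) * (1 + (p * a) ^ p)

/-- The pointwise lower bound for the left side of the weak equation tested with
`η ^ p * powTest u`, before absorption. -/
lemma energy_pointwise_aux {p a β δ η P H U D V h b c d i₁ i₂ G Bv f : ℝ} (hp : 1 < p)
    (ha : 1 < a) (hβ : 1 ≤ β) (hδ : 0 < δ) (hη : 0 ≤ η) (hP : 0 ≤ P) (hH : 0 ≤ H) (hU : 0 < U)
    (hD : 0 ≤ D) (hV : 0 ≤ V) (hh : 0 ≤ h) (hb : 0 ≤ b) (hc : 0 ≤ c) (hd : 0 ≤ d)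
    (hUP : U * P = β * H) (hG : |G| ≤ U * P ^ p)
    (h1 : |i₁| ≤ D * (a * V ^ (p - 1) + b * U ^ (p - 1)))
    (h2 : a⁻¹ * V ^ p - h * U ^ p ≤ i₂)
    (h3 : |Bv| ≤ c * V ^ (p - 1) + d * U ^ (p - 1))
    (hf : f = G * (p * η ^ (p - 1) * i₁) + η ^ p * P ^ p * i₂ + η ^ p * G * Bv) :
    (2 * a)⁻¹ * (η * P * V) ^ p ≤ f + energyConst p a * β ^ p *
      ((h + d + c ^ p + δ * b ^ (p / (p - 1))) * (η * H) ^ p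
        + (1 + δ ^ (1 - p)) * (H * D) ^ p) := by
  have hp0 : 0 < p := by linarith
  have hp1 : 0 < p - 1 := by linarith
  have ha0 : 0 < a := by linarith
  have hβ0 : 0 < β := by linarith
  have hsplit : ∀ {z : ℝ}, 0 ≤ z → z ^ (p - 1) * z = z ^ p := fun hz => by
    rw [← Real.rpow_add_one' hz (by linarith)]; congr 1; ring
  -- Two applications of Young's inequality spend `κ E^p` each; of the ellipticity constant `a⁻¹`
  -- there remains `a⁻¹ - 2κ = (2a)⁻¹`.
  obtain ⟨κ, hκ⟩ : ∃ κ, κ = (4 * a)⁻¹ := ⟨_, rfl⟩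
  have hκ0 : 0 < κ := by rw [hκ]; positivity
  have hκp : κ ^ (1 - p) = (4 * a) ^ (p - 1) := by
    rw [hκ, Real.inv_rpow (by positivity), ← Real.rpow_neg (by positivity)]; congr 1; ring
  set E := η * P * V with hE
  set W := η * H with hW
  set Z := H * D with hZ
  have hE0 : 0 ≤ E := by positivity
  have hW0 : 0 ≤ W := by positivity
  have hZ0 : 0 ≤ Z := by positivity
  -- rewriting the products
  have e1 : η ^ p * P ^ p * V ^ p = E ^ p := by
    rw [hE, Real.mul_rpow (by positivity) hV, Real.mul_rpow hη hP]
  have e2 : η ^ p * P ^ p * U ^ p = β ^ p * W ^ p := by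
    rw [hW, ← Real.mul_rpow hη hP, ← Real.mul_rpow (by positivity) hU.le,
      ← Real.mul_rpow hβ0.le (by positivity)]
    congr 1
    calc η * P * U = η * (U * P) := by ring
      _ = _ := by rw [hUP]; ring
  have e3 : U * P ^ p * (η ^ (p - 1) * V ^ (p - 1)) = β * (E ^ (p - 1) * H) := by
    rw [hE, Real.mul_rpow (by positivity) hV, Real.mul_rpow hη hP, ← hsplit hP]
    linear_combination η ^ (p - 1) * P ^ (p - 1) * V ^ (p - 1) * hUP
  have e4 : U * P ^ p * (η ^ (p - 1) * U ^ (p - 1)) = β ^ p * (W ^ (p - 1) * H) := by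
    have : η ^ (p - 1) * P ^ (p - 1) * U ^ (p - 1) = β ^ (p - 1) * W ^ (p - 1) := by
      rw [hW, ← Real.mul_rpow hη hP, ← Real.mul_rpow (by positivity) hU.le,
        ← Real.mul_rpow hβ0.le (by positivity)]
      congr 1
      calc η * P * U = η * (U * P) := by ring
        _ = _ := by rw [hUP]; ring
    rw [← hsplit hP, ← hsplit hβ0.le]
    linear_combination (U * P) * this + β ^ (p - 1) * W ^ (p - 1) * hUP
  have hη' : η ^ (p - 1) * η = η ^ p := hsplit hη
  -- lower bound for `f`
  have t1 : -(U * P ^ p * (p * η ^ (p - 1)) * (D * (a * V ^ (p - 1) + b * U ^ (p - 1)))) ≤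
      G * (p * η ^ (p - 1) * i₁) := by
    refine neg_le_of_abs_le ?_
    rw [abs_mul, abs_mul, abs_of_nonneg (by positivity : 0 ≤ p * η ^ (p - 1))]
    calc |G| * (p * η ^ (p - 1) * |i₁|) = |G| * (p * η ^ (p - 1)) * |i₁| := by ring
      _ ≤ _ := by gcongr
  have t2 : η ^ p * P ^ p * (a⁻¹ * V ^ p - h * U ^ p) ≤ η ^ p * P ^ p * i₂ := by gcongr
  have t3 : -(η ^ p * (U * P ^ p) * (c * V ^ (p - 1) + d * U ^ (p - 1))) ≤ η ^ p * G * Bv := by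
    refine neg_le_of_abs_le ?_
    rw [abs_mul, abs_mul, abs_of_nonneg (by positivity : 0 ≤ η ^ p)]
    gcongr
  have s1 : U * P ^ p * (p * η ^ (p - 1)) * (D * (a * V ^ (p - 1) + b * U ^ (p - 1))) =
      E ^ (p - 1) * (p * a * β * Z) + p * β ^ p * (b * (W ^ (p - 1) * Z)) := by
    rw [hZ]
    linear_combination p * D * a * e3 + p * D * b * e4
  have s2 : η ^ p * P ^ p * (a⁻¹ * V ^ p - h * U ^ p) = a⁻¹ * E ^ p - h * (β ^ p * W ^ p) := by
    linear_combination a⁻¹ * e1 - h * e2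
  have s3 : η ^ p * (U * P ^ p) * (c * V ^ (p - 1) + d * U ^ (p - 1)) =
      E ^ (p - 1) * (β * c * W) + d * (β ^ p * W ^ p) := by
    rw [← hη', ← hsplit hW0]
    linear_combination c * η * e3 + d * η * e4 + (c * β * E ^ (p - 1) +
      d * β ^ p * W ^ (p - 1)) * (hW.symm)
  have y1 := rpow_mul_le_young hp hκ0 hE0 (by positivity : 0 ≤ p * a * β * Z)
  have y2 := rpow_mul_le_young hp hκ0 hE0 (by positivity : 0 ≤ β * c * W)
  -- The factor `b` is put into the base, as `b^(1/(p-1)) W`. The parameter `δ` stays free: `b` is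
  -- only critically integrable, so the smallness of its term must come from `δ`.
  have y3 : b * (W ^ (p - 1) * Z) ≤ δ * (b ^ (p / (p - 1)) * W ^ p) + δ ^ (1 - p) * Z ^ p := by
    have hx : 0 ≤ b ^ (1 / (p - 1)) * W := by positivity
    have := rpow_mul_le_young hp hδ hx hZ0
    rw [Real.mul_rpow (by positivity) hW0, Real.mul_rpow (by positivity) hW0,
      ← Real.rpow_mul hb, ← Real.rpow_mul hb, one_div_mul_cancel hp1.ne', Real.rpow_one,
      one_div_mul_eq_div] at this
    linarith
  rw [Real.mul_rpow (by positivity) hZ0, Real.mul_rpow (by positivity) hβ0.le, hκp] at y1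
  rw [Real.mul_rpow (by positivity) hW0, Real.mul_rpow hβ0.le hc, hκp] at y2
  have hκa : a⁻¹ = (2 * a)⁻¹ + κ + κ := by rw [hκ]; field_simp; norm_num
  have hA : 0 ≤ (4 * a) ^ (p - 1) := by positivity
  have hA1 : 0 ≤ (p * a) ^ p := by positivity
  set A1 := (4 * a) ^ (p - 1)
  set A2 := (p * a) ^ p
  set X := β ^ p * W ^ p with hX
  set Y := β ^ p * Z ^ p with hY
  have hX0 : 0 ≤ X := by positivity
  have hY0 : 0 ≤ Y := by positivity
  have hδ' : 0 ≤ δ ^ (1 - p) := by positivity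
  have hcp : 0 ≤ c ^ p := by positivity
  have hbp : 0 ≤ b ^ (p / (p - 1)) := by positivity
  set cp := c ^ p
  set bp := b ^ (p / (p - 1))
  set dp := δ ^ (1 - p)
  have y3' : p * β ^ p * (b * (W ^ (p - 1) * Z)) ≤ p * (δ * bp * X + dp * Y) := by
    have := mul_le_mul_of_nonneg_left y3 (by positivity : 0 ≤ p * β ^ p)
    refine this.trans_eq ?_
    rw [hX, hY]; ring
  have hlow : (2 * a)⁻¹ * E ^ p ≤ f + ((h + d) * X + A1 * A2 * Y + p * (δ * bp * X + dp * Y) +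
      A1 * cp * X) := by
    rw [s1] at t1
    rw [s2] at t2
    rw [s3] at t3
    have hκE : a⁻¹ * E ^ p = (2 * a)⁻¹ * E ^ p + κ * E ^ p + κ * E ^ p := by rw [hκa]; ring
    rw [hf]
    have y1' : E ^ (p - 1) * (p * a * β * Z) ≤ κ * E ^ p + A1 * A2 * Y := by
      rw [hY]; linarith
    have y2' : E ^ (p - 1) * (β * c * W) ≤ κ * E ^ p + A1 * cp * X := by
      rw [hX]; linarith
    linarith
  refine hlow.trans ?_
  have hfin : (h + d) * X + A1 * A2 * Y + p * (δ * bp * X + dp * Y) + A1 * cp * X ≤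
      energyConst p a * ((h + d + cp + δ * bp) * X + (1 + dp) * Y) := by
    have : energyConst p a = 1 + p + A1 + A1 * A2 := by
      change 1 + p + A1 * (1 + A2) = _; ring
    rw [this]
    have z1 : 0 ≤ (h + d) * X := by positivity
    have z2 : 0 ≤ cp * X := by positivity
    have z3 : 0 ≤ δ * bp * X := by positivity
    have z4 : 0 ≤ dp * Y := by positivity
    have z5 : 0 ≤ A1 * A2 := by positivity
    have m1 := mul_le_mul_of_nonneg_right (by linarith : 1 ≤ 1 + p + A1 + A1 * A2) z1
    have m2 := mul_le_mul_of_nonneg_right (by linarith : A1 ≤ 1 + p + A1 + A1 * A2) z2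
    have m3 := mul_le_mul_of_nonneg_right (by linarith : p ≤ 1 + p + A1 + A1 * A2) z3
    have m4 := mul_le_mul_of_nonneg_right (by linarith : p ≤ 1 + p + A1 + A1 * A2) z4
    have m5 := mul_le_mul_of_nonneg_right (by linarith : A1 * A2 ≤ 1 + p + A1 + A1 * A2) hY0
    linarith
  have : energyConst p a * ((h + d + cp + δ * bp) * X + (1 + dp) * Y) =
      energyConst p a * β ^ p * ((h + d + cp + δ * bp) * W ^ p + (1 + dp) * Z ^ p) := by
    rw [hX, hY]; ring
  linarith

lemma absorb_aux {C L T w z b b1 b2 B : ℝ} (hC : 0 ≤ C) (hL : 0 ≤ L) (hT : 0 ≤ T) (hw : 0 ≤ w)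
    (hz : 0 ≤ z) (hB : 0 ≤ B) (h1 : b * b1 ≤ B) (h2 : b * b2 ≤ B) (h3 : b ≤ B) (h4 : 1 ≤ B) :
    C * b * (L * b1 * w + (1 + T * b2) * z) + z + w ≤
      (1 + C * L + C * (1 + T)) * B * (w + z) := by
  have w1 := mul_le_mul_of_nonneg_left h1 (by positivity : 0 ≤ C * L * w)
  have w2 := mul_le_mul_of_nonneg_left h3 (by positivity : 0 ≤ C * z)
  have w3 := mul_le_mul_of_nonneg_left h2 (by positivity : 0 ≤ C * T * z)
  have w4 : z ≤ B * z := le_mul_of_one_le_left hz h4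
  have w5 : w ≤ B * w := le_mul_of_one_le_left hw h4
  have w6 : 0 ≤ C * L * B * z := by positivity
  have w7 : 0 ≤ C * B * w := by positivity
  have w8 : 0 ≤ C * T * B * w := by positivity
  linarith

/-- Here `Y`, `E`, `W`, `Z` stand for `‖ηH‖_{pσ}`, the energy, `‖ηH‖_p` and the cutoff term.
Choosing `δ` and `L` according to `β` makes the coefficient of `Y^p` at most one half, and `δ^(1-p)`
and `L` then cost only powers of `β`. -/
lemma absorb_real {p ε C C₁ M : ℝ} (hp : 1 < p) (hε : 0 < ε) (hC : 0 ≤ C) (hC₁ : 0 ≤ C₁)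
    (hM : 0 ≤ M) : ∃ K : ℝ, 0 < K ∧ ∀ β Y E W Z : ℝ, 1 ≤ β → 0 ≤ Y → 0 ≤ E → 0 ≤ W → 0 ≤ Z →
      Y ≤ C * (E + Z + W) →
      (∀ δ L : ℝ, 0 < δ → 0 < L → E ^ p ≤ C₁ * β ^ p * ((δ * M + L ^ (-ε) * M) * Y ^ p
        + L * W ^ p + (1 + δ ^ (1 - p)) * Z ^ p)) →
      Y ^ p ≤ K * β ^ (p + p / ε + p ^ 2) * (W ^ p + Z ^ p) := by
  have hp0 : 0 < p := by linarith
  obtain ⟨K0, hK0, hK1⟩ : ∃ K0 : ℝ, 1 ≤ K0 ∧ (3 * C) ^ p ≤ K0 :=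
    ⟨1 + (3 * C) ^ p, by have : 0 ≤ (3 * C) ^ p := by positivity
                         linarith, by linarith⟩
  -- Large enough that `2 K0 C₁ M / T ≤ 1/2`.
  obtain ⟨T, hT⟩ : ∃ T : ℝ, T = 4 * K0 * (C₁ + 1) * (M + 1) := ⟨_, rfl⟩
  have hT1 : 1 ≤ T := by
    rw [hT]
    have : 1 ≤ K0 * (C₁ + 1) := by nlinarith
    nlinarith
  have hT0 : 0 < T := by linarith
  set L₀ : ℝ := T ^ (1 / ε) with hL₀
  have hL₀0 : 0 < L₀ := by positivity
  refine ⟨2 * K0 * (1 + C₁ * L₀ + C₁ * (1 + T ^ (p - 1))), by positivity, ?_⟩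
  intro β Y E W Z hβ hY hE hW hZ hY1 hE1
  have hβ0 : 0 < β := by linarith
  have hβp : 0 < β ^ p := by positivity
  -- With this `L` one has `L^(-ε) = δ = (T β^p)⁻¹`, which cancels the factor `β^p` in front of both
  -- terms with `Y^p`.
  have h1 := hE1 (T * β ^ p)⁻¹ ((T * β ^ p) ^ (1 / ε))
    (by positivity) (by positivity)
  have hLe : ((T * β ^ p) ^ (1 / ε)) ^ (-ε) = (T * β ^ p)⁻¹ := by
    rw [← Real.rpow_mul (by positivity), one_div, mul_neg, inv_mul_cancel₀ hε.ne',
      Real.rpow_neg_one]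
  have hL : (T * β ^ p) ^ (1 / ε) = L₀ * β ^ (p / ε) := by
    rw [Real.mul_rpow hT0.le hβp.le, ← Real.rpow_mul hβ0.le]; congr 2; ring
  have hδ : ((T * β ^ p)⁻¹) ^ (1 - p) = T ^ (p - 1) * β ^ (p * (p - 1)) := by
    rw [Real.inv_rpow (by positivity), ← Real.rpow_neg (by positivity), neg_sub,
      Real.mul_rpow hT0.le hβp.le, ← Real.rpow_mul hβ0.le]
  rw [hLe, hL, hδ] at h1
  have h3 : Y ^ p ≤ K0 * (E ^ p + Z ^ p + W ^ p) := by
    have hm : ∀ x y z : ℝ, 0 ≤ x → 0 ≤ y → 0 ≤ z → (x + y + z) ^ p ≤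
        3 ^ p * (x ^ p + y ^ p + z ^ p) := by
      intro x y z hx hy hz
      have hle : x + y + z ≤ 3 * max x (max y z) := by
        have := le_max_left x (max y z)
        have := (le_max_left y z).trans (le_max_right x (max y z))
        have := (le_max_right y z).trans (le_max_right x (max y z))
        linarith
      refine (Real.rpow_le_rpow (by positivity) hle hp0.le).trans ?_
      rw [Real.mul_rpow (by norm_num) (by positivity)]
      have x1 : 0 ≤ x ^ p := by positivity
      have x2 : 0 ≤ y ^ p := by positivity
      have x3 : 0 ≤ z ^ p := by positivity
      gcongr
      rcases max_choice x (max y z) with h | h <;> rw [h]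
      · linarith
      · rcases max_choice y z with h | h <;> rw [h] <;> linarith
    calc Y ^ p ≤ (C * (E + Z + W)) ^ p := Real.rpow_le_rpow hY hY1 hp0.le
      _ = C ^ p * (E + Z + W) ^ p := Real.mul_rpow hC (by positivity)
      _ ≤ C ^ p * (3 ^ p * (E ^ p + Z ^ p + W ^ p)) := by
        gcongr; exact hm _ _ _ hE hZ hW
      _ = (3 * C) ^ p * (E ^ p + Z ^ p + W ^ p) := by
        rw [Real.mul_rpow (by norm_num) hC]; ring
      _ ≤ _ := by gcongr
  have hTM : K0 * C₁ * (2 * M) ≤ T / 2 := by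
    rw [hT]
    have : 0 ≤ K0 * (C₁ + M + 1) := by positivity
    nlinarith
  have hcoef : K0 * (C₁ * β ^ p * (((T * β ^ p)⁻¹ * M + (T * β ^ p)⁻¹ * M) * Y ^ p)) ≤
      1 / 2 * Y ^ p := by
    have e : K0 * (C₁ * β ^ p * (((T * β ^ p)⁻¹ * M + (T * β ^ p)⁻¹ * M) * Y ^ p)) =
        K0 * C₁ * (2 * M) / T * Y ^ p := by field_simp; ring
    rw [e]
    refine mul_le_mul_of_nonneg_right ?_ (by positivity)
    rw [div_le_iff₀ hT0]
    linarith
  set b1 := β ^ (p / ε) with hb1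
  set b2 := β ^ (p * (p - 1)) with hb2
  -- One exponent dominating `p`, `p + p/ε` (from `L`) and `p + p(p-1)` (from `δ^(1-p)`).
  set Bt := β ^ (p + p / ε + p ^ 2) with hBt
  have q1 : β ^ p * b1 ≤ Bt := by
    rw [hb1, hBt, ← Real.rpow_add hβ0]
    exact Real.rpow_le_rpow_of_exponent_le hβ (by nlinarith [sq_nonneg p])
  have q2 : β ^ p * b2 ≤ Bt := by
    rw [hb2, hBt, ← Real.rpow_add hβ0]
    refine Real.rpow_le_rpow_of_exponent_le hβ ?_
    have : 0 ≤ p / ε := by positivity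
    nlinarith
  have q3 : β ^ p ≤ Bt := by
    refine Real.rpow_le_rpow_of_exponent_le hβ ?_
    have : 0 ≤ p / ε := by positivity
    nlinarith [sq_nonneg p]
  have q4 : 1 ≤ Bt := Real.one_le_rpow hβ (by positivity)
  have hWp : 0 ≤ W ^ p := by positivity
  have hZp : 0 ≤ Z ^ p := by positivity
  have hT2 : 0 ≤ T ^ (p - 1) := by positivity
  have h4 : Y ^ p ≤ 1 / 2 * Y ^ p + K0 * (C₁ * β ^ p * (L₀ * b1 * W ^ p +
      (1 + T ^ (p - 1) * b2) * Z ^ p) + Z ^ p + W ^ p) := by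
    have := mul_le_mul_of_nonneg_left h1 (by linarith : 0 ≤ K0)
    linarith
  have h5 : C₁ * β ^ p * (L₀ * b1 * W ^ p + (1 + T ^ (p - 1) * b2) * Z ^ p) + Z ^ p + W ^ p ≤
      (1 + C₁ * L₀ + C₁ * (1 + T ^ (p - 1))) * Bt * (W ^ p + Z ^ p) := by
    exact absorb_aux hC₁ hL₀0.le hT2 hWp hZp (by positivity) q1 q2 q3 q4
  have := mul_le_mul_of_nonneg_left h5 (by linarith : 0 ≤ K0)
  linarith

/-! ### The energy inequality in terms of norms -/

section EnergyNorms

variable {α : Type*} [MeasurableSpace α] {μ : Measure α}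

/-- Integrability of `R` need not be known in advance: if it fails, the right side is infinite. -/
lemma eLpNorm_one_le_of_integral_nonpos {X R : α → ℝ} (hX : Integrable X μ)
    (hX0 : 0 ≤ᵐ[μ] X) (hR : AEStronglyMeasurable R μ) (hR0 : 0 ≤ᵐ[μ] R)
    (h : Integrable (fun x => X x - R x) μ → ∫ x, (X x - R x) ∂μ ≤ 0) :
    eLpNorm X 1 μ ≤ eLpNorm R 1 μ := by
  by_cases hRi : Integrable R μ
  · have h1 := h (hX.sub hRi)
    rw [integral_sub hX hRi] at h1
    have e : ∀ {f : α → ℝ}, Integrable f μ → 0 ≤ᵐ[μ] f →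
        eLpNorm f 1 μ = ENNReal.ofReal (∫ x, f x ∂μ) := by
      intro f hf hf0
      rw [ofReal_integral_eq_lintegral_ofReal hf hf0, eLpNorm_one_eq_lintegral_enorm]
      refine lintegral_congr_ae ?_
      filter_upwards [hf0] with x hx
      exact Real.enorm_of_nonneg hx
    rw [e hX hX0, e hRi hR0]
    exact ENNReal.ofReal_le_ofReal (by linarith)
  · have : eLpNorm R 1 μ = ∞ := by
      by_contra hne
      exact hRi (memLp_one_iff_integrable.1 ⟨hR, lt_top_iff_ne_top.2 hne⟩)
    rw [this]
    exact le_top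

lemma eLpNorm_rpow_of_nonneg {f : α → ℝ} (hf : 0 ≤ᵐ[μ] f) {q : ℝ} (hq : 0 < q) (s : ℝ≥0∞) :
    eLpNorm (fun x => f x ^ q) s μ = eLpNorm f (s * ENNReal.ofReal q) μ ^ q := by
  rw [← eLpNorm_norm_rpow f hq]
  refine eLpNorm_congr_ae ?_
  filter_upwards [hf] with x hx
  rw [Real.norm_of_nonneg hx]

lemma eLpNorm_const_mul_of_nonneg (f : α → ℝ) {c : ℝ} (hc : 0 ≤ c) (s : ℝ≥0∞) :
    eLpNorm (fun x => c * f x) s μ = ENNReal.ofReal c * eLpNorm f s μ := by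
  have := eLpNorm_const_smul c f s μ
  rw [Real.enorm_of_nonneg hc] at this
  exact this

lemma ofReal_inv_add_inv_conjExponent {σ : ℝ} (hσ : 1 < σ) :
    (ENNReal.ofReal σ.conjExponent)⁻¹ + (ENNReal.ofReal σ)⁻¹ = 1⁻¹ := by
  have h := Real.HolderConjugate.conjExponent hσ
  rw [← ENNReal.ofReal_inv_of_pos h.symm.pos, ← ENNReal.ofReal_inv_of_pos h.pos,
    ← ENNReal.ofReal_add (inv_nonneg.2 h.symm.nonneg) (inv_nonneg.2 h.nonneg), add_comm,
    h.inv_add_inv_eq_one]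
  simp

/-- Hölder with exponents `σ'` and `σ`. `Γ` lies in `L^{σ'(1+ε)}` and is split as in
`le_add_rpow_mul`, whereas `b^{p'}` lies just in `L^{σ'}` and keeps its factor `δ`. -/
lemma eLpNorm_energy_le {p σ ε δ L C : ℝ} (hp : 1 < p) (hσ : 1 < σ) (hε : 0 < ε) (hδ : 0 < δ)
    (hL : 0 < L) (hC : 0 ≤ C) {E W Z Γ b : α → ℝ} (hW : AEStronglyMeasurable W μ)
    (hZ : AEStronglyMeasurable Z μ) (hΓ : AEStronglyMeasurable Γ μ)
    (hb : AEStronglyMeasurable b μ) (hE0 : 0 ≤ᵐ[μ] E) (hW0 : 0 ≤ᵐ[μ] W) (hZ0 : 0 ≤ᵐ[μ] Z)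
    (hΓ0 : 0 ≤ᵐ[μ] Γ) (hb0 : 0 ≤ᵐ[μ] b)
    (h : eLpNorm (fun x => E x ^ p) 1 μ ≤ eLpNorm (fun x => C *
      ((Γ x + δ * b x ^ p.conjExponent) * W x ^ p + (1 + δ ^ (1 - p)) * Z x ^ p)) 1 μ) :
    eLpNorm E (ENNReal.ofReal p) μ ^ p ≤ ENNReal.ofReal C *
      ((ENNReal.ofReal δ *
          eLpNorm b (ENNReal.ofReal (p.conjExponent * σ.conjExponent)) μ ^ p.conjExponent +
        ENNReal.ofReal (L ^ (-ε)) *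
          eLpNorm Γ (ENNReal.ofReal (σ.conjExponent * (1 + ε))) μ ^ (1 + ε)) *
        eLpNorm W (ENNReal.ofReal (p * σ)) μ ^ p +
      ENNReal.ofReal L * eLpNorm W (ENNReal.ofReal p) μ ^ p +
      ENNReal.ofReal (1 + δ ^ (1 - p)) * eLpNorm Z (ENNReal.ofReal p) μ ^ p) := by
  have hp0 : 0 < p := by linarith
  have hpc := Real.HolderConjugate.conjExponent hp
  have hσc := Real.HolderConjugate.conjExponent hσ
  have hp'0 : 0 < p.conjExponent := hpc.symm.pos
  have hσ'0 : 0 < σ.conjExponent := hσc.symm.pos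
  have hσ'1 : 1 ≤ σ.conjExponent := hσc.symm.lt.le
  have hWp : AEStronglyMeasurable (fun x => W x ^ p) μ :=
    (hW.aemeasurable.pow_const p).aestronglyMeasurable
  have hZp : AEStronglyMeasurable (fun x => Z x ^ p) μ :=
    (hZ.aemeasurable.pow_const p).aestronglyMeasurable
  have hΓp : AEStronglyMeasurable (fun x => Γ x ^ (1 + ε)) μ :=
    (hΓ.aemeasurable.pow_const _).aestronglyMeasurable
  have hbp : AEStronglyMeasurable (fun x => b x ^ p.conjExponent) μ :=
    (hb.aemeasurable.pow_const _).aestronglyMeasurable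
  have hone : ∀ {f : α → ℝ}, 0 ≤ᵐ[μ] f →
      eLpNorm (fun x => f x ^ p) 1 μ = eLpNorm f (ENNReal.ofReal p) μ ^ p := fun hf => by
    rw [eLpNorm_rpow_of_nonneg hf hp0, one_mul]
  rw [← hone hE0]
  refine h.trans ?_
  rw [eLpNorm_const_mul_of_nonneg _ hC]
  refine mul_le_mul_right ?_ _
  set Θ : α → ℝ := fun x => δ * b x ^ p.conjExponent + L ^ (-ε) * Γ x ^ (1 + ε) with hΘ
  have hδ1 : 0 ≤ 1 + δ ^ (1 - p) := by positivity
  have hΘm : AEStronglyMeasurable Θ μ := (hbp.const_mul _).add (hΓp.const_mul _)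
  have hΘn : eLpNorm Θ (ENNReal.ofReal σ.conjExponent) μ ≤ ENNReal.ofReal δ *
          eLpNorm b (ENNReal.ofReal (p.conjExponent * σ.conjExponent)) μ ^ p.conjExponent +
        ENNReal.ofReal (L ^ (-ε)) *
          eLpNorm Γ (ENNReal.ofReal (σ.conjExponent * (1 + ε))) μ ^ (1 + ε) := by
    refine (eLpNorm_add_le (hbp.const_mul _) (hΓp.const_mul _)
      (ENNReal.one_le_ofReal_of_one_le hσ'1)).trans_eq ?_
    rw [eLpNorm_const_mul_of_nonneg _ hδ.le, eLpNorm_const_mul_of_nonneg _ (by positivity),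
      eLpNorm_rpow_of_nonneg hb0 hp'0, eLpNorm_rpow_of_nonneg hΓ0 (by positivity),
      ← ENNReal.ofReal_mul hσ'0.le, ← ENNReal.ofReal_mul hσ'0.le, mul_comm σ.conjExponent
        p.conjExponent]
  calc _ ≤ eLpNorm (fun x => (Θ x * W x ^ p + L * W x ^ p) +
        (1 + δ ^ (1 - p)) * Z x ^ p) 1 μ := by
        refine eLpNorm_mono_ae ?_
        filter_upwards [hΓ0, hb0, hW0, hZ0] with x h1 h2 h3 h4
        have h1 : 0 ≤ Γ x := h1
        have h2 : 0 ≤ b x := h2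
        have h3 : 0 ≤ W x := h3
        have h4 : 0 ≤ Z x := h4
        have h5 := le_add_rpow_mul hL hε h1
        have h6 : 0 ≤ W x ^ p := by positivity
        have h7 := mul_le_mul_of_nonneg_right h5 h6
        rw [Real.norm_of_nonneg (by positivity)]
        refine le_trans ?_ (le_abs_self _)
        simp only [hΘ]
        linarith
    _ ≤ (eLpNorm (fun x => Θ x * W x ^ p) 1 μ + eLpNorm (fun x => L * W x ^ p) 1 μ) +
        eLpNorm (fun x => (1 + δ ^ (1 - p)) * Z x ^ p) 1 μ :=
        (eLpNorm_add_le ((hΘm.mul hWp).add (hWp.const_mul _)) (hZp.const_mul _) le_rfl).trans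
          (add_le_add_left (eLpNorm_add_le (hΘm.mul hWp) (hWp.const_mul _) le_rfl) _)
    _ ≤ _ := by
        rw [eLpNorm_const_mul_of_nonneg _ hL.le, eLpNorm_const_mul_of_nonneg _ hδ1, hone hW0,
          hone hZ0]
        refine add_le_add_left (add_le_add_left ?_ _) _
        refine (eLpNorm_mul_le_of_inv_add_inv hΘm hWp
          (ofReal_inv_add_inv_conjExponent hσ)).trans ?_
        rw [eLpNorm_rpow_of_nonneg hW0 hp0, ← ENNReal.ofReal_mul (by linarith), mul_comm σ p]
        exact mul_le_mul_left hΘn _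

/-- Absorption is legitimate only because `Y` is finite. An infinite `Z` is harmless, the conclusion
being trivial then. -/
lemma exists_absorb_const {p ε C C₁ M : ℝ} (hp : 1 < p) (hε : 0 < ε) (hC : 0 ≤ C)
    (hC₁ : 0 ≤ C₁) (hM : 0 ≤ M) : ∃ K : ℝ≥0, ∀ (β : ℝ) (Y E W Z : ℝ≥0∞), 1 ≤ β → Y ≠ ∞ → E ≠ ∞ →
      W ≠ ∞ → Y ≤ ENNReal.ofReal C * (E + Z + W) →
      (∀ δ L : ℝ, 0 < δ → 0 < L → E ^ p ≤ ENNReal.ofReal (C₁ * β ^ p) *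
        ((ENNReal.ofReal δ * ENNReal.ofReal M + ENNReal.ofReal (L ^ (-ε)) * ENNReal.ofReal M) *
          Y ^ p + ENNReal.ofReal L * W ^ p + ENNReal.ofReal (1 + δ ^ (1 - p)) * Z ^ p)) →
      Y ≤ K * ENNReal.ofReal (β ^ ((p + p / ε + p ^ 2) / p)) * (W + Z) := by
  have hp0 : 0 < p := by linarith
  obtain ⟨K, hK0, hK⟩ := absorb_real hp hε hC hC₁ hM
  refine ⟨(K ^ (1 / p)).toNNReal, fun β Y E W Z hβ hY hE hW h1 h2 => ?_⟩
  have hβ0 : 0 < β := by linarith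
  have hKp : 0 < K ^ (1 / p) := by positivity
  change _ ≤ ENNReal.ofReal (K ^ (1 / p)) * _ * _
  by_cases hZ : Z = ∞
  · have : ENNReal.ofReal (K ^ (1 / p)) * ENNReal.ofReal (β ^ ((p + p / ε + p ^ 2) / p)) *
        (W + Z) = ∞ := by
      rw [hZ, add_top, ENNReal.mul_top]
      rw [← ENNReal.ofReal_mul hKp.le]
      simp only [ne_eq, ENNReal.ofReal_eq_zero, not_le]
      positivity
    rw [this]
    exact le_top
  obtain ⟨y, hy0, rfl⟩ : ∃ y : ℝ, 0 ≤ y ∧ Y = ENNReal.ofReal y :=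
    ⟨Y.toReal, ENNReal.toReal_nonneg, (ENNReal.ofReal_toReal hY).symm⟩
  obtain ⟨e, he0, rfl⟩ : ∃ y : ℝ, 0 ≤ y ∧ E = ENNReal.ofReal y :=
    ⟨E.toReal, ENNReal.toReal_nonneg, (ENNReal.ofReal_toReal hE).symm⟩
  obtain ⟨w, hw0, rfl⟩ : ∃ y : ℝ, 0 ≤ y ∧ W = ENNReal.ofReal y :=
    ⟨W.toReal, ENNReal.toReal_nonneg, (ENNReal.ofReal_toReal hW).symm⟩
  obtain ⟨z, hz0, rfl⟩ : ∃ y : ℝ, 0 ≤ y ∧ Z = ENNReal.ofReal y :=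
    ⟨Z.toReal, ENNReal.toReal_nonneg, (ENNReal.ofReal_toReal hZ).symm⟩
  have key := hK β y e w z hβ hy0 he0 hw0 hz0 ?_ ?_
  · rw [← ENNReal.ofReal_add hw0 hz0, ← ENNReal.ofReal_mul hKp.le,
      ← ENNReal.ofReal_mul (by positivity)]
    refine ENNReal.ofReal_le_ofReal ?_
    have h3 : y = (y ^ p) ^ (1 / p) := by
      rw [← Real.rpow_mul hy0, mul_one_div_cancel hp0.ne', Real.rpow_one]
    rw [h3]
    have h4 : w ^ p + z ^ p ≤ (w + z) ^ p := Real.add_rpow_le_rpow_add hw0 hz0 hp.le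
    calc (y ^ p) ^ (1 / p) ≤ (K * β ^ (p + p / ε + p ^ 2) * (w + z) ^ p) ^ (1 / p) := by
          refine Real.rpow_le_rpow (by positivity) (key.trans ?_) (by positivity)
          gcongr
      _ = _ := by
          rw [Real.mul_rpow (by positivity) (by positivity),
            Real.mul_rpow (by positivity) (by positivity), ← Real.rpow_mul hβ0.le,
            ← Real.rpow_mul (by positivity), mul_one_div_cancel hp0.ne', Real.rpow_one,
            mul_one_div]
  · rw [← ENNReal.ofReal_add he0 hz0, ← ENNReal.ofReal_add (by positivity) hw0,
      ← ENNReal.ofReal_mul hC] at h1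
    exact (ENNReal.ofReal_le_ofReal_iff (by positivity)).1 h1
  · intro δ L hδ hL
    have h3 := h2 δ L hδ hL
    rw [ENNReal.ofReal_rpow_of_nonneg he0 hp0.le, ENNReal.ofReal_rpow_of_nonneg hy0 hp0.le,
      ENNReal.ofReal_rpow_of_nonneg hw0 hp0.le, ENNReal.ofReal_rpow_of_nonneg hz0 hp0.le,
      ← ENNReal.ofReal_mul (by positivity), ← ENNReal.ofReal_mul (by positivity),
      ← ENNReal.ofReal_add (by positivity) (by positivity), ← ENNReal.ofReal_mul (by positivity),
      ← ENNReal.ofReal_mul (by positivity), ← ENNReal.ofReal_mul (by positivity),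
      ← ENNReal.ofReal_add (by positivity) (by positivity),
      ← ENNReal.ofReal_add (by positivity) (by positivity),
      ← ENNReal.ofReal_mul (by positivity)] at h3
    exact (ENNReal.ofReal_le_ofReal_iff (by positivity)).1 h3

end EnergyNorms

/-! ### The local problem on a ball -/

section Helpers

variable {α : Type*} [MeasurableSpace α] {μ : Measure α}

lemma ofReal_inv_add_inv {x y z : ℝ} (hx : 0 < x) (hy : 0 < y) (hz : 0 < z)
    (h : x⁻¹ + y⁻¹ = z⁻¹) :
    (ENNReal.ofReal x)⁻¹ + (ENNReal.ofReal y)⁻¹ = (ENNReal.ofReal z)⁻¹ := by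
  rw [← ENNReal.ofReal_inv_of_pos hx, ← ENNReal.ofReal_inv_of_pos hy,
    ← ENNReal.ofReal_inv_of_pos hz, ← ENNReal.ofReal_add (by positivity) (by positivity), h]

lemma MemLp.mul_of_inv_add_inv {f g : α → ℝ} {p q r : ℝ≥0∞} (hf : MemLp f p μ) (hg : MemLp g q μ)
    (h : p⁻¹ + q⁻¹ = r⁻¹) : MemLp (fun x => f x * g x) r μ :=
  ⟨hf.1.mul hg.1, (eLpNorm_mul_le_of_inv_add_inv hf.1 hg.1 h).trans_lt
    (ENNReal.mul_lt_top hf.2 hg.2)⟩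

lemma MemLp.rpow_of_nonneg {f : α → ℝ} {s q q' : ℝ} (hs : 0 ≤ s) (hq : 0 < q)
    (hq' : s * q = q') (hf : MemLp f (ENNReal.ofReal q') μ) (hf0 : 0 ≤ᵐ[μ] f) :
    MemLp (fun x => f x ^ q) (ENNReal.ofReal s) μ := by
  refine ⟨(hf.1.aemeasurable.pow_const q).aestronglyMeasurable, ?_⟩
  rw [eLpNorm_rpow_of_nonneg hf0 hq, ← ENNReal.ofReal_mul hs, hq']
  exact ENNReal.rpow_lt_top_of_nonneg hq.le hf.2.ne

end Helpers

section Cutoff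

variable {n : ℕ} {S : Set (Eucl n)} {p : ℝ} {η : Eucl n → ℝ}

lemma IsLipZero.rpow (hp : 1 ≤ p) (hη : IsLipZero S η) : IsLipZero S (fun x => η x ^ p) := by
  obtain ⟨⟨L, hL⟩, hc, hs⟩ := hη
  have h0 : (0 : ℝ) ^ p = 0 := Real.zero_rpow (by linarith)
  have hc' : HasCompactSupport fun x => η x ^ p := hc.comp_left (g := fun t : ℝ => t ^ p) h0
  have hd : ContDiff ℝ 1 fun t : ℝ => t ^ p := by
    have := Real.contDiff_rpow_const_of_le (p := p) (n := 1) (by simpa using hp)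
    exact_mod_cast this
  refine ⟨exists_lipschitzWith_of_hasCompactSupport
    (locallyLipschitzOn_univ.1 (hL.locallyLipschitz.locallyLipschitzOn.comp_locallyLipschitz
      hd.locallyLipschitz)) hc', hc', ?_⟩
  exact (closure_mono fun x hx => by
    intro h
    exact hx (by simp [h, h0])).trans hs

lemma gradient_rpow (hp : 1 ≤ p) {x : Eucl n} (hη : DifferentiableAt ℝ η x) :
    gradient (fun x => η x ^ p) x = (p * η x ^ (p - 1)) • gradient η x := by
  have h1 : HasFDerivAt (fun x => η x ^ p) ((p * η x ^ (p - 1)) • fderiv ℝ η x) x :=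
    (Real.hasDerivAt_rpow_const (Or.inr hp)).comp_hasFDerivAt x hη.hasFDerivAt
  unfold gradient
  rw [h1.fderiv, map_smulₛₗ]
  simp

end Cutoff

lemma avgNorm_ofReal {n : ℕ} {F : Type*} [NormedAddCommGroup F] {S : Set (Eucl n)}
    (f : Eucl n → F) {s : ℝ} (hs : 0 < s) :
    avgNorm f (ENNReal.ofReal s) S =
      (volume S)⁻¹ ^ (1 / s) * eLpNorm f (ENNReal.ofReal s) (volume.restrict S) := by
  rw [avgNorm, eLpNorm_ofReal_eq hs, eLpNorm_ofReal_eq hs, lintegral_smul_measure, smul_eq_mul,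
    ENNReal.mul_rpow_of_nonneg _ _ (by positivity)]

lemma eLpNorm_eq_avgNorm {n : ℕ} {F : Type*} [NormedAddCommGroup F] {S : Set (Eucl n)}
    (h0 : volume S ≠ 0) (h1 : volume S ≠ ∞) (f : Eucl n → F) {s : ℝ} (hs : 0 < s) :
    eLpNorm f (ENNReal.ofReal s) (volume.restrict S) =
      volume S ^ (1 / s) * avgNorm f (ENNReal.ofReal s) S := by
  rw [avgNorm_ofReal f hs, ← mul_assoc, ← ENNReal.mul_rpow_of_nonneg _ _ (by positivity),
    ENNReal.mul_inv_cancel h0 h1, ENNReal.one_rpow, one_mul]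

/-- The data of a weak solution on a ball `S` of radius `r`, with the structural conditions in
the homogeneous form `|z| ↦ shiftAbs k z` and normalized bounds `M` for the coefficients. -/
structure LocalProblem {n : ℕ} (Ω S : Set (Eucl n)) (Q : Eucl n → Matrix (Fin n) (Fin n) ℝ)
    (p σ a ε r k : ℝ) (CSob M : ℝ≥0) (t t' : ℝ≥0∞) (A : Eucl n → ℝ → Eucl n → Eucl n)
    (B : Eucl n → ℝ → Eucl n → ℝ) (u : Eucl n → ℝ) (v : Eucl n → Eucl n)
    (b c d h : Eucl n → ℝ) : Prop where
  isOpen : IsOpen Ω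
  admissible : IsAdmissibleMatrix Ω p Q
  subset : S ⊆ Ω
  volume_ne_zero : volume S ≠ 0
  volume_lt_top : volume S < ∞
  r_pos : 0 < r
  k_pos : 0 < k
  sobolev : ∀ (w : Eucl n → ℝ) (z : Eucl n → Eucl n), MemWZero Q p S w z →
    avgNorm w (ENNReal.ofReal (p * σ)) S ≤ CSob * (ENNReal.ofReal r *
      avgNorm (fun x => sqrtMul (Q x) (z x)) (ENNReal.ofReal p) S
        + avgNorm w (ENNReal.ofReal p) S)
  conj : t⁻¹ + t'⁻¹ = 1
  local_integrability : ∃ c₂ : ℝ≥0, ∀ w : Eucl n → ℝ, LocallyLipschitzOn Ω w →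
    eLpNorm w (ENNReal.ofReal p * t') (volume.restrict S) ≤ c₂ * sobNorm Q p Ω w (gradient w)
  weak_solution : IsWeakSolution Ω Q p A B u v
  u_mem : MemLp u (ENNReal.ofReal (p * σ)) (volume.restrict S)
  nonneg : ∀ᵐ x ∂(volume.restrict S), 0 ≤ b x ∧ 0 ≤ c x ∧ 0 ≤ d x ∧ 0 ≤ h x
  b_mem : MemLp b (ENNReal.ofReal (p.conjExponent * σ.conjExponent)) (volume.restrict S)
  c_mem : MemLp c (ENNReal.ofReal (p * σ.conjExponent)) (volume.restrict S)
  d_mem : MemLp d (ENNReal.ofReal σ.conjExponent) (volume.restrict S)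
  h_meas : AEStronglyMeasurable h (volume.restrict S)
  b_le : avgNorm (fun x => r ^ (p - 1) * b x)
    (ENNReal.ofReal (p.conjExponent * σ.conjExponent)) S ≤ M
  sum_le : avgNorm (fun x => r ^ p * h x + r ^ p * d x + (r * c x) ^ p)
    (ENNReal.ofReal (σ.conjExponent * (1 + ε))) S ≤ M
  structural : ∀ᵐ x ∂(volume.restrict S),
    (∀ ξ : Eucl n, |inner ℝ ξ (A x (u x) (v x))| ≤ ‖sqrtMul (Q x) ξ‖ *
      (a * ‖sqrtMul (Q x) (v x)‖ ^ (p - 1) + b x * shiftAbs k (u x) ^ (p - 1))) ∧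
    a⁻¹ * ‖sqrtMul (Q x) (v x)‖ ^ p - h x * shiftAbs k (u x) ^ p
      ≤ inner ℝ (v x) (A x (u x) (v x)) ∧
    |B x (u x) (v x)| ≤ c x * ‖sqrtMul (Q x) (v x)‖ ^ (p - 1)
      + d x * shiftAbs k (u x) ^ (p - 1)

namespace LocalProblem

variable {n : ℕ} {Ω S : Set (Eucl n)} {Q : Eucl n → Matrix (Fin n) (Fin n) ℝ}
  {p σ a ε r k : ℝ} {CSob M : ℝ≥0} {t t' : ℝ≥0∞} {A : Eucl n → ℝ → Eucl n → Eucl n}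
  {B : Eucl n → ℝ → Eucl n → ℝ} {u : Eucl n → ℝ} {v : Eucl n → Eucl n}
  {b c d h : Eucl n → ℝ}

lemma isFiniteMeasure (H : LocalProblem Ω S Q p σ a ε r k CSob M t t' A B u v b c d h) :
    IsFiniteMeasure (volume.restrict S) := ⟨by simpa using H.volume_lt_top⟩

lemma memLp_sqrtMul (H : LocalProblem Ω S Q p σ a ε r k CSob M t t' A B u v b c d h)
    (hp : 1 < p) :
    MemLp (fun x => ‖sqrtMul (Q x) (v x)‖) (ENNReal.ofReal p) (volume.restrict S) := by
  have hmono : volume.restrict S ≤ volume.restrict Ω := Measure.restrict_mono H.subset le_rfl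
  have h1 := H.weak_solution.1.eLpNorm_lt_top hp.le H.admissible H.isOpen
  exact ⟨(H.admissible.aemeasurable_norm H.isOpen H.subset
    (H.weak_solution.1.2.1.mono_measure hmono)).aestronglyMeasurable,
    (eLpNorm_mono_measure _ hmono).trans_lt h1.2⟩

lemma memLp_shiftAbs (H : LocalProblem Ω S Q p σ a ε r k CSob M t t' A B u v b c d h) :
    MemLp (fun x => shiftAbs k (u x)) (ENNReal.ofReal (p * σ)) (volume.restrict S) := by
  have := H.isFiniteMeasure
  refine (H.u_mem.norm.add (memLp_const k)).of_le
    (continuous_shiftAbs.comp_aestronglyMeasurable H.u_mem.1) (Eventually.of_forall fun x => ?_)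
  rw [Real.norm_of_nonneg (shiftAbs_pos H.k_pos _).le]
  exact (shiftAbs_le H.k_pos _).trans (le_abs_self _)

/-- The constant depends on `S`; it serves only to justify the test functions and never enters the
final estimate. -/
lemma exists_sobolev_const (H : LocalProblem Ω S Q p σ a ε r k CSob M t t' A B u v b c d h)
    (hp : 1 < p) (hσ : 1 < σ) : ∃ C : ℝ≥0, ∀ (w : Eucl n → ℝ) (z : Eucl n → Eucl n),
      MemWZero Q p S w z → eLpNorm w (ENNReal.ofReal (p * σ)) (volume.restrict S) ≤
        C * sobNorm Q p S w z := by
  have hp0 : 0 < p := by linarith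
  have hpσ : 0 < p * σ := by positivity
  set C : ℝ≥0∞ := volume S ^ (1 / (p * σ)) * (CSob * (ENNReal.ofReal r * (volume S)⁻¹ ^ (1 / p) +
    (volume S)⁻¹ ^ (1 / p))) with hC
  have hCt : C ≠ ∞ := by
    have h1 : (volume S)⁻¹ ^ (1 / p) ≠ ∞ :=
      ENNReal.rpow_ne_top_of_nonneg (by positivity) (ENNReal.inv_ne_top.2 H.volume_ne_zero)
    have h2 : volume S ^ (1 / (p * σ)) ≠ ∞ :=
      ENNReal.rpow_ne_top_of_nonneg (by positivity) H.volume_lt_top.ne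
    finiteness
  refine ⟨C.toNNReal, fun w z hw => ?_⟩
  rw [ENNReal.coe_toNNReal hCt, eLpNorm_eq_avgNorm H.volume_ne_zero H.volume_lt_top.ne _ hpσ, hC,
    mul_assoc]
  refine mul_le_mul_right ((H.sobolev w z hw).trans ?_) _
  rw [mul_assoc, avgNorm_ofReal _ hp0, avgNorm_ofReal _ hp0, add_mul, mul_assoc]
  have e1 := eLpNorm_sqrtMul_le_sobNorm (Q := Q) (S := S) hp0 w z
  rw [eLpNorm_norm] at e1
  have e2 := eLpNorm_le_sobNorm (Q := Q) (S := S) hp0 w z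
  gcongr

/-- Hölder with `b ∈ L^{p'σ'}` and `U^(p-1) ∈ L^{p'σ}`. -/
lemma memLp_flux_bound (H : LocalProblem Ω S Q p σ a ε r k CSob M t t' A B u v b c d h)
    (hp : 1 < p) (hσ : 1 < σ) :
    MemLp (fun x => a * ‖sqrtMul (Q x) (v x)‖ ^ (p - 1) + b x * shiftAbs k (u x) ^ (p - 1))
      (ENNReal.ofReal p.conjExponent) (volume.restrict S) := by
  have hpc := Real.HolderConjugate.conjExponent hp
  have hσc := Real.HolderConjugate.conjExponent hσ
  have hp'0 : 0 < p.conjExponent := hpc.symm.pos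
  have hσ'0 : 0 < σ.conjExponent := hσc.symm.pos
  have e : p.conjExponent * (p - 1) = p := by
    rw [Real.conjExponent]; exact div_mul_cancel₀ _ (by linarith)
  have h1 := MemLp.rpow_of_nonneg hp'0.le (by linarith) e (H.memLp_sqrtMul hp)
    (Eventually.of_forall fun x => norm_nonneg _)
  have h2 := MemLp.rpow_of_nonneg (s := p.conjExponent * σ) (q := p - 1) (by positivity)
    (by linarith) (by rw [mul_right_comm, e]) H.memLp_shiftAbs
    (Eventually.of_forall fun x => (shiftAbs_pos H.k_pos _).le)
  refine (h1.const_mul a).add (MemLp.mul_of_inv_add_inv H.b_mem h2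
    (ofReal_inv_add_inv (by positivity) (by positivity) hp'0 ?_))
  rw [mul_inv, mul_inv, ← mul_add, add_comm σ.conjExponent⁻¹, hσc.inv_add_inv_eq_one, mul_one]

/-- Both products have the exponent dual to `pσ`: `1/(pσ') + 1/p'` and `1/σ' + 1/(p'σ)` equal `1 -
1/(pσ)`. -/
lemma memLp_source_bound (H : LocalProblem Ω S Q p σ a ε r k CSob M t t' A B u v b c d h)
    (hp : 1 < p) (hσ : 1 < σ) :
    MemLp (fun x => c x * ‖sqrtMul (Q x) (v x)‖ ^ (p - 1) + d x * shiftAbs k (u x) ^ (p - 1))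
      (ENNReal.ofReal (p * σ).conjExponent) (volume.restrict S) := by
  have hp0 : 0 < p := by linarith
  have hpσ : 1 < p * σ := by nlinarith
  have hpc := Real.HolderConjugate.conjExponent hp
  have hσc := Real.HolderConjugate.conjExponent hσ
  have hpσc := Real.HolderConjugate.conjExponent hpσ
  have hp'0 : 0 < p.conjExponent := hpc.symm.pos
  have hσ'0 : 0 < σ.conjExponent := hσc.symm.pos
  have e : p.conjExponent * (p - 1) = p := by
    rw [Real.conjExponent]; exact div_mul_cancel₀ _ (by linarith)
  have e1 := hpc.inv_add_inv_eq_one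
  have e2 := hσc.inv_add_inv_eq_one
  have e3 := hpσc.inv_add_inv_eq_one
  rw [mul_inv] at e3
  have h1 := MemLp.rpow_of_nonneg hp'0.le (by linarith) e (H.memLp_sqrtMul hp)
    (Eventually.of_forall fun x => norm_nonneg _)
  have h2 := MemLp.rpow_of_nonneg (s := p.conjExponent * σ) (q := p - 1) (by positivity)
    (by linarith) (by rw [mul_right_comm, e]) H.memLp_shiftAbs
    (Eventually.of_forall fun x => (shiftAbs_pos H.k_pos _).le)
  refine (MemLp.mul_of_inv_add_inv H.c_mem h1
    (ofReal_inv_add_inv (by positivity) (by positivity) hpσc.symm.pos ?_)).add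
    (MemLp.mul_of_inv_add_inv H.d_mem h2
    (ofReal_inv_add_inv (by positivity) (by positivity) hpσc.symm.pos ?_))
  · rw [mul_inv]
    linear_combination p⁻¹ * e2 + e1 - e3
  · rw [mul_inv]
    linear_combination e2 + σ⁻¹ * e1 - e3

end LocalProblem

/-! ### Energy inequality and gain of integrability on a ball -/

namespace LocalProblem

variable {n : ℕ} {Ω S : Set (Eucl n)} {Q : Eucl n → Matrix (Fin n) (Fin n) ℝ}
  {p σ a ε r k : ℝ} {CSob M : ℝ≥0} {t t' : ℝ≥0∞} {A : Eucl n → ℝ → Eucl n → Eucl n}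
  {B : Eucl n → ℝ → Eucl n → ℝ} {u : Eucl n → ℝ} {v : Eucl n → Eucl n}
  {b c d h : Eucl n → ℝ}

lemma aestronglyMeasurable_u (H : LocalProblem Ω S Q p σ a ε r k CSob M t t' A B u v b c d h) :
    AEStronglyMeasurable u (volume.restrict S) := H.u_mem.1

lemma aestronglyMeasurable_cutoff_norm
    (H : LocalProblem Ω S Q p σ a ε r k CSob M t t' A B u v b c d h) (η : Eucl n → ℝ) :
    AEStronglyMeasurable (fun x => ‖sqrtMul (Q x) (gradient η x)‖) (volume.restrict S) :=
  (H.admissible.aemeasurable_norm H.isOpen H.subset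
    (aestronglyMeasurable_gradient η)).aestronglyMeasurable

/-- Finite because the truncated weight is bounded. -/
lemma memLp_energy (H : LocalProblem Ω S Q p σ a ε r k CSob M t t' A B u v b c d h)
    (hp : 1 < p) {l β : ℝ} (hl : 0 < l) (hβ : 1 ≤ β) {η : Eucl n → ℝ} (hη : IsLipZero S η)
    (hη01 : ∀ x, 0 ≤ η x ∧ η x ≤ 1) :
    MemLp (fun x => r * (η x * powWeight k l β (u x) * ‖sqrtMul (Q x) (v x)‖))
      (ENNReal.ofReal p) (volume.restrict S) := by
  have hr := H.r_pos
  have hk := H.k_pos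
  obtain ⟨⟨Lη, hLη⟩, -, -⟩ := id hη
  have hPm : AEStronglyMeasurable (fun x => powWeight k l β (u x)) (volume.restrict S) :=
    (continuous_powWeight hk hl).comp_aestronglyMeasurable H.aestronglyMeasurable_u
  have hV := H.memLp_sqrtMul hp
  refine (hV.const_mul (r * (β * l⁻¹ ^ (β - 1)))).of_le
    (((hLη.continuous.aestronglyMeasurable.mul hPm).mul hV.1).const_mul r)
    (Eventually.of_forall fun x => ?_)
  have hP := (powWeight_pos hk hl hβ (u x)).le
  have hη0 := (hη01 x).1
  rw [Real.norm_of_nonneg (by positivity)]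
  refine le_trans ?_ (le_abs_self _)
  rw [mul_assoc r]
  have h1 : η x * powWeight k l β (u x) ≤ β * l⁻¹ ^ (β - 1) := by
    have h2 := powWeight_le hk hl hβ (u x)
    have h3 := hη01 x
    nlinarith
  gcongr

lemma memLp_powTrunc (H : LocalProblem Ω S Q p σ a ε r k CSob M t t' A B u v b c d h)
    {l β : ℝ} (hl : 0 < l) (hβ : 1 ≤ β) {η : Eucl n → ℝ} (hη : IsLipZero S η)
    (hη01 : ∀ x, 0 ≤ η x ∧ η x ≤ 1) :
    MemLp (fun x => η x * powTrunc k l β (u x)) (ENNReal.ofReal (p * σ))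
      (volume.restrict S) := by
  have hk := H.k_pos
  obtain ⟨⟨Lη, hLη⟩, -, -⟩ := id hη
  have hHc : Continuous (powTrunc k l β) :=
    continuous_iff_continuousAt.2 fun z => (hasDerivAt_powTrunc hk hl z).continuousAt
  refine (H.memLp_shiftAbs.const_mul (l⁻¹ ^ (β - 1))).of_le
    (hLη.continuous.aestronglyMeasurable.mul
      (hHc.comp_aestronglyMeasurable H.aestronglyMeasurable_u))
    (Eventually.of_forall fun x => ?_)
  have hP := (powTrunc_pos (β := β) hk hl (u x)).le
  have hη0 := (hη01 x).1
  rw [Real.norm_of_nonneg (by positivity)]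
  refine le_trans ?_ (le_abs_self _)
  have h1 := powTrunc_le_mul hk hl hβ (u x)
  have := (hη01 x).2
  nlinarith

/-- The energy inequality in integrated form, before absorption. -/
lemma eLpNorm_one_energy_le (H : LocalProblem Ω S Q p σ a ε r k CSob M t t' A B u v b c d h)
    (hp : 1 < p) (hσ : 1 < σ) (ha : 1 < a) {l β δ : ℝ} (hl : 0 < l) (hβ : 1 ≤ β) (hδ : 0 < δ)
    {η : Eucl n → ℝ} (hη : IsLipZero S η) (hη01 : ∀ x, 0 ≤ η x ∧ η x ≤ 1)
    (hηt : eLpNorm (fun x => ‖sqrtMul (Q x) (gradient η x)‖) (t * ENNReal.ofReal p)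
      (volume.restrict S) < ∞) :
    eLpNorm (fun x => (r * (η x * powWeight k l β (u x) * ‖sqrtMul (Q x) (v x)‖)) ^ p) 1
      (volume.restrict S) ≤
    eLpNorm (fun x => (2 * a * (energyConst p a * β ^ p)) *
      (((r ^ p * h x + r ^ p * d x + (r * c x) ^ p) +
        δ * (r ^ (p - 1) * b x) ^ p.conjExponent) * (η x * powTrunc k l β (u x)) ^ p +
        (1 + δ ^ (1 - p)) *
        (r * (powTrunc k l β (u x) * ‖sqrtMul (Q x) (gradient η x)‖)) ^ p)) 1
      (volume.restrict S) := by
  have hp0 : 0 < p := by linarith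
  have ha0 : 0 < a := by linarith
  have hβ0 : 0 < β := by linarith
  have hr := H.r_pos
  have hk := H.k_pos
  have hpσ : 1 < p * σ := by nlinarith
  have hpc := Real.HolderConjugate.conjExponent hp
  have hp'0 : 0 < p.conjExponent := hpc.symm.pos
  have hEC : 0 ≤ energyConst p a := by unfold energyConst; positivity
  obtain ⟨⟨Lη, hLη⟩, -, -⟩ := id hη
  have hum := H.aestronglyMeasurable_u
  have hηm : AEStronglyMeasurable η (volume.restrict S) := hLη.continuous.aestronglyMeasurable
  have hDm := H.aestronglyMeasurable_cutoff_norm η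
  have hVm := (H.memLp_sqrtMul hp).1
  have hPm : AEStronglyMeasurable (fun x => powWeight k l β (u x)) (volume.restrict S) :=
    (continuous_powWeight hk hl).comp_aestronglyMeasurable hum
  have hHc : Continuous (powTrunc k l β) :=
    continuous_iff_continuousAt.2 fun z => (hasDerivAt_powTrunc hk hl z).continuousAt
  have hHm : AEStronglyMeasurable (fun x => powTrunc k l β (u x)) (volume.restrict S) :=
    hHc.comp_aestronglyMeasurable hum
  have hbm := H.b_mem.1
  have hcm := H.c_mem.1
  have hdm := H.d_mem.1
  have hhm := H.h_meas
  have hPpos := fun x => (powWeight_pos hk hl hβ (u x)).le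
  have hHpos := fun x => (powTrunc_pos (β := β) hk hl (u x)).le
  set E : Eucl n → ℝ := fun x => r * (η x * powWeight k l β (u x) * ‖sqrtMul (Q x) (v x)‖)
    with hE
  have hE0 : ∀ x, 0 ≤ E x := fun x => by
    have := hPpos x; have := (hη01 x).1; simp only [hE]; positivity
  have hEmem : MemLp E (ENNReal.ofReal p) (volume.restrict S) :=
    H.memLp_energy hp hl hβ hη hη01
  have hXi : Integrable (fun x => E x ^ p) (volume.restrict S) := by
    have := hEmem.integrable_norm_rpow (by simpa using hp0) ENNReal.ofReal_ne_top
    rw [ENNReal.toReal_ofReal hp0.le] at this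
    refine this.congr (Eventually.of_forall fun x => ?_)
    beta_reduce
    rw [Real.norm_of_nonneg (hE0 x)]
  refine eLpNorm_one_le_of_integral_nonpos hXi
    (Eventually.of_forall fun x => Real.rpow_nonneg (hE0 x) _) ?_ ?_ ?_
  · refine AEStronglyMeasurable.const_mul (AEStronglyMeasurable.add ?_ ?_) _
    · refine AEStronglyMeasurable.mul (((hhm.const_mul _).add (hdm.const_mul _)).add
        ((hcm.const_mul r).aemeasurable.pow_const p).aestronglyMeasurable |>.add
        (((hbm.const_mul _).aemeasurable.pow_const _).aestronglyMeasurable.const_mul δ)) ?_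
      exact ((hηm.mul hHm).aemeasurable.pow_const p).aestronglyMeasurable
    · exact (((hHm.mul hDm).const_mul r).aemeasurable.pow_const p).aestronglyMeasurable.const_mul _
  · filter_upwards [H.nonneg] with x hx
    obtain ⟨h1, h2, h3, h4⟩ := hx
    have := hHpos x; have := (hη01 x).1
    simp only [Pi.zero_apply]
    positivity
  intro hint
  -- the test function
  have hζ := hη.rpow (p := p) hp.le
  have hgradζ : ∀ x, DifferentiableAt ℝ η x → gradient (fun x => η x ^ p) x =
      (p * η x ^ (p - 1)) • gradient η x := fun x hx => gradient_rpow hp.le hx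
  have hdiff : ∀ᵐ x ∂(volume.restrict S), DifferentiableAt ℝ η x :=
    ae_mono Measure.restrict_le_self hLη.ae_differentiableAt
  have hηp : ∀ x, 0 ≤ η x ^ (p - 1) ∧ η x ^ (p - 1) ≤ 1 := fun x =>
    ⟨Real.rpow_nonneg (hη01 x).1 _, Real.rpow_le_one (hη01 x).1 (hη01 x).2 (by linarith)⟩
  have hζt : eLpNorm (fun x => ‖sqrtMul (Q x) (gradient (fun x => η x ^ p) x)‖)
      (t * ENNReal.ofReal p) (volume.restrict S) < ∞ := by
    refine lt_of_le_of_lt (eLpNorm_mono_ae ?_) (MemLp.const_mul ⟨hDm, hηt⟩ p).2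
    filter_upwards [hdiff] with x hx
    rw [hgradζ x hx, sqrtMul_smul, norm_norm, norm_smul,
      norm_mul p ‖sqrtMul (Q x) (gradient η x)‖, norm_norm,
      Real.norm_of_nonneg (mul_nonneg hp0.le (hηp x).1), Real.norm_of_nonneg hp0.le]
    refine mul_le_mul_of_nonneg_right ?_ (norm_nonneg _)
    exact mul_le_of_le_one_right hp0.le (hηp x).2
  obtain ⟨Λ, hΛ⟩ : ∃ Λ : ℝ≥0, (Λ : ℝ) = (β * l⁻¹ ^ (β - 1)) ^ p :=
    ⟨⟨(β * l⁻¹ ^ (β - 1)) ^ p, by positivity⟩, rfl⟩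
  -- The test function is `η^p · powTest(u)`; its derivative factor `powWeight^p` is bounded owing
  -- to the truncation.
  have hφ := memWZero_mul_comp hp H.isOpen H.admissible H.subset H.volume_lt_top H.conj
    H.local_integrability hζ hζt H.weak_solution.1
    (fun z => hasDerivAt_powTest (p := p) hk hl hβ z) (continuous_powWeight_rpow hk hl hβ)
    (Λ := Λ) (fun z => by rw [hΛ]; exact powWeight_rpow_le hk hl hβ hp0.le z)
  have hcoef : 0 < 2 * a * r ^ p := by positivity
  have hmain := integral_nonpos_of_isWeakSolution hp H.isOpen H.admissible H.subset
    H.weak_solution (ofReal_inv_add_inv hp0 hp'0 one_pos (by rw [hpc.inv_add_inv_eq_one]; simp)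
      |>.trans (by simp))
    (ofReal_inv_add_inv (by linarith) (Real.HolderConjugate.conjExponent hpσ).symm.pos one_pos
      (by rw [(Real.HolderConjugate.conjExponent hpσ).inv_add_inv_eq_one]; simp)
      |>.trans (by simp))
    (H.exists_sobolev_const hp hσ) (H.memLp_flux_bound hp hσ) (H.memLp_source_bound hp hσ)
    (H.structural.mono fun x hx => hx.1) (H.structural.mono fun x hx => hx.2.2) hφ
    (hint.const_mul (2 * a * r ^ p)⁻¹) ?_
  · rw [integral_const_mul] at hmain
    exact nonpos_of_mul_nonpos_right hmain (by positivity)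
  · filter_upwards [H.nonneg, H.structural, hdiff] with x hx hstr hxd
    obtain ⟨hb0, hc0, hd0, hh0⟩ := hx
    obtain ⟨s1, s2, s3⟩ := hstr
    have key := energy_pointwise_aux (δ := δ) (D := ‖sqrtMul (Q x) (gradient η x)‖)
      (V := ‖sqrtMul (Q x) (v x)‖) (i₁ := inner ℝ (gradient η x) (A x (u x) (v x)))
      hp ha hβ hδ (hη01 x).1 (hPpos x) (hHpos x) (shiftAbs_pos hk (u x)) (norm_nonneg _)
      (norm_nonneg _) hh0 hb0 hc0 hd0 (shiftAbs_mul_powWeight (u x))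
      (abs_powTest_le hk hl hβ hp0.le (u x)) (s1 _) s2 s3 rfl
    rw [inv_mul_le_iff₀ hcoef, hgradζ x hxd, inner_add_left, inner_smul_left, inner_smul_left,
      inner_smul_left]
    simp only [conj_trivial]
    -- The powers of `r` in the normalized coefficients are such that the whole inequality carries a
    -- single factor `r^p`.
    have e1 : (r ^ (p - 1) * b x) ^ p.conjExponent = r ^ p * b x ^ (p / (p - 1)) := by
      rw [Real.mul_rpow (by positivity) hb0, ← Real.rpow_mul hr.le, Real.conjExponent,
        mul_div_cancel₀ _ (by linarith : p - 1 ≠ 0)]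
    have e2 : (r * c x) ^ p = r ^ p * c x ^ p := Real.mul_rpow hr.le hc0
    have hH := hHpos x
    have hP := hPpos x
    have hη0 := (hη01 x).1
    have e3 : (r * (powTrunc k l β (u x) * ‖sqrtMul (Q x) (gradient η x)‖)) ^ p =
        r ^ p * (powTrunc k l β (u x) * ‖sqrtMul (Q x) (gradient η x)‖) ^ p :=
      Real.mul_rpow hr.le (by positivity)
    have e4 : E x ^ p = r ^ p * (η x * powWeight k l β (u x) * ‖sqrtMul (Q x) (v x)‖) ^ p :=
      Real.mul_rpow hr.le (by positivity)
    rw [e1, e2, e3, e4]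
    have key2 := mul_le_mul_of_nonneg_left key (by positivity : 0 ≤ 2 * a * r ^ p)
    have e5 : 2 * a * r ^ p * ((2 * a)⁻¹ * (η x * powWeight k l β (u x) *
        ‖sqrtMul (Q x) (v x)‖) ^ p) =
        r ^ p * (η x * powWeight k l β (u x) * ‖sqrtMul (Q x) (v x)‖) ^ p := by
      field_simp
    rw [e5] at key2
    linarith

end LocalProblem

lemma avgNorm_lt_top {n : ℕ} {S : Set (Eucl n)} (h0 : volume S ≠ 0) {f : Eucl n → ℝ} {s : ℝ}
    (hs : 0 < s) (hf : MemLp f (ENNReal.ofReal s) (volume.restrict S)) :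
    avgNorm f (ENNReal.ofReal s) S < ∞ := by
  rw [avgNorm_ofReal f hs]
  exact ENNReal.mul_lt_top (ENNReal.rpow_lt_top_of_nonneg (by positivity)
    (ENNReal.inv_ne_top.2 h0)) hf.2

/-- The basic estimate of the iteration: a gain of integrability from `p` to `p * σ` for a
truncated power of the solution, with polynomial dependence on the power. -/
theorem exists_step_const (n : ℕ) {p σ a ε : ℝ} (hp : 1 < p) (hσ : 1 < σ) (ha : 1 < a)
    (hε : 0 < ε) (CSob M : ℝ≥0) : ∃ K : ℝ≥0, ∀ (Ω S : Set (Eucl n))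
      (Q : Eucl n → Matrix (Fin n) (Fin n) ℝ) (r k : ℝ) (t t' : ℝ≥0∞)
      (A : Eucl n → ℝ → Eucl n → Eucl n) (B : Eucl n → ℝ → Eucl n → ℝ) (u : Eucl n → ℝ)
      (v : Eucl n → Eucl n) (b c d h : Eucl n → ℝ),
      LocalProblem Ω S Q p σ a ε r k CSob M t t' A B u v b c d h →
      ∀ (l β : ℝ) (η : Eucl n → ℝ), 0 < l → 1 ≤ β → IsLipZero S η →
        (∀ x, 0 ≤ η x ∧ η x ≤ 1) →
        eLpNorm (fun x => ‖sqrtMul (Q x) (gradient η x)‖) (t * ENNReal.ofReal p)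
          (volume.restrict S) < ∞ →
        avgNorm (fun x => η x * powTrunc k l β (u x)) (ENNReal.ofReal (p * σ)) S ≤
          K * ENNReal.ofReal (β ^ ((p + p / ε + p ^ 2) / p)) *
            (avgNorm (fun x => η x * powTrunc k l β (u x)) (ENNReal.ofReal p) S +
              avgNorm (fun x => r * (powTrunc k l β (u x) * ‖sqrtMul (Q x) (gradient η x)‖))
                (ENNReal.ofReal p) S) := by
  have hp0 : 0 < p := by linarith
  have ha0 : 0 < a := by linarith
  have hEC : 0 ≤ energyConst p a := by unfold energyConst; positivity
  have hp'0 : 0 < p.conjExponent := (Real.HolderConjugate.conjExponent hp).symm.pos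
  -- A common bound for `‖b‖^{p'}` and `‖Γ‖^{1+ε}`, both normalized norms being at most `M`.
  obtain ⟨K, hK⟩ := exists_absorb_const (C := CSob) (C₁ := 2 * a * energyConst p a)
    (M := (M : ℝ) ^ p.conjExponent + (M : ℝ) ^ (1 + ε)) hp hε CSob.2 (by positivity)
    (by positivity)
  refine ⟨K, fun Ω S Q r k t t' A B u v b c d h H l β η hl hβ hη hη01 hηt => ?_⟩
  have hk := H.k_pos
  have hr := H.r_pos
  have := H.isFiniteMeasure
  have hβ0 : 0 < β := by linarith
  obtain ⟨⟨Lη, hLη⟩, -, -⟩ := id hη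
  have hηm : AEStronglyMeasurable η (volume.restrict S) := hLη.continuous.aestronglyMeasurable
  have hHc : Continuous (powTrunc k l β) :=
    continuous_iff_continuousAt.2 fun z => (hasDerivAt_powTrunc hk hl z).continuousAt
  have hHm : AEStronglyMeasurable (fun x => powTrunc k l β (u x)) (volume.restrict S) :=
    hHc.comp_aestronglyMeasurable H.aestronglyMeasurable_u
  have hDm := H.aestronglyMeasurable_cutoff_norm η
  have hWmem := H.memLp_powTrunc hl hβ hη hη01
  have hEmem := H.memLp_energy hp hl hβ hη hη01
  have hPpos := fun x => (powWeight_pos hk hl hβ (u x)).le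
  have hHpos := fun x => (powTrunc_pos (β := β) hk hl (u x)).le
  have hac : (volume S)⁻¹ • volume.restrict S ≪ volume.restrict S :=
    Measure.smul_absolutelyContinuous
  have hWp : MemLp (fun x => η x * powTrunc k l β (u x)) (ENNReal.ofReal p)
      (volume.restrict S) :=
    hWmem.mono_exponent (ENNReal.ofReal_le_ofReal (by nlinarith))
  have hEm := hEmem.1.mono_ac hac
  have hWm := hWmem.1.mono_ac hac
  have hZm : AEStronglyMeasurable (fun x => r * (powTrunc k l β (u x) *
      ‖sqrtMul (Q x) (gradient η x)‖)) ((volume S)⁻¹ • volume.restrict S) :=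
    ((hHm.mul hDm).const_mul r).mono_ac hac
  refine hK β _ (avgNorm (fun x => r * (η x * powWeight k l β (u x) *
    ‖sqrtMul (Q x) (v x)‖)) (ENNReal.ofReal p) S) _ _ hβ
    (avgNorm_lt_top H.volume_ne_zero (by positivity) hWmem).ne
    (avgNorm_lt_top H.volume_ne_zero hp0 hEmem).ne
    (avgNorm_lt_top H.volume_ne_zero hp0 hWp).ne ?_ ?_
  -- The Sobolev estimate for `ηH(u)`: of its gradient, `H ∇η` gives the cutoff term, and `η H'(u)
  -- ∇u` is controlled by the energy since `|H'| ≤ P`.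
  · rw [ENNReal.ofReal_coe_nnreal]
    have hΛ : ∃ Λ : ℝ≥0, (Λ : ℝ) = β * l⁻¹ ^ (β - 1) := ⟨⟨β * l⁻¹ ^ (β - 1), by positivity⟩, rfl⟩
    obtain ⟨Λ, hΛ⟩ := hΛ
    have hmem := memWZero_mul_comp hp H.isOpen H.admissible H.subset H.volume_lt_top H.conj
      H.local_integrability hη hηt H.weak_solution.1
      (fun z => hasDerivAt_powTrunc (β := β) hk hl z) (continuous_powTruncDeriv hk hl)
      (Λ := Λ) (fun z => by
        rw [hΛ]; exact (abs_powTruncDeriv_le hk hl hβ z).trans (powWeight_le hk hl hβ z))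
    refine (H.sobolev _ _ hmem).trans (mul_le_mul_right (add_le_add_left ?_ _) _)
    unfold avgNorm
    rw [← Real.enorm_of_nonneg hr.le, ← eLpNorm_const_smul]
    refine le_trans (eLpNorm_mono_real fun x => ?_) (eLpNorm_add_le hEm hZm
      (ENNReal.one_le_ofReal_of_one_le hp.le))
    have h1 := hη01 x
    have h2 := abs_powTruncDeriv_le hk hl hβ (u x)
    rw [Pi.smul_apply, norm_smul, Real.norm_of_nonneg hr.le, Pi.add_apply, ← mul_add, sqrtMul_add,
      sqrtMul_smul, sqrtMul_smul]
    refine mul_le_mul_of_nonneg_left ((norm_add_le _ _).trans ?_) hr.le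
    rw [norm_smul, norm_smul, norm_mul, Real.norm_of_nonneg (hHpos x), Real.norm_of_nonneg h1.1,
      add_comm, Real.norm_eq_abs]
    have h3 := h1.1
    gcongr
  · intro δ L hδ hL
    have hcm := (H.c_mem.1.const_mul r).aemeasurable.pow_const p
    have hΓm : AEStronglyMeasurable (fun x => r ^ p * h x + r ^ p * d x + (r * c x) ^ p)
        ((volume S)⁻¹ • volume.restrict S) :=
      (((H.h_meas.const_mul _).add (H.d_mem.1.const_mul _)).add
        hcm.aestronglyMeasurable).mono_ac hac
    have hbm := (H.b_mem.1.const_mul (r ^ (p - 1))).mono_ac hac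
    have hnn := hac.ae_le H.nonneg
    have hen := eLpNorm_energy_le (μ := (volume S)⁻¹ • volume.restrict S)
      (C := 2 * a * (energyConst p a * β ^ p)) (Γ := fun x => r ^ p * h x + r ^ p * d x +
        (r * c x) ^ p) (b := fun x => r ^ (p - 1) * b x)
      (E := fun x => r * (η x * powWeight k l β (u x) * ‖sqrtMul (Q x) (v x)‖))
      hp hσ hε hδ hL (by positivity) hWm hZm
      hΓm hbm ?_ ?_ ?_ ?_ ?_ ?_
    · refine hen.trans ?_
      rw [show 2 * a * energyConst p a * β ^ p = 2 * a * (energyConst p a * β ^ p) by ring]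
      unfold avgNorm
      have hb' : eLpNorm (fun x => r ^ (p - 1) * b x)
          (ENNReal.ofReal (p.conjExponent * σ.conjExponent)) ((volume S)⁻¹ • volume.restrict S)
            ^ p.conjExponent ≤ ENNReal.ofReal ((M : ℝ) ^ p.conjExponent + (M : ℝ) ^ (1 + ε)) := by
        refine (ENNReal.rpow_le_rpow H.b_le hp'0.le).trans ?_
        rw [← ENNReal.ofReal_coe_nnreal, ENNReal.ofReal_rpow_of_nonneg M.coe_nonneg hp'0.le]
        refine ENNReal.ofReal_le_ofReal (le_add_of_nonneg_right ?_)
        positivity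
      have hΓ' : eLpNorm (fun x => r ^ p * h x + r ^ p * d x + (r * c x) ^ p)
          (ENNReal.ofReal (σ.conjExponent * (1 + ε))) ((volume S)⁻¹ • volume.restrict S)
            ^ (1 + ε) ≤ ENNReal.ofReal ((M : ℝ) ^ p.conjExponent + (M : ℝ) ^ (1 + ε)) := by
        refine (ENNReal.rpow_le_rpow H.sum_le (by positivity)).trans ?_
        rw [← ENNReal.ofReal_coe_nnreal, ENNReal.ofReal_rpow_of_nonneg M.coe_nonneg (by positivity)]
        refine ENNReal.ofReal_le_ofReal (le_add_of_nonneg_left ?_)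
        positivity
      gcongr
    · refine Eventually.of_forall fun x => ?_
      have := hPpos x; have := (hη01 x).1
      simp only [Pi.zero_apply]
      positivity
    · refine Eventually.of_forall fun x => ?_
      have := hHpos x; have := (hη01 x).1
      simp only [Pi.zero_apply]
      positivity
    · refine Eventually.of_forall fun x => ?_
      have := hHpos x
      simp only [Pi.zero_apply]
      positivity
    · filter_upwards [hnn] with x hx
      obtain ⟨h1, h2, h3, h4⟩ := hx
      simp only [Pi.zero_apply]
      positivity
    · filter_upwards [hnn] with x hx
      obtain ⟨h1, h2, h3, h4⟩ := hx
      simp only [Pi.zero_apply]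
      positivity
    · rw [eLpNorm_one_smul_measure, eLpNorm_one_smul_measure]
      exact mul_le_mul_right (H.eLpNorm_one_energy_le hp hσ ha hl hβ hδ hη hη01 hηt) _

/-! ### The iteration -/

/-- By Chebyshev, for `b > C` the set `{|f| ≥ b}` has measure at most `(C/b)^{q_j}`, which tends to
zero. -/
lemma ae_enorm_le_of_forall_eLpNorm_le {α : Type*} [MeasurableSpace α] {ν : Measure α}
    {f : α → ℝ} (hf : AEStronglyMeasurable f ν) {q : ℕ → ℝ}
    (hq : Tendsto q atTop atTop) {C : ℝ≥0∞} (h : ∀ j, eLpNorm f (ENNReal.ofReal (q j)) ν ≤ C) :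
    ∀ᵐ x ∂ν, ‖f x‖ₑ ≤ C := by
  refine (ae_le_const_iff_forall_gt_measure_zero (fun x => ‖f x‖ₑ) C).2 fun b hb => ?_
  have hb0 : b ≠ 0 := (zero_le.trans_lt hb).ne'
  rcases eq_or_ne b ∞ with rfl | hbt
  · have : {x | ∞ ≤ ‖f x‖ₑ} = ∅ := by ext x; simp
    rw [this, measure_empty]
  have hlt : b⁻¹ * C < 1 := by
    rw [mul_comm, ← div_eq_mul_inv, ENNReal.div_lt_iff (Or.inl hb0) (Or.inl hbt), one_mul]
    exact hb
  have hlim : Tendsto (fun j => (b⁻¹ * C) ^ q j) atTop (𝓝 0) := by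
    lift b⁻¹ * C to ℝ≥0 using hlt.ne_top with x
    have hx : (x : ℝ) < 1 := by exact_mod_cast hlt
    have h1 := (tendsto_rpow_atTop_of_base_lt_one (x : ℝ)
      (by linarith [x.coe_nonneg]) hx).comp hq
    have h2 : Tendsto (fun j => ENNReal.ofReal ((x : ℝ) ^ q j)) atTop (𝓝 (ENNReal.ofReal 0)) :=
      (ENNReal.continuous_ofReal.tendsto 0).comp h1
    rw [ENNReal.ofReal_zero] at h2
    refine h2.congr' ?_
    filter_upwards [hq.eventually_gt_atTop 0] with j hj
    rw [← ENNReal.ofReal_rpow_of_nonneg x.coe_nonneg hj.le, ENNReal.ofReal_coe_nnreal]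
  refine le_antisymm (ge_of_tendsto hlim ?_) zero_le
  filter_upwards [hq.eventually_gt_atTop 0] with j hj
  have h1 := meas_ge_le_mul_pow_eLpNorm_enorm ν (p := ENNReal.ofReal (q j)) (by simpa using hj)
    ENNReal.ofReal_ne_top hf hb0 (fun h => absurd h hbt)
  rw [ENNReal.toReal_ofReal hj.le] at h1
  refine h1.trans ?_
  rw [← ENNReal.mul_rpow_of_nonneg _ _ hj.le]
  exact ENNReal.rpow_le_rpow (mul_le_mul_right (h j) _) hj.le

/-- The product of the factors `(K b^j)^{χ^{-j}}` converges, since `∑ χ^{-j}` and `∑ j χ^{-j}` do.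
-/
lemma exists_iteration_const {χ K b : ℝ} (hχ : 1 < χ) (hK : 1 ≤ K) (hb : 1 ≤ b) :
    ∃ C : ℝ≥0, ∀ a : ℕ → ℝ≥0∞,
      (∀ j, a (j + 1) ≤ ENNReal.ofReal ((K * b ^ (j : ℝ)) ^ (χ⁻¹ ^ j)) * a j) →
      ∀ j, a j ≤ C * a 0 := by
  have hK0 : 0 < K := by linarith
  have hb0 : 0 < b := by linarith
  have hχ0 : 0 ≤ χ⁻¹ := by positivity
  have hχ1 : χ⁻¹ < 1 := inv_lt_one_of_one_lt₀ hχ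
  have s0 : Summable fun j : ℕ => χ⁻¹ ^ j := summable_geometric_of_lt_one hχ0 hχ1
  have s1 : Summable fun j : ℕ => (j : ℝ) * χ⁻¹ ^ j := by
    have := summable_pow_mul_geometric_of_norm_lt_one 1 (r := χ⁻¹)
      (by rwa [Real.norm_of_nonneg hχ0])
    simpa using this
  refine ⟨(K ^ (∑' j : ℕ, χ⁻¹ ^ j) * b ^ (∑' j : ℕ, (j : ℝ) * χ⁻¹ ^ j)).toNNReal,
    fun a ha j => ?_⟩
  have key : ∀ j, a j ≤ ENNReal.ofReal (K ^ (∑ i ∈ Finset.range j, χ⁻¹ ^ i) *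
      b ^ (∑ i ∈ Finset.range j, (i : ℝ) * χ⁻¹ ^ i)) * a 0 := by
    intro j
    induction j with
    | zero => simp
    | succ j ih =>
      refine (ha j).trans ((mul_le_mul_right ih _).trans_eq ?_)
      rw [← mul_assoc, ← ENNReal.ofReal_mul (by positivity), Finset.sum_range_succ,
        Finset.sum_range_succ, Real.rpow_add hK0, Real.rpow_add hb0,
        Real.mul_rpow hK0.le (by positivity), ← Real.rpow_mul hb0.le]
      congr 2
      ring
  refine (key j).trans (mul_le_mul_left (ENNReal.ofReal_le_ofReal ?_) _)
  have e0 : ∑ i ∈ Finset.range j, χ⁻¹ ^ i ≤ ∑' j : ℕ, χ⁻¹ ^ j :=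
    s0.sum_le_tsum _ fun i _ => by positivity
  have e1 : ∑ i ∈ Finset.range j, (i : ℝ) * χ⁻¹ ^ i ≤ ∑' j : ℕ, (j : ℝ) * χ⁻¹ ^ j :=
    s1.sum_le_tsum _ fun i _ => by positivity
  gcongr

/-- The relation `1/s + p/s* = 1` divided by `p` says that `s*` and `ps` are Hölder exponents for
`L^p`. -/
lemma sStar_inv_add {p s : ℝ} {sStar : ℝ≥0∞} (hp : 0 < p) (hs0 : 0 < s) (hS : sStar ≠ 0)
    (hs : s⁻¹ + p * (sStar⁻¹).toReal = 1) :
    sStar⁻¹ + (ENNReal.ofReal (p * s))⁻¹ = (ENNReal.ofReal p)⁻¹ := by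
  have h1 : sStar⁻¹ = ENNReal.ofReal (sStar⁻¹).toReal :=
    (ENNReal.ofReal_toReal (ENNReal.inv_ne_top.2 hS)).symm
  rw [h1, ← ENNReal.ofReal_inv_of_pos hp, ← ENNReal.ofReal_inv_of_pos (by positivity),
    ← ENNReal.ofReal_add ENNReal.toReal_nonneg (by positivity)]
  congr 1
  rw [mul_inv]
  have : p⁻¹ * p = 1 := inv_mul_cancel₀ hp.ne'
  linear_combination p⁻¹ * hs - (sStar⁻¹).toReal * this

/-! ### One step of the iteration, without cutoff and truncation -/

namespace LocalProblem

variable {n : ℕ} {Ω S : Set (Eucl n)} {Q : Eucl n → Matrix (Fin n) (Fin n) ℝ}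
  {p σ a ε r k : ℝ} {CSob M : ℝ≥0} {t t' : ℝ≥0∞} {A : Eucl n → ℝ → Eucl n → Eucl n}
  {B : Eucl n → ℝ → Eucl n → ℝ} {u : Eucl n → ℝ} {v : Eucl n → Eucl n}
  {b c d h : Eucl n → ℝ}

lemma aemeasurable_powTrunc (H : LocalProblem Ω S Q p σ a ε r k CSob M t t' A B u v b c d h)
    {l β : ℝ} (hl : 0 < l) :
    AEStronglyMeasurable (fun x => powTrunc k l β (u x)) ((volume S)⁻¹ • volume.restrict S) :=
  ((continuous_iff_continuousAt.2 fun z =>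
    (hasDerivAt_powTrunc H.k_pos hl z).continuousAt).comp_aestronglyMeasurable
      H.aestronglyMeasurable_u).mono_ac Measure.smul_absolutelyContinuous

lemma measure_le_one (H : LocalProblem Ω S Q p σ a ε r k CSob M t t' A B u v b c d h)
    (T : Set (Eucl n)) :
    (((volume S)⁻¹ • volume.restrict S).restrict T) univ ≤ 1 := by
  refine (Measure.restrict_apply_le _ _).trans ?_
  rw [Measure.smul_apply, Measure.restrict_apply_univ, smul_eq_mul,
    ENNReal.inv_mul_cancel H.volume_ne_zero H.volume_lt_top.ne]

/-- Passing from a set `T` containing the support of a cutoff function to a set `T'` on which it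
equals one. -/
lemma powTrunc_step (H : LocalProblem Ω S Q p σ a ε r k CSob M t t' A B u v b c d h)
    (hp : 1 < p) {K : ℝ≥0∞} {l β s : ℝ} {sStar : ℝ≥0∞} {η : Eucl n → ℝ} {D : ℝ≥0∞}
    (hs1 : 1 ≤ s) (hsS : sStar⁻¹ + (ENNReal.ofReal (p * s))⁻¹ = (ENNReal.ofReal p)⁻¹)
    (hl : 0 < l) (hη01 : ∀ x, 0 ≤ η x ∧ η x ≤ 1)
    (hstep : avgNorm (fun x => η x * powTrunc k l β (u x)) (ENNReal.ofReal (p * σ)) S ≤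
          K * (avgNorm (fun x => η x * powTrunc k l β (u x)) (ENNReal.ofReal p) S +
              avgNorm (fun x => r * (powTrunc k l β (u x) * ‖sqrtMul (Q x) (gradient η x)‖))
                (ENNReal.ofReal p) S))
    (hD : ENNReal.ofReal r * avgNorm (fun x => sqrtMul (Q x) (gradient η x)) sStar S ≤ D)
    {T T' : Set (Eucl n)} (hT : MeasurableSet T) (hT' : MeasurableSet T') (hηT : tsupport η ⊆ T)
    (hηT' : ∀ x ∈ T', η x = 1) :
    eLpNorm (fun x => powTrunc k l β (u x)) (ENNReal.ofReal (p * σ))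
        (((volume S)⁻¹ • volume.restrict S).restrict T') ≤
      K * (1 + D) * eLpNorm (fun x => powTrunc k l β (u x)) (ENNReal.ofReal (p * s))
        (((volume S)⁻¹ • volume.restrict S).restrict T) := by
  set μ : Measure (Eucl n) := (volume S)⁻¹ • volume.restrict S with hμ
  have hac : μ ≪ volume.restrict S := Measure.smul_absolutelyContinuous
  have hHm := H.aemeasurable_powTrunc (β := β) hl
  have hDm := (H.aestronglyMeasurable_cutoff_norm η).mono_ac hac
  have hps : p ≤ p * s := by nlinarith
  have hpow : ∀ x, 0 ≤ powTrunc k l β (u x) := fun x => (powTrunc_pos H.k_pos hl _).le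
  -- The total mass is at most one, so norms increase with the exponent; here `p ≤ ps`.
  have hmono : eLpNorm (fun x => powTrunc k l β (u x)) (ENNReal.ofReal p) (μ.restrict T) ≤
      eLpNorm (fun x => powTrunc k l β (u x)) (ENNReal.ofReal (p * s)) (μ.restrict T) := by
    refine (eLpNorm_le_eLpNorm_mul_rpow_measure_univ (ENNReal.ofReal_le_ofReal hps)
      hHm.restrict).trans (mul_le_of_le_one_right' ?_)
    refine ENNReal.rpow_le_one (H.measure_le_one T) ?_
    rw [ENNReal.toReal_ofReal (by linarith), ENNReal.toReal_ofReal (by linarith), sub_nonneg]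
    exact one_div_le_one_div_of_le (by linarith) hps
  have h1 : eLpNorm (fun x => powTrunc k l β (u x)) (ENNReal.ofReal (p * σ)) (μ.restrict T') ≤
      avgNorm (fun x => η x * powTrunc k l β (u x)) (ENNReal.ofReal (p * σ)) S := by
    refine le_trans (eLpNorm_congr_ae ?_).le (eLpNorm_mono_measure _ Measure.restrict_le_self)
    filter_upwards [ae_restrict_mem hT'] with x hx
    rw [hηT' x hx, one_mul]
  have h2 : avgNorm (fun x => η x * powTrunc k l β (u x)) (ENNReal.ofReal p) S ≤
      eLpNorm (fun x => powTrunc k l β (u x)) (ENNReal.ofReal p) (μ.restrict T) := by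
    rw [← eLpNorm_indicator_eq_eLpNorm_restrict hT]
    refine eLpNorm_mono fun x => ?_
    by_cases hx : x ∈ T
    · rw [indicator_of_mem hx, norm_mul, Real.norm_of_nonneg (hη01 x).1]
      exact mul_le_of_le_one_left (norm_nonneg _) (hη01 x).2
    · rw [image_eq_zero_of_notMem_tsupport fun h => hx (hηT h)]
      simp
  have h3 : avgNorm (fun x => r * (powTrunc k l β (u x) * ‖sqrtMul (Q x) (gradient η x)‖))
      (ENNReal.ofReal p) S ≤
      D * eLpNorm (fun x => powTrunc k l β (u x)) (ENNReal.ofReal (p * s)) (μ.restrict T) := by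
    -- The gradient of `η` vanishes off its support, so `H` may be cut down to `T` before applying
    -- Hölder.
    have e : (fun x => r * (powTrunc k l β (u x) * ‖sqrtMul (Q x) (gradient η x)‖)) =
        fun x => (r * ‖sqrtMul (Q x) (gradient η x)‖) *
          T.indicator (fun x => powTrunc k l β (u x)) x := by
      ext x
      by_cases hx : x ∈ T
      · rw [indicator_of_mem hx]; ring
      · rw [gradient_eq_zero_of_notMem_tsupport fun h => hx (hηT h), sqrtMul_zero]
        simp
    rw [e]
    unfold avgNorm
    refine (eLpNorm_mul_le_of_inv_add_inv (hDm.const_mul r) (hHm.indicator hT) hsS).trans ?_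
    rw [eLpNorm_indicator_eq_eLpNorm_restrict hT, eLpNorm_const_mul_of_nonneg _ H.r_pos.le,
      eLpNorm_norm]
    exact mul_le_mul_left hD _
  refine h1.trans (hstep.trans ?_)
  rw [mul_assoc]
  refine mul_le_mul_right ?_ _
  rw [add_mul, one_mul]
  exact add_le_add (h2.trans hmono) h3

/-- The step for powers of `shiftAbs k u`, obtained by removing the truncation. -/
lemma shiftAbs_step (H : LocalProblem Ω S Q p σ a ε r k CSob M t t' A B u v b c d h)
    (hp : 1 < p) (hσ : 1 < σ) {K : ℝ≥0∞} {β s : ℝ} {ν ν' : Measure (Eucl n)} (hβ : 1 ≤ β)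
    (hs1 : 1 ≤ s) (hν' : ν' ≪ volume.restrict S)
    (hstep : ∀ l : ℝ, 0 < l → eLpNorm (fun x => powTrunc k l β (u x)) (ENNReal.ofReal (p * σ)) ν'
      ≤ K * eLpNorm (fun x => powTrunc k l β (u x)) (ENNReal.ofReal (p * s)) ν) :
    eLpNorm (fun x => shiftAbs k (u x)) (ENNReal.ofReal (p * σ * β)) ν' ≤
      K ^ β⁻¹ * eLpNorm (fun x => shiftAbs k (u x)) (ENNReal.ofReal (p * s * β)) ν := by
  have hβ0 : 0 < β := by linarith
  have hk := H.k_pos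
  have hm : ∀ l, 0 < l → AEStronglyMeasurable (fun x => powTrunc k l β (u x))
      (volume.restrict S) := fun l hl => (continuous_iff_continuousAt.2 fun z =>
    (hasDerivAt_powTrunc hk hl z).continuousAt).comp_aestronglyMeasurable H.aestronglyMeasurable_u
  have h1 : eLpNorm (fun x => shiftAbs k (u x) ^ β) (ENNReal.ofReal (p * σ)) ν' ≤
      K * eLpNorm (fun x => shiftAbs k (u x) ^ β) (ENNReal.ofReal (p * s)) ν := by
    -- Fatou along `l = 1/(j+1)`; the right side is bounded uniformly in `l`.
    refine Lp.eLpNorm_le_of_ae_tendsto (u := atTop)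
      (f := fun (j : ℕ) x => powTrunc k ((j : ℝ) + 1)⁻¹ β (u x)) (Eventually.of_forall fun j => ?_)
      (fun j => (hm _ (by positivity)).mono_ac hν')
      (Eventually.of_forall fun x => tendsto_powTrunc hk hβ (u x))
    refine (hstep _ (by positivity)).trans (mul_le_mul_right (eLpNorm_mono fun x => ?_) _)
    rw [Real.norm_of_nonneg (powTrunc_pos hk (by positivity) _).le,
      Real.norm_of_nonneg (Real.rpow_nonneg (shiftAbs_pos hk _).le _)]
    exact powTrunc_le_rpow hk (by positivity) hβ _
  have hnn : ∀ {μ : Measure (Eucl n)}, 0 ≤ᵐ[μ] fun x => shiftAbs k (u x) :=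
    Eventually.of_forall fun x => (shiftAbs_pos hk _).le
  rw [eLpNorm_rpow_of_nonneg hnn hβ0, eLpNorm_rpow_of_nonneg hnn hβ0,
    ← ENNReal.ofReal_mul (by nlinarith), ← ENNReal.ofReal_mul (by nlinarith)] at h1
  have h2 := ENNReal.rpow_le_rpow h1 (inv_nonneg.2 hβ0.le)
  rwa [ENNReal.mul_rpow_of_nonneg _ _ (inv_nonneg.2 hβ0.le), ENNReal.rpow_rpow_inv hβ0.ne',
    ENNReal.rpow_rpow_inv hβ0.ne'] at h2

end LocalProblem

lemma IsCutoffSequence.isLipZero {n : ℕ} {Ω : Set (Eucl n)}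
    {Q : Eucl n → Matrix (Fin n) (Fin n) ℝ} {ρ : Eucl n → Eucl n → ℝ} {τ : ℝ} {sStar : ℝ≥0∞}
    {N C : ℝ≥0} {y : Eucl n} {r : ℝ} {η : ℕ → Eucl n → ℝ}
    (hη : IsCutoffSequence Ω Q ρ τ sStar N C y r η) (hc : IsCompact (closure (rhoBall Ω ρ y r)))
    {j : ℕ} (hj : 1 ≤ j) : IsLipZero (rhoBall Ω ρ y r) (η j) := by
  have hsub : tsupport (η j) ⊆ rhoBall Ω ρ y r := by
    rcases j with _ | _ | j
    · omega
    · exact hη.support_one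
    · exact (hη.support_succ (j + 1) (by omega)).trans fun x hx => hx.1
  exact ⟨hη.lipschitz j hj,
    hc.of_isClosed_subset (isClosed_tsupport _) (hsub.trans subset_closure), hsub⟩

/-- Moser iteration: local boundedness for solutions of the local problem on a ball. -/
theorem exists_moser_const (n : ℕ) {p σ a ε s : ℝ} {sStar : ℝ≥0∞} (hp : 1 < p) (hσ : 1 < σ)
    (ha : 1 < a) (hε : 0 < ε) (hs1 : 1 ≤ s) (hsσ : s < σ)
    (hsS : sStar⁻¹ + (ENNReal.ofReal (p * s))⁻¹ = (ENNReal.ofReal p)⁻¹) (CSob M N CCut : ℝ≥0) :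
    ∃ C : ℝ≥0, ∀ (Ω : Set (Eucl n)) (Q : Eucl n → Matrix (Fin n) (Fin n) ℝ)
      (ρ : Eucl n → Eucl n → ℝ) (τ : ℝ) (y : Eucl n) (r k : ℝ) (t t' : ℝ≥0∞)
      (A : Eucl n → ℝ → Eucl n → Eucl n) (B : Eucl n → ℝ → Eucl n → ℝ) (u : Eucl n → ℝ)
      (v : Eucl n → Eucl n) (b c d h : Eucl n → ℝ) (η : ℕ → Eucl n → ℝ),
      LocalProblem Ω (rhoBall Ω ρ y r) Q p σ a ε r k CSob M t t' A B u v b c d h →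
      IsCompact (closure (rhoBall Ω ρ y r)) →
      IsCutoffSequence Ω Q ρ τ sStar N CCut y r η →
      (∀ j, 1 ≤ j → eLpNorm (fun x => sqrtMul (Q x) (gradient (η j) x)) (t * ENNReal.ofReal p)
        (volume.restrict (rhoBall Ω ρ y r)) < ∞) →
      ∀ᵐ x ∂(volume.restrict (rhoBall Ω ρ y (τ * r))), ‖shiftAbs k (u x)‖ₑ ≤
        C * avgNorm (fun x => shiftAbs k (u x)) (ENNReal.ofReal (p * s)) (rhoBall Ω ρ y r) := by
  obtain ⟨K, hK⟩ := exists_step_const n hp hσ ha hε CSob M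
  have hp0 : 0 < p := by linarith
  have hs0 : 0 < s := by linarith
  set m := (p + p / ε + p ^ 2) / p with hm
  have hm0 : 0 ≤ m := by positivity
  set χ := σ / s with hχ
  have hχ1 : 1 < χ := (one_lt_div hs0).2 hsσ
  have hχ0 : 0 < χ := by linarith
  have hχm : 1 ≤ χ ^ m := Real.one_le_rpow hχ1.le hm0
  set N' : ℝ := max 1 N with hN'
  have hN1 : 1 ≤ N' := le_max_left _ _
  have hK0 : (0 : ℝ) ≤ K := K.2
  have hC0 : (0 : ℝ) ≤ CCut := CCut.2
  have hN0 : (0 : ℝ) ≤ N := N.2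
  -- The base `χ^m N'` collects the growth of `β^m` with `β = χ^j` and that of the cutoff gradients.
  -- The extra factor `N'` in the first constant is there because step `j` uses `η (j+1)`; `K + 1`
  -- and `N' = max 1 N` keep everything at least one.
  obtain ⟨C, hC⟩ := exists_iteration_const (K := (K + 1) * (1 + CCut) * N') (b := χ ^ m * N') hχ1
    (one_le_mul_of_one_le_of_one_le (one_le_mul_of_one_le_of_one_le (by linarith) (by linarith))
      hN1) (one_le_mul_of_one_le_of_one_le hχm hN1)
  refine ⟨C, fun Ω Q ρ τ y r k t t' A B u v b c d h η H hcpt hη hηt => ?_⟩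
  set S := rhoBall Ω ρ y r with hS
  set μ : Measure (Eucl n) := (volume S)⁻¹ • volume.restrict S with hμ
  have hac : μ ≪ volume.restrict S := Measure.smul_absolutelyContinuous
  -- Step `j` passes from `T j`, which contains the support of `η (j+1)`, to `T (j+1)`, where `η
  -- (j+1) = 1`. The first set is the whole space, since `η 0` carries no information.
  set T : ℕ → Set (Eucl n) := fun j => if j = 0 then univ else {x | η j x = 1} with hT
  have hTm : ∀ j, MeasurableSet (T j) := by
    intro j
    rcases j with _ | j
    · simp [hT]
    · obtain ⟨L, hL⟩ := hη.lipschitz (j + 1) (by omega)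
      simpa [hT] using (isClosed_eq hL.continuous continuous_const).measurableSet
  have hsupp : ∀ j, tsupport (η (j + 1)) ⊆ T j := by
    intro j
    rcases j with _ | j
    · simp [hT]
    · intro x hx
      simpa [hT] using (hη.support_succ (j + 1) (by omega) hx).2
  have hiter : ∀ j : ℕ,
      eLpNorm (fun x => shiftAbs k (u x)) (ENNReal.ofReal (p * s * χ ^ j)) (μ.restrict (T j)) ≤
        C * eLpNorm (fun x => shiftAbs k (u x)) (ENNReal.ofReal (p * s)) μ := by
    intro j
    have := hC (fun j => eLpNorm (fun x => shiftAbs k (u x)) (ENNReal.ofReal (p * s * χ ^ j))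
      (μ.restrict (T j))) (fun j => ?_) j
    · simpa [hT] using this
    · have hβ : 1 ≤ χ ^ j := one_le_pow₀ hχ1.le
      have hD : ENNReal.ofReal r * avgNorm (fun x => sqrtMul (Q x) (gradient (η (j + 1)) x)) sStar
          S ≤ (CCut : ℝ≥0∞) * (N : ℝ≥0∞) ^ (j + 1) :=
        (mul_le_mul_right (hη.gradient_bound (j + 1) (by omega)) _).trans
          ENNReal.mul_div_le
      have h1 := H.shiftAbs_step hp hσ (ν := μ.restrict (T j)) (ν' := μ.restrict (T (j + 1))) hβ
        hs1 (Measure.absolutelyContinuous_of_le Measure.restrict_le_self |>.trans hac)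
        fun l hl => H.powTrunc_step hp hs1 hsS hl (hη.bounds (j + 1) (by omega))
          (hK Ω S Q r k t t' A B u v b c d h H l (χ ^ j) (η (j + 1)) hl hβ
            (hη.isLipZero hcpt (by omega)) (hη.bounds (j + 1) (by omega))
            (by rw [eLpNorm_norm]; exact hηt _ (by omega))) hD (hTm j) (hTm (j + 1)) (hsupp j)
          (fun x hx => by simpa [hT] using hx)
      -- As `χ = σ/s`, the exponent gained at step `j` is the exponent required at step `j+1`.
      have e1 : p * σ * χ ^ j = p * s * χ ^ (j + 1) := by rw [pow_succ, hχ]; field_simp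
      rw [e1] at h1
      refine h1.trans (mul_le_mul_left ?_ _)
      rw [← inv_pow, ← ENNReal.ofReal_rpow_of_nonneg (p := χ⁻¹ ^ j) (by positivity) (by positivity)]
      refine ENNReal.rpow_le_rpow ?_ (by positivity)
      have e2 : (K : ℝ≥0∞) * ENNReal.ofReal ((χ ^ j) ^ m) * (1 + CCut * N ^ (j + 1)) =
          ENNReal.ofReal (K * (χ ^ j) ^ m * (1 + CCut * N ^ (j + 1))) := by
        rw [ENNReal.ofReal_mul (by positivity), ENNReal.ofReal_mul hK0,
          ENNReal.ofReal_add one_pos.le (by positivity), ENNReal.ofReal_mul hC0,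
          ENNReal.ofReal_pow hN0]
        simp
      rw [e2]
      refine ENNReal.ofReal_le_ofReal ?_
      have e3 : (χ ^ m * N') ^ (j : ℝ) = (χ ^ j) ^ m * N' ^ j := by
        rw [Real.rpow_natCast, mul_pow, ← Real.rpow_natCast, ← Real.rpow_natCast χ,
          ← Real.rpow_mul hχ0.le, ← Real.rpow_mul hχ0.le, mul_comm m]
      have e4 : 1 + CCut * N ^ (j + 1) ≤ (1 + CCut) * N' ^ (j + 1) := by
        have : (N : ℝ) ^ (j + 1) ≤ N' ^ (j + 1) := by
          gcongr; exact le_max_right _ _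
        have h2 : 1 ≤ N' ^ (j + 1) := one_le_pow₀ hN1
        nlinarith
      rw [e3]
      calc K * (χ ^ j) ^ m * (1 + CCut * N ^ (j + 1))
          ≤ (K + 1) * (χ ^ j) ^ m * ((1 + CCut) * N' ^ (j + 1)) := by
            gcongr; linarith
        _ = _ := by rw [pow_succ]; ring
  have hae : ∀ᵐ x ∂(μ.restrict (⋂ j, T j)), ‖shiftAbs k (u x)‖ₑ ≤
      C * eLpNorm (fun x => shiftAbs k (u x)) (ENNReal.ofReal (p * s)) μ :=
    ae_enorm_le_of_forall_eLpNorm_le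
      ((continuous_shiftAbs.comp_aestronglyMeasurable
        H.aestronglyMeasurable_u).mono_ac hac).restrict
      (q := fun j => p * s * χ ^ j)
      ((tendsto_pow_atTop_atTop_of_one_lt hχ1).const_mul_atTop (by positivity))
      fun j => (eLpNorm_mono_measure _
        (Measure.restrict_mono (iInter_subset _ j) le_rfl)).trans (hiter j)
  rw [hμ, Measure.restrict_smul, Measure.restrict_restrict (MeasurableSet.iInter hTm)] at hae
  have hae' := (Measure.ae_ennreal_smul_measure_iff
    (ENNReal.inv_ne_zero.2 H.volume_lt_top.ne)).1 hae
  have hsub : rhoBall Ω ρ y (τ * r) ⊆ (⋂ j, T j) ∩ S := fun x hx =>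
    ⟨mem_iInter.2 fun j => ?_, (hη.eq_one 1 le_rfl hx).1⟩
  · exact ae_mono (Measure.restrict_mono hsub le_rfl) hae'
  rcases j with _ | j
  · simp [hT]
  · simpa [hT] using (hη.eq_one (j + 1) (by omega) hx).2

/-! ### Volume bound and higher integrability of the solution -/

/-- The condition is stated for radii below one. The case `r = 1` follows by letting smaller radii
increase to `r`, the balls being nested. -/
lemma ConditionD.le_volume {n : ℕ} {Ω : Set (Eucl n)} {ρ : Eucl n → Eucl n → ℝ}
    {r₁ : Eucl n → ℝ} {q c₀ : ℝ} (h : ConditionD Ω ρ r₁ q c₀) {y : Eucl n}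
    (hy : y ∈ Ω) {r : ℝ} (hr : 0 < r) (hr1 : r ≤ 1) (hry : r < r₁ y) :
    ENNReal.ofReal (c₀ * r ^ q) ≤ volume (rhoBall Ω ρ y r) := by
  have hlim : Tendsto (fun x : ℝ => ENNReal.ofReal (c₀ * x ^ q)) (𝓝[<] r)
      (𝓝 (ENNReal.ofReal (c₀ * r ^ q))) :=
    ((ENNReal.continuous_ofReal.tendsto _).comp
      (((Real.continuousAt_rpow_const r q (Or.inl hr.ne')).tendsto.const_mul c₀))).mono_left
      nhdsWithin_le_nhds
  refine le_of_tendsto hlim ?_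
  filter_upwards [self_mem_nhdsWithin, Ioo_mem_nhdsLT hr] with x hx hx0
  exact (h y hy x hx0.1 (lt_min (hx0.2.trans_le hr1) (hx0.2.trans hry))).trans
    (measure_mono fun z hz => ⟨hz.1, lt_trans hz.2 hx0.2⟩)

/-- Elements of the Sobolev space have the integrability given by the Sobolev estimate. -/
lemma MemW.memLp_mul_sigma {n : ℕ} {Ω : Set (Eucl n)} {Q : Eucl n → Matrix (Fin n) (Fin n) ℝ}
    {ρ : Eucl n → Eucl n → ℝ} {r₁ : Eucl n → ℝ} {p σ τ : ℝ} {sStar t t' : ℝ≥0∞}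
    {CSob N CCut : ℝ≥0} (hp : 1 < p) (hσ : 1 < σ) (hτ : 0 < τ) (hΩ : IsOpen Ω)
    (hQ : IsAdmissibleMatrix Ω p Q) (hr₁ : IsAdmissibleRadius Ω ρ r₁)
    (hSob : SobolevEstimate Ω Q ρ r₁ p σ CSob) (htt : t⁻¹ + t'⁻¹ = 1)
    (hcut : CutoffCondition Ω Q ρ r₁ p τ sStar N CCut t)
    (hloc : LocalIntegrabilityCondition Ω Q ρ r₁ p t') {u : Eucl n → ℝ} {v : Eucl n → Eucl n}
    (hu : MemW Q p Ω u v) {y : Eucl n} (hy : y ∈ Ω) {r : ℝ} (hr : 0 < r) (hry : r < τ * r₁ y)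
    (hvol : volume (rhoBall Ω ρ y (r / τ)) ≠ 0) :
    MemLp u (ENNReal.ofReal (p * σ)) (volume.restrict (rhoBall Ω ρ y r)) := by
  have hp0 : 0 < p := by linarith
  have hpσ : 0 < p * σ := by positivity
  -- On the ball of radius `r/τ` the first cutoff function equals one on `B(y, r)`, so the Sobolev
  -- estimate for `η₁ u` gives the integrability of `u` there.
  have hR : 0 < r / τ := by positivity
  have hR1 : r / τ < r₁ y := by rwa [div_lt_iff₀' hτ]
  set S := rhoBall Ω ρ y (r / τ) with hS
  have hSΩ : S ⊆ Ω := fun x hx => hx.1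
  obtain ⟨hcpt, -⟩ := (hr₁ y hy).2 _ hR hR1
  have hfin : volume S < ∞ := (measure_mono subset_closure).trans_lt hcpt.measure_lt_top
  obtain ⟨η, hη, hηt⟩ := hcut y hy _ hR hR1
  have hmem := memWZero_mul_comp hp hΩ hQ hSΩ hfin htt (hloc y hy _ hR hR1)
    (hη.isLipZero hcpt le_rfl) (by rw [eLpNorm_norm]; exact hηt 1 le_rfl) hu
    (G := fun z => z) (G' := fun _ => 1) (fun z => hasDerivAt_id z) continuous_const (Λ := 1)
    (fun z => by simp)
  obtain ⟨f1, f2⟩ := hmem.eLpNorm_lt_top hp.le hQ hΩ hSΩ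
  rw [eLpNorm_norm] at f2
  have hw : eLpNorm (fun x => η 1 x * u x) (ENNReal.ofReal (p * σ)) (volume.restrict S) < ∞ := by
    have h1 := hSob y hy _ hR hR1 _ _ hmem
    rw [eLpNorm_eq_avgNorm hvol hfin.ne _ hpσ]
    refine ENNReal.mul_lt_top (ENNReal.rpow_lt_top_of_nonneg (by positivity) hfin.ne)
      (h1.trans_lt ?_)
    have hv : (volume S)⁻¹ ^ (1 / p) < ∞ :=
      ENNReal.rpow_lt_top_of_nonneg (by positivity) (ENNReal.inv_ne_top.2 hvol)
    rw [avgNorm_ofReal _ hp0, avgNorm_ofReal _ hp0]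
    finiteness
  have hball : rhoBall Ω ρ y r ⊆ {x | x ∈ S ∧ η 1 x = 1} := by
    have := hη.eq_one 1 le_rfl
    rwa [mul_div_cancel₀ _ hτ.ne'] at this
  refine ⟨hu.1.mono_measure (Measure.restrict_mono (fun x hx => hx.1) le_rfl), ?_⟩
  have hm : MeasurableSet {x | η 1 x = 1} := by
    obtain ⟨L, hL⟩ := hη.lipschitz 1 le_rfl
    exact (isClosed_eq hL.continuous continuous_const).measurableSet
  calc eLpNorm u (ENNReal.ofReal (p * σ)) (volume.restrict (rhoBall Ω ρ y r))
      = eLpNorm (fun x => η 1 x * u x) (ENNReal.ofReal (p * σ))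
        (volume.restrict (rhoBall Ω ρ y r)) := by
        refine eLpNorm_congr_ae ?_
        have h3 : ∀ᵐ x ∂(volume.restrict (rhoBall Ω ρ y r)), η 1 x = 1 :=
          ae_mono (Measure.restrict_mono (fun x hx => (hball hx).2) le_rfl) (ae_restrict_mem hm)
        filter_upwards [h3] with x hx
        rw [hx, one_mul]
    _ ≤ _ := eLpNorm_mono_measure _ (Measure.restrict_mono (fun x hx => (hball hx).1) le_rfl)
    _ < ∞ := hw

/-! ### Scaling of the coefficients -/

/-- The lower bound for `|S|` trades the normalization for the factor `r^(-q/α)`. -/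
lemma avgNorm_scaled_le {n : ℕ} {S : Set (Eucl n)} {c₀ q r α m : ℝ} (hc₀ : 0 < c₀) (hr : 0 < r)
    (hα : 0 < α) (hvol : ENNReal.ofReal (c₀ * r ^ q) ≤ volume S) (F : Eucl n → ℝ) :
    avgNorm (fun x => r ^ m * F x) (ENNReal.ofReal α) S ≤ ENNReal.ofReal (c₀⁻¹ ^ (1 / α)) *
      (ENNReal.ofReal (r ^ (m - q / α)) * eLpNorm F (ENNReal.ofReal α) (volume.restrict S)) := by
  have h1 : (volume S)⁻¹ ^ (1 / α) ≤ ENNReal.ofReal (c₀⁻¹ ^ (1 / α) * r ^ (-(q / α))) := by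
    have : (volume S)⁻¹ ≤ ENNReal.ofReal ((c₀ * r ^ q)⁻¹) := by
      rw [ENNReal.ofReal_inv_of_pos (by positivity)]
      exact ENNReal.inv_le_inv.2 hvol
    refine (ENNReal.rpow_le_rpow this (by positivity)).trans_eq ?_
    rw [ENNReal.ofReal_rpow_of_nonneg (by positivity) (by positivity), mul_inv,
      Real.mul_rpow (by positivity) (by positivity), ← Real.rpow_neg hr.le, ← Real.rpow_mul hr.le]
    congr 3
    ring
  rw [avgNorm_ofReal _ hα, eLpNorm_const_mul_of_nonneg _ (by positivity)]
  refine (mul_le_mul_left h1 _).trans_eq ?_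
  rw [← mul_assoc, ← mul_assoc, ← ENNReal.ofReal_mul (by positivity),
    ← ENNReal.ofReal_mul (by positivity), mul_assoc, ← Real.rpow_add hr]
  congr 4
  ring

/-- Applied with `X` a nonnegative power of `r ≤ 1` and `κ` a power of `k`. The `1` in the bound is
the contribution of the inhomogeneous terms, controlled by `K(y, r) ≤ k`. -/
lemma eLpNorm_add_const_mul_le {n : ℕ} {S : Set (Eucl n)} {b F : Eucl n → ℝ} {s X M : ℝ≥0∞}
    {κ : ℝ} (hs : 1 ≤ s) (hb : AEStronglyMeasurable b (volume.restrict S))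
    (hF : AEStronglyMeasurable F (volume.restrict S)) (hκ : 0 < κ) (hX : X ≤ 1)
    (hbM : eLpNorm b s (volume.restrict S) ≤ M)
    (hFκ : X * eLpNorm F s (volume.restrict S) ≤ ENNReal.ofReal κ) :
    X * eLpNorm (fun x => b x + F x / κ) s (volume.restrict S) ≤ M + 1 := by
  have e : (fun x => F x / κ) = fun x => κ⁻¹ * F x := by ext x; ring
  have h1 : eLpNorm (fun x => b x + F x / κ) s (volume.restrict S) ≤
      eLpNorm b s (volume.restrict S) +
        ENNReal.ofReal κ⁻¹ * eLpNorm F s (volume.restrict S) := by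
    rw [← eLpNorm_const_mul_of_nonneg _ (by positivity), ← e]
    exact eLpNorm_add_le hb (by rw [e]; exact hF.const_mul _) hs
  refine (mul_le_mul_right h1 _).trans ?_
  rw [mul_add]
  refine add_le_add ((mul_le_of_le_one_left' hX).trans hbM) ?_
  rw [mul_left_comm]
  refine (mul_le_mul_right hFκ _).trans_eq ?_
  rw [← ENNReal.ofReal_mul (by positivity), inv_mul_cancel₀ hκ.ne', ENNReal.ofReal_one]

lemma rpow_le_rpow_add_one {x α β : ℝ} (hx : 0 ≤ x) (hα : 0 ≤ α) (hαβ : α ≤ β) :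
    x ^ α ≤ x ^ β + 1 := by
  rcases le_total x 1 with h | h
  · linarith [Real.rpow_le_one hx h hα, Real.rpow_nonneg hx β]
  · linarith [Real.rpow_le_rpow_of_exponent_le h hαβ]

/-- Since `X ≥ k`, a constant is at most itself times `(X/k)^β`. A lower power of `x` is at most
`x^β + 1`, which is how the homogeneous coefficients come to appear in `K(y, r)` too. -/
lemma mul_rpow_add_le {m w x k X α β : ℝ} (hm : 0 ≤ m) (hw : 0 ≤ w) (hx : 0 ≤ x) (hk : 0 < k)
    (hxX : x ≤ X) (hkX : k ≤ X) (hα : 0 ≤ α) (hαβ : α ≤ β) :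
    m * x ^ α + w ≤ (m + (w + m) / k ^ β) * X ^ β := by
  have h1 := rpow_le_rpow_add_one hx hα hαβ
  have h2 : x ^ β ≤ X ^ β := Real.rpow_le_rpow hx hxX (hα.trans hαβ)
  have h3 : 1 ≤ X ^ β / k ^ β := by
    rw [one_le_div (by positivity)]
    exact Real.rpow_le_rpow hk.le hkX (hα.trans hαβ)
  calc m * x ^ α + w ≤ m * (X ^ β + 1) + w := by
        gcongr; linarith
    _ = m * X ^ β + (w + m) * 1 := by ring
    _ ≤ m * X ^ β + (w + m) * (X ^ β / k ^ β) := by gcongr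
    _ = _ := by ring

lemma ofReal_rpow_mul_le_of_rpow_inv {r k x m : ℝ} {X : ℝ≥0∞} (hr : 0 < r) (hk : 0 ≤ k)
    (hm : 0 < m) (h : ENNReal.ofReal (r ^ x) * X ^ (1 / m) ≤ ENNReal.ofReal k) :
    ENNReal.ofReal (r ^ (x * m)) * X ≤ ENNReal.ofReal (k ^ m) := by
  have h1 := ENNReal.rpow_le_rpow h hm.le
  rwa [ENNReal.mul_rpow_of_nonneg _ _ hm.le, one_div, ENNReal.rpow_inv_rpow hm.ne',
    ENNReal.ofReal_rpow_of_nonneg (by positivity) hm.le, ENNReal.ofReal_rpow_of_nonneg hk hm.le,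
    ← Real.rpow_mul hr.le] at h1

/-- The three bounds on the coefficients contained in a bound for the remainder. -/
lemma remainderK_le {n : ℕ} {p σ ε q r k : ℝ} {S : Set (Eucl n)} {e g f : Eucl n → ℝ} (hp : 1 < p)
    (hσ : 1 < σ) (hε : 0 < ε) (hr : 0 < r) (hk : 0 ≤ k)
    (h : remainderK p σ ε q S r e g f ≤ ENNReal.ofReal k) :
    ENNReal.ofReal (r ^ (p - 1 - q / (p.conjExponent * σ.conjExponent))) *
        eLpNorm e (ENNReal.ofReal (p.conjExponent * σ.conjExponent)) (volume.restrict S) ≤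
      ENNReal.ofReal (k ^ (p - 1)) ∧
    ENNReal.ofReal (r ^ (p - q / (σ.conjExponent * (1 + ε)))) *
        eLpNorm g (ENNReal.ofReal (σ.conjExponent * (1 + ε))) (volume.restrict S) ≤
      ENNReal.ofReal (k ^ p) ∧
    ENNReal.ofReal (r ^ (p - q / (σ.conjExponent * (1 + ε)))) *
        eLpNorm f (ENNReal.ofReal (σ.conjExponent * (1 + ε))) (volume.restrict S) ≤
      ENNReal.ofReal (k ^ (p - 1)) := by
  have hp0 : 0 < p := by linarith
  have hp1 : 0 < p - 1 := by linarith
  have hσ' : 0 < σ.conjExponent := (Real.HolderConjugate.conjExponent hσ).symm.pos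
  rw [remainderK, mul_add, mul_add] at h
  refine ⟨?_, ?_, ?_⟩
  · convert ofReal_rpow_mul_le_of_rpow_inv hr hk hp1 ((le_self_add.trans le_self_add).trans h)
      using 4
    rw [Real.conjExponent]
    field_simp
  -- Here and in the third bound the powers of `r` in `K(y, r)` combine to the same exponent `p -
  -- q/(σ'(1+ε))`, the natural scaling `r^p` corrected by the volume.
  · have h2 := (le_add_self.trans le_self_add).trans h
    rw [← mul_assoc, ← ENNReal.ofReal_mul (by positivity), ← Real.rpow_add hr] at h2
    convert ofReal_rpow_mul_le_of_rpow_inv hr hk hp0 h2 using 4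
    field_simp
    ring
  · have h2 := le_add_self.trans h
    rw [← mul_assoc, ← ENNReal.ofReal_mul (by positivity), ← Real.rpow_add hr] at h2
    convert ofReal_rpow_mul_le_of_rpow_inv hr hk hp1 h2 using 4
    field_simp
    ring

/-- Under the structural conditions, with the terms of lower order absorbed in the coefficients,
one obtains the local problem on a ball. -/
lemma exists_localProblem {p σ a γ ψ δ ε q c₀ : ℝ} (M : ℝ≥0) (hp : 1 < p) (hσ : 1 < σ)
    (hγ : 1 < γ) (hγp : γ < p) (hψ : 1 < ψ) (hψp : ψ < p) (hδ : 1 < δ) (hδp : δ < p)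
    (hε : 0 < ε) (hq : 0 < q) (hqσ : q ≤ p * σ.conjExponent) (hc₀ : 0 < c₀) :
    ∃ M₁ : ℝ≥0, ∀ {n : ℕ} {Ω S : Set (Eucl n)} {Q : Eucl n → Matrix (Fin n) (Fin n) ℝ}
      {CSob : ℝ≥0} {t t' : ℝ≥0∞} {b c d e f g h : Eucl n → ℝ}
      {A : Eucl n → ℝ → Eucl n → Eucl n} {B : Eucl n → ℝ → Eucl n → ℝ}
      {u : Eucl n → ℝ} {v : Eucl n → Eucl n} {r k : ℝ},
      IsOpen Ω → IsAdmissibleMatrix Ω p Q → S ⊆ Ω →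
      ENNReal.ofReal (c₀ * r ^ q) ≤ volume S → volume S < ∞ → 0 < r → r ≤ 1 → 0 < k →
      (∀ (w : Eucl n → ℝ) (z : Eucl n → Eucl n), MemWZero Q p S w z →
        avgNorm w (ENNReal.ofReal (p * σ)) S ≤ CSob * (ENNReal.ofReal r *
          avgNorm (fun x => sqrtMul (Q x) (z x)) (ENNReal.ofReal p) S
            + avgNorm w (ENNReal.ofReal p) S)) →
      t⁻¹ + t'⁻¹ = 1 →
      (∃ c₂ : ℝ≥0, ∀ w : Eucl n → ℝ, LocallyLipschitzOn Ω w →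
        eLpNorm w (ENNReal.ofReal p * t') (volume.restrict S) ≤
          c₂ * sobNorm Q p Ω w (gradient w)) →
      IsWeakSolution Ω Q p A B u v →
      MemLp u (ENNReal.ofReal (p * σ)) (volume.restrict S) →
      StructuralConditions Ω Q p a γ ψ δ b c d e f g h A B →
      MemLp b (ENNReal.ofReal (p.conjExponent * σ.conjExponent)) (volume.restrict S) →
      MemLp e (ENNReal.ofReal (p.conjExponent * σ.conjExponent)) (volume.restrict S) →
      MemLp c (ENNReal.ofReal (p * σ.conjExponent * (1 + ε))) (volume.restrict S) →
      MemLp d (ENNReal.ofReal (σ.conjExponent * (1 + ε))) (volume.restrict S) →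
      MemLp f (ENNReal.ofReal (σ.conjExponent * (1 + ε))) (volume.restrict S) →
      MemLp h (ENNReal.ofReal (σ.conjExponent * (1 + ε))) (volume.restrict S) →
      MemLp g (ENNReal.ofReal (σ.conjExponent * (1 + ε))) (volume.restrict S) →
      eLpNorm b (ENNReal.ofReal (p.conjExponent * σ.conjExponent)) (volume.restrict S) ≤ M →
      eLpNorm c (ENNReal.ofReal (p * σ.conjExponent * (1 + ε))) (volume.restrict S) ≤ M →
      eLpNorm d (ENNReal.ofReal (σ.conjExponent * (1 + ε))) (volume.restrict S) ≤ M →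
      eLpNorm h (ENNReal.ofReal (σ.conjExponent * (1 + ε))) (volume.restrict S) ≤ M →
      remainderK p σ ε q S r (fun x => e x + b x) (fun x => g x + h x)
        (fun x => f x + c x + d x) ≤ ENNReal.ofReal k →
      LocalProblem Ω S Q p σ a ε r k CSob M₁ t t' A B u v
        (fun x => b x + (e x + b x) / k ^ (p - 1)) c
        (fun x => d x + (f x + c x + d x) / k ^ (p - 1))
        (fun x => h x + (g x + h x) / k ^ p) := by
  have hp0 : 0 < p := by linarith
  have hp1 : 0 < p - 1 := by linarith
  have hpc := Real.HolderConjugate.conjExponent hp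
  have hp' : 1 < p.conjExponent := hpc.symm.lt
  have hσ' : 1 < σ.conjExponent := (Real.HolderConjugate.conjExponent hσ).symm.lt
  have hσ'0 : 0 < σ.conjExponent := by linarith
  set α₁ := p.conjExponent * σ.conjExponent with hα₁
  set α₂ := σ.conjExponent * (1 + ε) with hα₂
  have h1α₁ : 1 ≤ α₁ := by rw [hα₁]; nlinarith
  have h1α₂ : 1 ≤ α₂ := by rw [hα₂]; nlinarith
  -- This and the next inequality are where `q ≤ pσ'` is needed: the powers of `r` left over are at
  -- most one for `r ≤ 1`.
  have hE₁ : 0 ≤ p - 1 - q / α₁ := by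
    rw [sub_nonneg, div_le_iff₀ (by linarith), hα₁, ← mul_assoc, mul_comm (p - 1),
      Real.conjExponent, div_mul_cancel₀ _ hp1.ne']
    exact hqσ
  have hE₂ : 0 ≤ p - q / α₂ := by
    rw [sub_nonneg, div_le_iff₀ (by linarith), hα₂, ← mul_assoc]
    nlinarith [mul_pos hp0 hσ'0]
  have e₃ : α₂ * p = p * σ.conjExponent * (1 + ε) := by rw [hα₂]; ring
  -- First entry: the `b` coefficient. Second: those of `h` and `d` and the term `c^p`. Each `M + 1`
  -- is a given norm plus the part normalized by `k`.
  set M₁ : ℝ≥0∞ := max (ENNReal.ofReal (c₀⁻¹ ^ (1 / α₁)) * (M + 1))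
    (ENNReal.ofReal (c₀⁻¹ ^ (1 / α₂)) * ((M + 1) + (M + 1) + (M : ℝ≥0∞) ^ p)) with hM₁
  have hM₁t : M₁ ≠ ∞ := by
    have : (M : ℝ≥0∞) ^ p ≠ ∞ := ENNReal.rpow_ne_top_of_nonneg hp0.le ENNReal.coe_ne_top
    exact (max_lt (by finiteness) (by finiteness)).ne
  refine ⟨M₁.toNNReal, fun {n Ω S Q CSob t t' b c d e f g h A B u v r k} hΩ hQ hSΩ hvol hfin hr hr1
    hk hSob htt hloc hu hum hst hb he hc hd hf hh hg hbM hcM hdM hhM hK => ?_⟩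
  have : IsFiniteMeasure (volume.restrict S) := ⟨by simpa using hfin⟩
  have hmono : volume.restrict S ≤ volume.restrict Ω := Measure.restrict_mono hSΩ le_rfl
  obtain ⟨hnn, Atilde, hA⟩ := hst
  have hnn' : ∀ᵐ x ∂(volume.restrict S),
      0 ≤ b x ∧ 0 ≤ c x ∧ 0 ≤ d x ∧ 0 ≤ e x ∧ 0 ≤ f x ∧ 0 ≤ g x ∧ 0 ≤ h x :=
    ae_mono hmono ((ae_restrict_mem hΩ.measurableSet).mono fun x hx => hnn x hx)
  have hkp : 0 < k ^ (p - 1) := by positivity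
  have hkp' : 0 < k ^ p := by positivity
  have hc₂ : MemLp c (ENNReal.ofReal α₂) (volume.restrict S) :=
    hc.mono_exponent (ENNReal.ofReal_le_ofReal (by rw [← e₃]; nlinarith))
  have hF : MemLp (fun x => f x + c x + d x) (ENNReal.ofReal α₂) (volume.restrict S) :=
    (hf.add hc₂).add hd
  have hdd : MemLp (fun x => d x + (f x + c x + d x) / k ^ (p - 1)) (ENNReal.ofReal α₂)
      (volume.restrict S) := by
    simp only [div_eq_inv_mul]; exact hd.add (hF.const_mul (k ^ (p - 1))⁻¹)
  have hbb : MemLp (fun x => b x + (e x + b x) / k ^ (p - 1)) (ENNReal.ofReal α₁)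
      (volume.restrict S) := by
    simp only [div_eq_inv_mul]; exact hb.add ((he.add hb).const_mul (k ^ (p - 1))⁻¹)
  have hhh : MemLp (fun x => h x + (g x + h x) / k ^ p) (ENNReal.ofReal α₂)
      (volume.restrict S) := by
    simp only [div_eq_inv_mul]; exact hh.add ((hg.add hh).const_mul (k ^ p)⁻¹)
  have hcp : MemLp (fun x => c x ^ p) (ENNReal.ofReal α₂) (volume.restrict S) :=
    MemLp.rpow_of_nonneg (by linarith) hp0 e₃ hc (hnn'.mono fun x hx => hx.2.1)
  obtain ⟨k1, k2, k3⟩ := remainderK_le hp hσ hε hr hk.le hK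
  have hX : ∀ {x : ℝ}, 0 ≤ x → ENNReal.ofReal (r ^ x) ≤ 1 := fun hx =>
    ENNReal.ofReal_le_one.2 (Real.rpow_le_one hr.le hr1 hx)
  refine
    { isOpen := hΩ
      admissible := hQ
      subset := hSΩ
      volume_ne_zero := fun h0 => ?_
      volume_lt_top := hfin
      r_pos := hr
      k_pos := hk
      sobolev := hSob
      conj := htt
      local_integrability := hloc
      weak_solution := hu
      u_mem := hum
      nonneg := ?_
      b_mem := hbb
      c_mem := hc.mono_exponent (ENNReal.ofReal_le_ofReal (by nlinarith [mul_pos hp0 hσ'0]))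
      d_mem := hdd.mono_exponent (ENNReal.ofReal_le_ofReal (by rw [hα₂]; nlinarith))
      h_meas := hhh.1
      b_le := ?_
      sum_le := ?_
      structural := ?_ }
  · rw [h0] at hvol
    exact absurd hvol (by rw [not_le]; exact ENNReal.ofReal_pos.2 (by positivity))
  · filter_upwards [hnn'] with x ⟨hb, hc, hd, he, hf, hg, hh⟩
    exact ⟨by positivity, hc, by positivity, by positivity⟩
  · rw [ENNReal.coe_toNNReal hM₁t]
    refine (avgNorm_scaled_le hc₀ hr (by linarith) hvol _).trans
      (le_trans (mul_le_mul_right ?_ _) (le_max_left _ _))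
    exact eLpNorm_add_const_mul_le (ENNReal.one_le_ofReal_of_one_le h1α₁) hb.1 (he.add hb).1 hkp
      (hX hE₁) hbM k1
  · rw [ENNReal.coe_toNNReal hM₁t]
    have e1 : avgNorm (fun x => r ^ p * (h x + (g x + h x) / k ^ p) +
        r ^ p * (d x + (f x + c x + d x) / k ^ (p - 1)) + (r * c x) ^ p) (ENNReal.ofReal α₂) S =
        avgNorm (fun x => r ^ p * ((h x + (g x + h x) / k ^ p) +
        (d x + (f x + c x + d x) / k ^ (p - 1)) + c x ^ p)) (ENNReal.ofReal α₂) S := by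
      refine eLpNorm_congr_ae (Measure.smul_absolutelyContinuous.ae_le ?_)
      filter_upwards [hnn'] with x hx
      rw [Real.mul_rpow hr.le hx.2.1]
      ring
    rw [e1]
    refine (avgNorm_scaled_le hc₀ hr (by linarith) hvol _).trans
      (le_trans (mul_le_mul_right ?_ _) (le_max_right _ _))
    have h1 := ENNReal.one_le_ofReal_of_one_le h1α₂
    refine (mul_le_mul_right ((eLpNorm_add_le (hhh.add hdd).1 hcp.1 h1).trans
      (add_le_add_left (eLpNorm_add_le hhh.1 hdd.1 h1) _)) _).trans ?_
    rw [mul_add, mul_add]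
    refine add_le_add (add_le_add ?_ ?_) ?_
    · exact eLpNorm_add_const_mul_le h1 hh.1 (hg.add hh).1 hkp' (hX hE₂) hhM k2
    · exact eLpNorm_add_const_mul_le h1 hd.1 hF.1 hkp (hX hE₂) hdM k3
    · refine (mul_le_of_le_one_left' (hX hE₂)).trans ?_
      rw [eLpNorm_rpow_of_nonneg (hnn'.mono fun x hx => hx.2.1) hp0,
        ← ENNReal.ofReal_mul (by linarith), e₃]
      exact ENNReal.rpow_le_rpow hcM hp0.le
  · filter_upwards [hnn', ae_mono hmono hA] with x ⟨hb, hc, hd, he, hf, hg, hh⟩ hx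
    have hz := abs_le_shiftAbs k (u x)
    have hkz := le_shiftAbs k (u x)
    have hz0 := abs_nonneg (u x)
    obtain ⟨a1, a2, a3, a4⟩ := hx (u x) (v x)
    refine ⟨fun ξ => ?_, ?_, ?_⟩
    · rw [a1, inner_sqrtMul]
      refine (abs_real_inner_le_norm _ _).trans
        (mul_le_mul_of_nonneg_left (a3.trans ?_) (norm_nonneg _))
      have := mul_rpow_add_le (α := γ - 1) (β := p - 1) hb he hz0 hk hz hkz (by linarith)
        (by linarith)
      linarith
    · have := mul_rpow_add_le (α := γ) (β := p) hh hg hz0 hk hz hkz (by linarith) hγp.le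
      linarith
    · have h1 := mul_rpow_add_le (α := δ - 1) (β := p - 1) hd (add_nonneg hf hc) hz0 hk hz hkz
        (by linarith) (by linarith)
      -- The power `ψ - 1` is raised to `p - 1` at the cost of an extra term `c`, which is treated
      -- together with `f`.
      have h3 : ‖sqrtMul (Q x) (v x)‖ ^ (ψ - 1) ≤ ‖sqrtMul (Q x) (v x)‖ ^ (p - 1) + 1 := by
        have hV := norm_nonneg (sqrtMul (Q x) (v x))
        exact rpow_le_rpow_add_one hV (by linarith) (by linarith)
      have h4 := mul_le_mul_of_nonneg_left h3 hc
      linarith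

/-! ### Local boundedness of weak solutions -/

theorem corollary1p7 (n : ℕ)
    (p σ a γ ψ δ τ s ε q c₀ : ℝ) (sStar : ℝ≥0∞) (CSob N CCut M : ℝ≥0)
    (hp : 1 < p) (hσ : 1 < σ) (ha : 1 < a)
    (hγ : 1 < γ) (hγp : γ < p) (hψ : 1 < ψ) (hψp : ψ < p) (hδ : 1 < δ) (hδp : δ < p)
    (hτ : 0 < τ) (hτ1 : τ < 1)
    (hsStar : ENNReal.ofReal (p * σ.conjExponent) < sStar)
    (hs : s⁻¹ + p * (sStar⁻¹).toReal = 1)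
    (hε : 0 < ε) (hq : 0 < q) (hqσ : q ≤ p * σ.conjExponent) (hc₀ : 0 < c₀) :
    ∃ C : ℝ≥0,
      ∀ (Ω : Set (Eucl n)) (Q : Eucl n → Matrix (Fin n) (Fin n) ℝ)
        (ρ : Eucl n → Eucl n → ℝ) (r₁ : Eucl n → ℝ) (t t' : ℝ≥0∞),
        IsOpen Ω →
        IsAdmissibleMatrix Ω p Q →
        IsQuasimetricOn Ω ρ →
        IsAdmissibleRadius Ω ρ r₁ →
        SobolevEstimate Ω Q ρ r₁ p σ CSob →
        t⁻¹ + t'⁻¹ = 1 →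
        CutoffCondition Ω Q ρ r₁ p τ sStar N CCut t →
        LocalIntegrabilityCondition Ω Q ρ r₁ p t' →
        ConditionD Ω ρ r₁ q c₀ →
      ∀ (b c d e f g h : Eucl n → ℝ)
        (A : Eucl n → ℝ → Eucl n → Eucl n) (B : Eucl n → ℝ → Eucl n → ℝ)
        (u : Eucl n → ℝ) (v : Eucl n → Eucl n),
        StructuralConditions Ω Q p a γ ψ δ b c d e f g h A B →
        IsWeakSolution Ω Q p A B u v →
      ∀ y ∈ Ω, ∀ r : ℝ, 0 < r → r ≤ 1 → r < τ * r₁ y →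
        MemLp b (ENNReal.ofReal (p.conjExponent * σ.conjExponent))
          (volume.restrict (rhoBall Ω ρ y r)) →
        MemLp e (ENNReal.ofReal (p.conjExponent * σ.conjExponent))
          (volume.restrict (rhoBall Ω ρ y r)) →
        MemLp c (ENNReal.ofReal (p * σ.conjExponent * (1 + ε)))
          (volume.restrict (rhoBall Ω ρ y r)) →
        MemLp d (ENNReal.ofReal (σ.conjExponent * (1 + ε)))
          (volume.restrict (rhoBall Ω ρ y r)) →
        MemLp f (ENNReal.ofReal (σ.conjExponent * (1 + ε)))
          (volume.restrict (rhoBall Ω ρ y r)) →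
        MemLp h (ENNReal.ofReal (σ.conjExponent * (1 + ε)))
          (volume.restrict (rhoBall Ω ρ y r)) →
        MemLp g (ENNReal.ofReal (σ.conjExponent * (1 + ε)))
          (volume.restrict (rhoBall Ω ρ y r)) →
        eLpNorm b (ENNReal.ofReal (p.conjExponent * σ.conjExponent))
          (volume.restrict (rhoBall Ω ρ y r)) ≤ M →
        eLpNorm c (ENNReal.ofReal (p * σ.conjExponent * (1 + ε)))
          (volume.restrict (rhoBall Ω ρ y r)) ≤ M →
        eLpNorm d (ENNReal.ofReal (σ.conjExponent * (1 + ε)))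
          (volume.restrict (rhoBall Ω ρ y r)) ≤ M →
        eLpNorm h (ENNReal.ofReal (σ.conjExponent * (1 + ε)))
          (volume.restrict (rhoBall Ω ρ y r)) ≤ M →
        avgNorm u (ENNReal.ofReal (s * p)) (rhoBall Ω ρ y r) < ∞ ∧
        eLpNorm u ∞ (volume.restrict (rhoBall Ω ρ y (τ * r))) ≤
          C * (avgNorm u (ENNReal.ofReal (s * p)) (rhoBall Ω ρ y r)
            + remainderK p σ ε q (rhoBall Ω ρ y r) r
                (fun x => e x + b x) (fun x => g x + h x) (fun x => f x + c x + d x)) := by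
  have hp0 : 0 < p := by linarith
  have hσc := Real.HolderConjugate.conjExponent hσ
  have hσ' : 0 < σ.conjExponent := hσc.symm.pos
  have hS0 : sStar ≠ 0 := (zero_le.trans_lt hsStar).ne'
  -- The condition `s* > pσ'` is equivalent to `s < σ`, that is, to a genuine gain in each
  -- iteration.
  have hlt : p * (sStar⁻¹).toReal < 1 - σ⁻¹ := by
    have h1 : sStar⁻¹ < ENNReal.ofReal (p * σ.conjExponent)⁻¹ := by
      rw [ENNReal.ofReal_inv_of_pos (by positivity)]
      exact ENNReal.inv_lt_inv.2 hsStar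
    have h2 := (ENNReal.toReal_lt_of_lt_ofReal h1)
    have h3 : σ.conjExponent⁻¹ = 1 - σ⁻¹ := by linarith [hσc.inv_add_inv_eq_one]
    rw [← h3, ← lt_div_iff₀' hp0]
    rwa [mul_inv, mul_comm, ← div_eq_mul_inv] at h2
  have hσi : 0 < σ⁻¹ := by positivity
  have hsi : σ⁻¹ < s⁻¹ := by linarith
  have hs0 : 0 < s := inv_pos.1 (hσi.trans hsi)
  have hsσ : s < σ := (inv_lt_inv₀ (by linarith) hs0).1 hsi
  have hs1 : 1 ≤ s := by
    rw [← inv_le_one₀ hs0]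
    have : 0 ≤ p * (sStar⁻¹).toReal := mul_nonneg hp0.le ENNReal.toReal_nonneg
    linarith
  obtain ⟨M₁, hM₁⟩ := exists_localProblem (a := a) M hp hσ hγ hγp hψ hψp hδ hδp hε hq hqσ hc₀
  obtain ⟨C, hC⟩ := exists_moser_const n hp hσ ha hε hs1 hsσ
    (sStar_inv_add hp0 hs0 hS0 hs) CSob M₁ N CCut
  refine ⟨C, fun Ω Q ρ r₁ t t' hΩ hQ hρ hr₁ hSob htt hcut hloc hD b c d e f g h A B u v hst hu
    y hy r hr hr1 hrτ hb he hc hd hf hh hg hbM hcM hdM hhM => ?_⟩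
  have hry : r < r₁ y := hrτ.trans_le (by nlinarith [(hr₁ y hy).1])
  set S := rhoBall Ω ρ y r with hS
  have hSΩ : S ⊆ Ω := fun x hx => hx.1
  obtain ⟨hcpt, -⟩ := (hr₁ y hy).2 r hr hry
  have hfin : volume S < ∞ := (measure_mono subset_closure).trans_lt hcpt.measure_lt_top
  have : IsFiniteMeasure (volume.restrict S) := ⟨by simpa using hfin⟩
  have hvol : ENNReal.ofReal (c₀ * r ^ q) ≤ volume S := hD.le_volume hy hr hr1 hry
  have hvol0 : volume S ≠ 0 :=
    ((ENNReal.ofReal_pos.2 (by positivity : 0 < c₀ * r ^ q)).trans_le hvol).ne'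
  have hum : MemLp u (ENNReal.ofReal (p * σ)) (volume.restrict S) := by
    refine hu.1.memLp_mul_sigma hp hσ hτ hΩ hQ hr₁ hSob htt hcut hloc hy hr hrτ fun h0 => hvol0 ?_
    have hsub : S ⊆ rhoBall Ω ρ y (r / τ) := fun x hx =>
      ⟨hx.1, hx.2.trans_le (le_div_self hr.le hτ hτ1.le)⟩
    exact measure_mono_null hsub h0
  have hup : avgNorm u (ENNReal.ofReal (s * p)) S < ∞ :=
    avgNorm_lt_top hvol0 (by positivity)
      (hum.mono_exponent (ENNReal.ofReal_le_ofReal (by nlinarith)))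
  refine ⟨hup, ?_⟩
  set K := remainderK p σ ε q S r (fun x => e x + b x) (fun x => g x + h x)
    (fun x => f x + c x + d x) with hKdef
  have hc₂ : MemLp c (ENNReal.ofReal (σ.conjExponent * (1 + ε))) (volume.restrict S) :=
    hc.mono_exponent (ENNReal.ofReal_le_ofReal (by
      nlinarith [mul_pos hσ' (by linarith : 0 < 1 + ε)]))
  have hKt : K ≠ ∞ := by
    have i1 : 0 ≤ 1 / (p - 1) := one_div_nonneg.2 (by linarith)
    have i2 : 0 ≤ 1 / p := by positivity
    have h1 := ENNReal.rpow_ne_top_of_nonneg i1 (he.add hb).2.ne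
    have h2 := ENNReal.rpow_ne_top_of_nonneg i2 (hg.add hh).2.ne
    have h3 := ENNReal.rpow_ne_top_of_nonneg i1 ((hf.add hc₂).add hd).2.ne
    exact ENNReal.mul_ne_top ENNReal.ofReal_ne_top (ENNReal.add_ne_top.2 ⟨ENNReal.add_ne_top.2
      ⟨h1, ENNReal.mul_ne_top ENNReal.ofReal_ne_top h2⟩,
        ENNReal.mul_ne_top ENNReal.ofReal_ne_top h3⟩)
  obtain ⟨η, hη, hηt⟩ := hcut y hy r hr hry
  -- The shift must be positive even when the remainder vanishes; `κ` is removed by a limit at the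
  -- end.
  have hbound : ∀ κ : ℝ, 0 < κ → eLpNorm u ∞ (volume.restrict (rhoBall Ω ρ y (τ * r))) ≤
      C * (avgNorm u (ENNReal.ofReal (s * p)) S + (K + ENNReal.ofReal κ)) := by
    intro κ hκ
    have hk : 0 < K.toReal + κ := by positivity
    have hKk : ENNReal.ofReal (K.toReal + κ) = K + ENNReal.ofReal κ := by
      rw [ENNReal.ofReal_add ENNReal.toReal_nonneg hκ.le, ENNReal.ofReal_toReal hKt]
    have H := hM₁ hΩ hQ hSΩ hvol hfin hr hr1 hk (hSob y hy r hr hry) htt (hloc y hy r hr hry) hu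
      hum hst hb he hc hd hf hh hg hbM hcM hdM hhM (by rw [hKk]; exact le_self_add)
    have h1 := hC Ω Q ρ τ y r _ t t' A B u v _ _ _ _ η H hcpt hη hηt
    -- `U ≤ |u| + k`, and the normalized norm of the constant `k` is `k` itself.
    have h2 : avgNorm (fun x => shiftAbs (K.toReal + κ) (u x)) (ENNReal.ofReal (p * s)) S ≤
        avgNorm u (ENNReal.ofReal (s * p)) S + (K + ENNReal.ofReal κ) := by
      have hac : (volume S)⁻¹ • volume.restrict S ≪ volume.restrict S :=
        Measure.smul_absolutelyContinuous
      have hps : 1 ≤ s * p := by nlinarith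
      rw [mul_comm p s, avgNorm]
      refine (eLpNorm_mono_real fun x => ?_).trans ((eLpNorm_add_le
        (hum.1.mono_ac hac).norm (aestronglyMeasurable_const (b := K.toReal + κ))
        (ENNReal.one_le_ofReal_of_one_le hps)).trans (add_le_add ?_ ?_))
      · rw [Real.norm_of_nonneg (shiftAbs_pos hk _).le]
        exact shiftAbs_le hk _
      · rw [eLpNorm_norm]; rfl
      · refine (eLpNorm_const' _ (by simpa using hps.trans_lt' one_pos)
          ENNReal.ofReal_ne_top).trans_le ?_
        rw [Measure.smul_apply, Measure.restrict_apply_univ, smul_eq_mul,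
          ENNReal.inv_mul_cancel hvol0 hfin.ne, ENNReal.one_rpow, mul_one,
          Real.enorm_of_nonneg hk.le, hKk]
    rw [eLpNorm_exponent_top]
    refine eLpNormEssSup_le_of_ae_enorm_bound ?_
    filter_upwards [h1] with x hx
    refine le_trans ?_ (hx.trans (mul_le_mul_right h2 _))
    rw [enorm_le_iff_norm_le, Real.norm_of_nonneg (shiftAbs_pos hk _).le]
    exact abs_le_shiftAbs _ _
  have hlim : Tendsto (fun κ : ℝ => (C : ℝ≥0∞) * (avgNorm u (ENNReal.ofReal (s * p)) S +
      (K + ENNReal.ofReal κ))) (𝓝[>] 0)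
      (𝓝 (C * (avgNorm u (ENNReal.ofReal (s * p)) S + (K + ENNReal.ofReal 0)))) :=
    ENNReal.Tendsto.const_mul (((ENNReal.continuous_ofReal.tendsto 0).const_add K).const_add _
      |>.mono_left nhdsWithin_le_nhds) (Or.inr ENNReal.coe_ne_top)
  rw [ENNReal.ofReal_zero, add_zero] at hlim
  exact ge_of_tendsto hlim (by filter_upwards [self_mem_nhdsWithin] with κ hκ using hbound κ hκ)
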